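/- **Theorem.** Let $R>0$ and let $M=\{x^2+y^2+z^2=R^2\}\subset\mathbb R^3$ with the induced Riemannian metric $g=R^2(d\theta^2+\sin^2\theta\,d\phi^2)$. Let $L$ be the Hermitian line bundle on $M$ with Hermitian connection $\nabla^L$ of curvature $R^L=-iF$, where $F=\tfrac12\sin\theta\,d\theta\wedge d\phi$ is the monopole field with $B=1/2$. For $N\in\mathbb N$ let $\Delta^{L^N}=(\nabla^{L^N})^*\nabla^{L^N}$ be the magnetic Laplacian on $C^\infty(M,L^N)$, $L^N=L^{\otimes N}$; let $\nu_{N,j}$, $j=0,1,2,\dots$, be its eigenvalues taken with multiplicities (such an enumeration exists), and put $\lambda_{N,j}=\sqrt{\nu_{N,j}+N^2}$. For $E>1$ and a Schwartz function $\varphi\in\mathcal S(\mathbb R)$ put $$Y_N(\varphi)=\sum_{j=0}^\infty\varphi(\lambda_{N,j}-EN),\qquad \hat\varphi(\xi)=\int_{\mathbb R}\varphi(x)e^{-i\xi x}\,dx,$$ $$D=\sqrt{E^2-1+\tfrac1{4R^2}},\qquad \tau_k=\frac{2\pi ERk}{D},\qquad \varepsilon_k(N)=\exp(\pi ik(N+1))\exp(-2\pi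 ikRDN)\quad(k\in\mathbb Z).$$ Then, for every $E>1$ and every $\varphi\in\mathcal S(\mathbb R)$, the series $Y_N(\varphi)$ converges absolutely, and there are coefficients $c_j(N,\varphi)$, $j=0,1,2,\dots$, each bounded in $N$, with $$Y_N(\varphi)\sim\sum_{j=0}^\infty c_j(N,\varphi)N^{1-j},\qquad N\to\infty,$$ that is, $Y_N(\varphi)-\sum_{j<J}c_j(N,\varphi)N^{1-j}=O(N^{1-J})$ for every $J\ge0$. The coefficients are explicit: for every $j$ there are finitely many polynomials $q_{j,0},\dots,q_{j,d_j-1}\in\mathbb C[X]$, depending only on $R$ and $E$, such that for all $\varphi$ and $N$ $$c_j(N,\varphi)=\sum_{k\in\mathbb Z}\Big[\sum_{l<d_j}q_{j,l}(k)\,\hat\varphi^{(l)}(\tau_k)\Big]\varepsilon_k(N).$$ The first two coefficients are $$c_0(N,\varphi)=\sum_{k\in\mathbb Z}2ER^2\,\hat\varphi(\tau_k)\,\varepsilon_k(N),$$ $$c_1(N,\varphi)=\sum_{k\in\mathbb Z}\Big[2iR^2\hat\varphi'(\tau_k)-\frac{\pi ER(4R^2-1)k}{2D^3}\,i\,\hat\varphi''(\tau_k)-\frac{\pi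 iERk}{2D}\,\hat\varphi(\tau_k)\Big]\varepsilon_k(N).$$ In particular, when $R=1/2$, $$c_0(N,\varphi)=\sum_{k\in\mathbb Z}\frac E2\,\hat\varphi(\pi k)\exp(\pi ik(N+1))\exp(-\pi ikEN),$$ $$c_1(N,\varphi)=\sum_{k\in\mathbb Z}\Big[\frac i2\,\hat\varphi'(\pi k)-\frac{\pi ik}4\,\hat\varphi(\pi k)\Big]\exp(\pi ik(N+1))\exp(-\pi ikEN).$$ All these series over $k$ converge absolutely. -/

import Mathlib

open scoped ContDiff

noncomputable section

namespace Monopole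

/-- The partial derivative `∂f/∂x^j` of a function of `n` real variables. -/
def partialDeriv {n : ℕ} {V : Type*} [NormedAddCommGroup V] [NormedSpace ℝ V]
    (j : Fin n) (f : (Fin n → ℝ) → V) (x : Fin n → ℝ) : V :=
  fderiv ℝ f x (Pi.single j 1)

/-- The covariant derivative `∂_j - i N A_j` of the `N`-th tensor power of a Hermitian line bundle,
in a unitary trivialization in which the connection is `d - i A`. -/
def covDeriv {n : ℕ} (A : (Fin n → ℝ) → Fin n → ℝ) (N : ℕ) (j : Fin n)
    (u : (Fin n → ℝ) → ℂ) (x : Fin n → ℝ) : ℂ :=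
  partialDeriv j u x - Complex.I * (N : ℂ) * ((A x j : ℝ) : ℂ) * u x

/-- The magnetic (Bochner) Laplacian of the `N`-th tensor power of a Hermitian line bundle, in local
coordinates with metric tensor `g` and in a unitary trivialization with connection `d - i A`:
`-|g|^{-1/2} ∑_{j,l} (∂_j - i N A_j) [ |g|^{1/2} g^{jl} (∂_l - i N A_l) u ]`. -/
def magneticLaplacian {n : ℕ} (g : (Fin n → ℝ) → Matrix (Fin n) (Fin n) ℝ)
    (A : (Fin n → ℝ) → Fin n → ℝ) (N : ℕ) (u : (Fin n → ℝ) → ℂ) (x : Fin n → ℝ) : ℂ :=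
  -(((1 / √((g x).det) : ℝ) : ℂ) *
    ∑ j, ∑ l, covDeriv A N j
      (fun y => ((√((g y).det) * (g y)⁻¹ j l : ℝ) : ℂ) * covDeriv A N l u y) x)

/-- The metric tensor induced by the Euclidean metric of `ℝ^m` through a parametrization `σ`. -/
def inducedMetric {n m : ℕ} (σ : (Fin n → ℝ) → Fin m → ℝ) (x : Fin n → ℝ) :
    Matrix (Fin n) (Fin n) ℝ :=
  Matrix.of fun j l => partialDeriv j σ x ⬝ᵥ partialDeriv l σ x

/-- Stereographic parametrization of the sphere of radius `R` in `ℝ³` minus the south pole; the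
origin goes to the north pole. In spherical coordinates `(θ, ϕ)`, `x₀ + i x₁ = tan(θ/2) e^{iϕ}`. -/
def northParam (R : ℝ) (x : Fin 2 → ℝ) : Fin 3 → ℝ :=
  (R / (1 + x 0 ^ 2 + x 1 ^ 2)) • ![2 * x 0, 2 * x 1, 1 - x 0 ^ 2 - x 1 ^ 2]

/-- Stereographic parametrization of the sphere of radius `R` in `ℝ³` minus the north pole; the
origin goes to the south pole. In spherical coordinates `(θ, ϕ)`, `x₀ + i x₁ = cot(θ/2) e^{-iϕ}`. -/
def southParam (R : ℝ) (x : Fin 2 → ℝ) : Fin 3 → ℝ :=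
  (R / (1 + x 0 ^ 2 + x 1 ^ 2)) • ![2 * x 0, -(2 * x 1), x 0 ^ 2 + x 1 ^ 2 - 1]

/-- The potential of the monopole field `F = (1/2) sin θ dθ ∧ dϕ` in either of the two stereographic
coordinate systems: `A = (x₀ dx₁ - x₁ dx₀) / (1 + x₀² + x₁²)`. It is `(1/2)(1 - cos θ) dϕ` in the
first one and `-(1/2)(1 + cos θ) dϕ` in the second one, and `dA = F` in both. -/
def monopolePotential (x : Fin 2 → ℝ) : Fin 2 → ℝ :=
  ![-(x 1) / (1 + x 0 ^ 2 + x 1 ^ 2), x 0 / (1 + x 0 ^ 2 + x 1 ^ 2)]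

/-- The transition function `e^{-iϕ}` of the monopole line bundle `L`, from the trivialization over
the first coordinate domain to the one over the second, in the coordinates of the first one. -/
def transition (x : Fin 2 → ℝ) : ℂ :=
  ((x 0 : ℂ) - Complex.I * (x 1 : ℂ)) / ((√(x 0 ^ 2 + x 1 ^ 2) : ℝ) : ℂ)

/-- The space `C^∞(M, L^N)` of smooth sections of the `N`-th power of the monopole line bundle over
the sphere `M` of radius `R`: pairs of smooth functions, the expressions of the section in the two
trivializations, related by `u₁ = e^{-iNϕ} u₀` at the points of the sphere covered by both. -/
def smoothSections (R : ℝ) (N : ℕ) :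
    Submodule ℂ (((Fin 2 → ℝ) → ℂ) × ((Fin 2 → ℝ) → ℂ)) where
  carrier := {u | ContDiff ℝ ∞ u.1 ∧ ContDiff ℝ ∞ u.2 ∧
    ∀ x y, northParam R x = southParam R y → u.2 y = transition x ^ N * u.1 x}
  add_mem' := by
    rintro u v ⟨hu1, hu2, hu⟩ ⟨hv1, hv2, hv⟩
    refine ⟨hu1.add hv1, hu2.add hv2, fun x y h => ?_⟩
    simp only [Prod.snd_add, Prod.fst_add, Pi.add_apply, hu x y h, hv x y h]
    ring
  zero_mem' := ⟨contDiff_const, contDiff_const, fun x y _ => by simp⟩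
  smul_mem' := by
    rintro c u ⟨hu1, hu2, hu⟩
    refine ⟨hu1.const_smul c, hu2.const_smul c, fun x y h => ?_⟩
    simp only [Prod.smul_snd, Prod.smul_fst, Pi.smul_apply, smul_eq_mul, hu x y h]
    ring

/-- The expression of `Δ^{L^N}` in the first trivialization. -/
def northLaplacian (R : ℝ) (N : ℕ) : ((Fin 2 → ℝ) → ℂ) → (Fin 2 → ℝ) → ℂ :=
  magneticLaplacian (inducedMetric (northParam R)) monopolePotential N

/-- The expression of `Δ^{L^N}` in the second trivialization. -/
def southLaplacian (R : ℝ) (N : ℕ) : ((Fin 2 → ℝ) → ℂ) → (Fin 2 → ℝ) → ℂ :=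
  magneticLaplacian (inducedMetric (southParam R)) monopolePotential N

section Linearity

variable {n : ℕ}

theorem contDiff_covDeriv {A : (Fin n → ℝ) → Fin n → ℝ} (hA : ∀ j, ContDiff ℝ ∞ fun x => A x j)
    (N : ℕ) (j : Fin n) {u : (Fin n → ℝ) → ℂ} (hu : ContDiff ℝ ∞ u) :
    ContDiff ℝ ∞ (covDeriv A N j u) := by
  have h1 : ContDiff ℝ ∞ fun x => fderiv ℝ u x (Pi.single j 1) :=
    (hu.fderiv_right (m := ∞) (by simp)).clm_apply contDiff_const
  have h2 : ContDiff ℝ ∞ fun x => ((A x j : ℝ) : ℂ) := Complex.ofRealCLM.contDiff.comp (hA j)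
  exact h1.sub ((contDiff_const.mul h2).mul hu)

theorem covDeriv_add (A : (Fin n → ℝ) → Fin n → ℝ) (N : ℕ) (j : Fin n)
    {u v : (Fin n → ℝ) → ℂ} (hu : Differentiable ℝ u) (hv : Differentiable ℝ v) :
    covDeriv A N j (u + v) = covDeriv A N j u + covDeriv A N j v := by
  funext x
  simp only [covDeriv, partialDeriv, fderiv_add (hu x) (hv x), Pi.add_apply,
    add_apply]
  ring

theorem covDeriv_smul (A : (Fin n → ℝ) → Fin n → ℝ) (N : ℕ) (j : Fin n) (c : ℂ)
    {u : (Fin n → ℝ) → ℂ} (hu : Differentiable ℝ u) :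
    covDeriv A N j (c • u) = c • covDeriv A N j u := by
  funext x
  simp only [covDeriv, partialDeriv, fderiv_const_smul (hu x) c, Pi.smul_apply,
    smul_apply, smul_eq_mul]
  ring

theorem magneticLaplacian_add {g : (Fin n → ℝ) → Matrix (Fin n) (Fin n) ℝ}
    {A : (Fin n → ℝ) → Fin n → ℝ} (hA : ∀ j, ContDiff ℝ ∞ fun x => A x j)
    (hg : ∀ j l, ContDiff ℝ ∞ fun y => √((g y).det) * (g y)⁻¹ j l) (N : ℕ)
    {u v : (Fin n → ℝ) → ℂ} (hu : ContDiff ℝ ∞ u) (hv : ContDiff ℝ ∞ v) :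
    magneticLaplacian g A N (u + v) = magneticLaplacian g A N u + magneticLaplacian g A N v := by
  have key : ∀ (w : (Fin n → ℝ) → ℂ), ContDiff ℝ ∞ w → ∀ j l, Differentiable ℝ
      (fun y => ((√((g y).det) * (g y)⁻¹ j l : ℝ) : ℂ) * covDeriv A N l w y) := fun w hw j l =>
    ((Complex.ofRealCLM.contDiff.comp (hg j l)).mul
      (contDiff_covDeriv hA N l hw)).differentiable (by simp)
  funext x
  have h : ∀ j l, covDeriv A N j
      (fun y => ((√((g y).det) * (g y)⁻¹ j l : ℝ) : ℂ) * covDeriv A N l (u + v) y) x =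
      covDeriv A N j
        (fun y => ((√((g y).det) * (g y)⁻¹ j l : ℝ) : ℂ) * covDeriv A N l u y) x +
      covDeriv A N j
        (fun y => ((√((g y).det) * (g y)⁻¹ j l : ℝ) : ℂ) * covDeriv A N l v y) x := by
    intro j l
    rw [← Pi.add_apply, ← covDeriv_add A N j (key u hu j l) (key v hv j l),
      covDeriv_add A N l (hu.differentiable (by simp)) (hv.differentiable (by simp))]
    congr 1
    funext y
    simp only [Pi.add_apply]
    ring
  simp only [magneticLaplacian, h, Finset.sum_add_distrib, Pi.add_apply]
  ring

theorem magneticLaplacian_smul {g : (Fin n → ℝ) → Matrix (Fin n) (Fin n) ℝ}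
    {A : (Fin n → ℝ) → Fin n → ℝ} (hA : ∀ j, ContDiff ℝ ∞ fun x => A x j)
    (hg : ∀ j l, ContDiff ℝ ∞ fun y => √((g y).det) * (g y)⁻¹ j l) (N : ℕ) (c : ℂ)
    {u : (Fin n → ℝ) → ℂ} (hu : ContDiff ℝ ∞ u) :
    magneticLaplacian g A N (c • u) = c • magneticLaplacian g A N u := by
  funext x
  have h : ∀ j l, covDeriv A N j
      (fun y => ((√((g y).det) * (g y)⁻¹ j l : ℝ) : ℂ) * covDeriv A N l (c • u) y) x =
      c * covDeriv A N j
        (fun y => ((√((g y).det) * (g y)⁻¹ j l : ℝ) : ℂ) * covDeriv A N l u y) x := by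
    intro j l
    have key : Differentiable ℝ
        (fun y => ((√((g y).det) * (g y)⁻¹ j l : ℝ) : ℂ) * covDeriv A N l u y) :=
      ((Complex.ofRealCLM.contDiff.comp (hg j l)).mul
        (contDiff_covDeriv hA N l hu)).differentiable (by simp)
    rw [← smul_eq_mul, ← Pi.smul_apply, ← covDeriv_smul A N j c key,
      covDeriv_smul A N l c (hu.differentiable (by simp))]
    congr 1
    funext y
    simp only [Pi.smul_apply, smul_eq_mul]
    ring
  simp only [magneticLaplacian, h, ← Finset.mul_sum, Pi.smul_apply, smul_eq_mul]
  ring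

end Linearity

theorem one_add_pos (x : Fin 2 → ℝ) : 0 < 1 + x 0 ^ 2 + x 1 ^ 2 := by positivity

theorem contDiff_monopolePotential (j : Fin 2) : ContDiff ℝ ∞ fun x => monopolePotential x j := by
  have h0 : ∀ x : Fin 2 → ℝ, 1 + x 0 ^ 2 + x 1 ^ 2 ≠ 0 := fun x => (one_add_pos x).ne'
  fin_cases j <;> simp only [monopolePotential, Fin.mk_one, Fin.zero_eta, Matrix.cons_val_zero,
    Matrix.cons_val_one] <;> fun_prop (disch := assumption)

theorem contDiff_northParam (R : ℝ) : ContDiff ℝ ∞ (northParam R) := by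
  have h0 : ∀ x : Fin 2 → ℝ, 1 + x 0 ^ 2 + x 1 ^ 2 ≠ 0 := fun x => (one_add_pos x).ne'
  rw [contDiff_pi]
  intro i
  fin_cases i <;> simp [northParam] <;> fun_prop (disch := assumption)

theorem contDiff_southParam (R : ℝ) : ContDiff ℝ ∞ (southParam R) := by
  have h0 : ∀ x : Fin 2 → ℝ, 1 + x 0 ^ 2 + x 1 ^ 2 ≠ 0 := fun x => (one_add_pos x).ne'
  rw [contDiff_pi]
  intro i
  fin_cases i <;> simp [southParam] <;> fun_prop (disch := assumption)

theorem partialDeriv_apply_eq_deriv {n m : ℕ} {σ : (Fin n → ℝ) → Fin m → ℝ}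
    (hσ : Differentiable ℝ σ) (j : Fin n) (x : Fin n → ℝ) (i : Fin m) :
    partialDeriv j σ x i = deriv (fun t : ℝ => σ (x + t • Pi.single j 1) i) 0 := by
  have h1 : HasDerivAt (fun t : ℝ => x + t • (Pi.single j 1 : Fin n → ℝ)) (Pi.single j 1) 0 := by
    simpa using ((hasDerivAt_id (0 : ℝ)).smul_const (Pi.single j 1 : Fin n → ℝ)).const_add x
  have h2 : HasFDerivAt σ (fderiv ℝ σ x) (x + (0 : ℝ) • (Pi.single j 1 : Fin n → ℝ)) := by
    simpa using (hσ x).hasFDerivAt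
  have h3 := hasDerivAt_pi.1 (h2.comp_hasDerivAt (0 : ℝ) h1) i
  exact h3.deriv.symm

theorem deriv_div_mul_zero (R : ℝ) {p q : ℝ → ℝ} {p' q' : ℝ} (hp : HasDerivAt p p' 0)
    (hq : HasDerivAt q q' 0) (h0 : q 0 ≠ 0) :
    deriv (fun t => R / q t * p t) 0 = R * (p' * q 0 - p 0 * q') / q 0 ^ 2 := by
  rw [(((hasDerivAt_const (0 : ℝ) R).fun_div hq h0).fun_mul hp).deriv]
  field_simp
  ring

theorem hasDerivAt_sq_shift (a : ℝ) : HasDerivAt (fun t : ℝ => (a + t) ^ 2) (2 * a) 0 := by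
  simpa using ((hasDerivAt_id (0 : ℝ)).const_add a).fun_pow 2

theorem partialDeriv_zero_northParam (R : ℝ) (x : Fin 2 → ℝ) :
    partialDeriv 0 (northParam R) x = (2 * R / (1 + x 0 ^ 2 + x 1 ^ 2) ^ 2) •
      ![1 - x 0 ^ 2 + x 1 ^ 2, -(2 * x 0 * x 1), -(2 * x 0)] := by
  have h0 : 1 + (x 0 + 0) ^ 2 + x 1 ^ 2 ≠ 0 := by simpa using (one_add_pos x).ne'
  have hs := hasDerivAt_sq_shift (x 0)
  have hq : HasDerivAt (fun t : ℝ => 1 + (x 0 + t) ^ 2 + x 1 ^ 2) (2 * x 0) 0 :=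
    (hs.const_add 1).add_const _
  have hp0 : HasDerivAt (fun t : ℝ => 2 * (x 0 + t)) 2 0 := by
    simpa using ((hasDerivAt_id (0 : ℝ)).const_add (x 0)).const_mul 2
  have hp2 : HasDerivAt (fun t : ℝ => 1 - (x 0 + t) ^ 2 - x 1 ^ 2) (-(2 * x 0)) 0 :=
    (hs.const_sub 1).sub_const _
  have hd0 := deriv_div_mul_zero R hp0 hq h0
  have hd1 := deriv_div_mul_zero R (hasDerivAt_const (0 : ℝ) (2 * x 1)) hq h0
  have hd2 := deriv_div_mul_zero R hp2 hq h0
  funext i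
  rw [partialDeriv_apply_eq_deriv ((contDiff_northParam R).differentiable (by simp))]
  fin_cases i
  · simp [northParam] at hd0 ⊢
    rw [hd0]; ring
  · simp [northParam] at hd1 ⊢
    rw [hd1]; ring
  · simp [northParam] at hd2 ⊢
    rw [hd2]; ring

theorem partialDeriv_one_northParam (R : ℝ) (x : Fin 2 → ℝ) :
    partialDeriv 1 (northParam R) x = (2 * R / (1 + x 0 ^ 2 + x 1 ^ 2) ^ 2) •
      ![-(2 * x 0 * x 1), 1 + x 0 ^ 2 - x 1 ^ 2, -(2 * x 1)] := by
  have h0 : 1 + x 0 ^ 2 + (x 1 + 0) ^ 2 ≠ 0 := by simpa using (one_add_pos x).ne'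
  have hs := hasDerivAt_sq_shift (x 1)
  have hq : HasDerivAt (fun t : ℝ => 1 + x 0 ^ 2 + (x 1 + t) ^ 2) (2 * x 1) 0 := hs.const_add _
  have hp1 : HasDerivAt (fun t : ℝ => 2 * (x 1 + t)) 2 0 := by
    simpa using ((hasDerivAt_id (0 : ℝ)).const_add (x 1)).const_mul 2
  have hp2 : HasDerivAt (fun t : ℝ => 1 - x 0 ^ 2 - (x 1 + t) ^ 2) (-(2 * x 1)) 0 :=
    hs.const_sub _
  have hd0 := deriv_div_mul_zero R (hasDerivAt_const (0 : ℝ) (2 * x 0)) hq h0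
  have hd1 := deriv_div_mul_zero R hp1 hq h0
  have hd2 := deriv_div_mul_zero R hp2 hq h0
  funext i
  rw [partialDeriv_apply_eq_deriv ((contDiff_northParam R).differentiable (by simp))]
  fin_cases i
  · simp [northParam] at hd0 ⊢
    rw [hd0]; ring
  · simp [northParam] at hd1 ⊢
    rw [hd1]; ring
  · simp [northParam] at hd2 ⊢
    rw [hd2]; ring

theorem inducedMetric_northParam (R : ℝ) (x : Fin 2 → ℝ) :
    inducedMetric (northParam R) x = (4 * R ^ 2 / (1 + x 0 ^ 2 + x 1 ^ 2) ^ 2) • 1 := by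
  have h0 := (one_add_pos x).ne'
  ext j l
  fin_cases j <;> fin_cases l <;>
    simp [inducedMetric, partialDeriv_zero_northParam, partialDeriv_one_northParam, dotProduct,
      Fin.sum_univ_three] <;> field_simp <;> ring

theorem southParam_apply (R : ℝ) (i : Fin 3) (x : Fin 2 → ℝ) :
    southParam R x i = (![1, -1, -1] : Fin 3 → ℝ) i * northParam R x i := by
  fin_cases i <;> simp [southParam, northParam] <;> ring

theorem partialDeriv_southParam (R : ℝ) (j : Fin 2) (x : Fin 2 → ℝ) (i : Fin 3) :
    partialDeriv j (southParam R) x i =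
      (![1, -1, -1] : Fin 3 → ℝ) i * partialDeriv j (northParam R) x i := by
  rw [partialDeriv_apply_eq_deriv ((contDiff_northParam R).differentiable (by simp)),
    partialDeriv_apply_eq_deriv ((contDiff_southParam R).differentiable (by simp))]
  simp only [southParam_apply]
  exact deriv_const_mul_field _

theorem inducedMetric_southParam (R : ℝ) (x : Fin 2 → ℝ) :
    inducedMetric (southParam R) x = (4 * R ^ 2 / (1 + x 0 ^ 2 + x 1 ^ 2) ^ 2) • 1 := by
  rw [← inducedMetric_northParam]
  ext j l
  simp [inducedMetric, partialDeriv_southParam, dotProduct, Fin.sum_univ_three]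

theorem contDiff_coeff {g : (Fin 2 → ℝ) → Matrix (Fin 2) (Fin 2) ℝ} {R : ℝ}
    (hg : ∀ x, g x = (4 * R ^ 2 / (1 + x 0 ^ 2 + x 1 ^ 2) ^ 2) • 1) (j l : Fin 2) :
    ContDiff ℝ ∞ fun y => √((g y).det) * (g y)⁻¹ j l := by
  have h : (fun y => √((g y).det) * (g y)⁻¹ j l) =
      fun _ => if R = 0 then 0 else (1 : Matrix (Fin 2) (Fin 2) ℝ) j l := by
    funext y
    rw [hg]
    split_ifs with hR
    · simp [hR]
    · have hpos : 0 < 4 * R ^ 2 / (1 + y 0 ^ 2 + y 1 ^ 2) ^ 2 := by positivity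
      rw [Matrix.det_smul, Matrix.det_one, mul_one, Fintype.card_fin, Real.sqrt_sq hpos.le,
        Matrix.inv_eq_right_inv (B := (4 * R ^ 2 / (1 + y 0 ^ 2 + y 1 ^ 2) ^ 2)⁻¹ • 1)
          (by rw [Matrix.smul_mul, Matrix.mul_smul, smul_smul, mul_inv_cancel₀ hpos.ne', one_smul,
            Matrix.one_mul]),
        Matrix.smul_apply, smul_eq_mul, mul_inv_cancel_left₀ hpos.ne']
  rw [h]
  exact contDiff_const

/-- The space of the smooth sections `u` of `L^N` with `Δ^{L^N} u = μ u`, where `L` is the monopole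
line bundle over the sphere of radius `R`. -/
def eigenspace (R : ℝ) (N : ℕ) (μ : ℂ) :
    Submodule ℂ (((Fin 2 → ℝ) → ℂ) × ((Fin 2 → ℝ) → ℂ)) where
  carrier := {u | u ∈ smoothSections R N ∧
    northLaplacian R N u.1 = μ • u.1 ∧ southLaplacian R N u.2 = μ • u.2}
  add_mem' := by
    rintro u v ⟨hu, hu1, hu2⟩ ⟨hv, hv1, hv2⟩
    refine ⟨add_mem hu hv, ?_, ?_⟩
    · rw [Prod.fst_add, smul_add, ← hu1, ← hv1]
      exact magneticLaplacian_add contDiff_monopolePotential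
        (contDiff_coeff (inducedMetric_northParam R)) N hu.1 hv.1
    · rw [Prod.snd_add, smul_add, ← hu2, ← hv2]
      exact magneticLaplacian_add contDiff_monopolePotential
        (contDiff_coeff (inducedMetric_southParam R)) N hu.2.1 hv.2.1
  zero_mem' := by
    have hz : ∀ {g : (Fin 2 → ℝ) → Matrix (Fin 2) (Fin 2) ℝ}
        (_ : ∀ j l, ContDiff ℝ ∞ fun y => √((g y).det) * (g y)⁻¹ j l),
        magneticLaplacian g monopolePotential N (0 : (Fin 2 → ℝ) → ℂ) = 0 := fun hg => by
      simpa using magneticLaplacian_smul contDiff_monopolePotential hg N 0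
        (u := (0 : (Fin 2 → ℝ) → ℂ)) contDiff_const
    refine ⟨zero_mem _, ?_, ?_⟩
    · rw [Prod.fst_zero, smul_zero]
      exact hz (contDiff_coeff (inducedMetric_northParam R))
    · rw [Prod.snd_zero, smul_zero]
      exact hz (contDiff_coeff (inducedMetric_southParam R))
  smul_mem' := by
    rintro c u ⟨hu, hu1, hu2⟩
    refine ⟨Submodule.smul_mem _ c hu, ?_, ?_⟩
    · rw [Prod.smul_fst, smul_comm, ← hu1]
      exact magneticLaplacian_smul contDiff_monopolePotential
        (contDiff_coeff (inducedMetric_northParam R)) N c hu.1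
    · rw [Prod.smul_snd, smul_comm, ← hu2]
      exact magneticLaplacian_smul contDiff_monopolePotential
        (contDiff_coeff (inducedMetric_southParam R)) N c hu.2.1

/-- `ν 0, ν 1, …` are the eigenvalues of `Δ^{L^N}` taken with multiplicities: each complex number
occurs in the sequence as many times as the dimension of its eigenspace says. -/
def IsEigenvalueSequence (R : ℝ) (N : ℕ) (ν : ℕ → ℝ) : Prop :=
  ∀ μ : ℂ, Module.rank ℂ (eigenspace R N μ) = Cardinal.mk {j : ℕ | (ν j : ℂ) = μ}

/-- The summand `φ(λ_{N,j} - E N)`, `λ_{N,j} = √(ν_{N,j} + N²)`, of the sum `Y_N(φ)`. -/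
def traceTerm (E : ℝ) (φ : SchwartzMap ℝ ℂ) (N : ℕ) (ν : ℕ → ℝ) (j : ℕ) : ℂ :=
  φ (√(ν j + (N : ℝ) ^ 2) - E * N)

/-- `Y_N(φ) = ∑_j φ(λ_{N,j} - E N)`. -/
def traceSum (E : ℝ) (φ : SchwartzMap ℝ ℂ) (N : ℕ) (ν : ℕ → ℝ) : ℂ :=
  ∑' j, traceTerm E φ N ν j

/-- The Fourier transform `φ̂(ξ) = ∫ φ(x) e^{-iξx} dx`. -/
def fourierHat (φ : SchwartzMap ℝ ℂ) (ξ : ℝ) : ℂ :=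
  ∫ x : ℝ, φ x * Complex.exp (-(Complex.I * ξ * x))

/-- The quantity `√(E² - 1 + 1/(4R²))`. -/
def speed (R E : ℝ) : ℝ :=
  √(E ^ 2 - 1 + 1 / (4 * R ^ 2))

/-- The point `2πERk / √(E² - 1 + 1/(4R²))`. -/
def period (R E : ℝ) (k : ℤ) : ℝ :=
  2 * Real.pi * E * R * k / speed R E

/-- The phase `exp(πik(N+1)) exp(-2πikR √(E² - 1 + 1/(4R²)) N)`. -/
def phase (R E : ℝ) (k : ℤ) (N : ℕ) : ℂ :=
  Complex.exp (Real.pi * Complex.I * k * (N + 1)) *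
    Complex.exp (-(2 * Real.pi * Complex.I * k * R * speed R E * N))

end Monopole

end

/-! The spectrum can be computed exactly, and the trace is then a sum over a shifted lattice, to
which Poisson summation applies.

Spectrum. In a complex stereographic coordinate, with `ρ = 1 + |z|²`, the Laplacian multiplied by
`R²` is `-ρ² ∇ ∇̄ + N/2`, where `[∇, ∇̄] = N/ρ²`. The operator `ρ ∇̄` (up to a sign in one chart)
sends sections of `L^N` to sections of `L^(N+2)`. It identifies the eigenspace of `α` with that of
`α - (N+1)`, unless `α = N/2` (`nonempty_raiseEquiv`). Iteration pushes the eigenvalue to a negative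
real part, where a Bochner formula and the maximum principle leave only zero
(`chartEigenspace_eq_bot`). A nonzero eigenspace must therefore pass through the exceptional value
of some `L^(N+2n)`. There the eigensections are a fixed weight times polynomials of degree at most
`N+2n`, by Liouville's argument (`rank_chartEigenspace_lowest`). So the eigenvalues are `((n +
(N+1)/2)² - 1/4 - N²/4)/R²`, `n ≥ 0`, with multiplicities `N + 2n + 1`.

Trace. Put `ε = 1/N` and `s = n + (N+1)/2 - R D N`. Since `(R D)² = R²(E² - 1) + 1/4`, the
difference `λ - E N` is a function `x(s, ε)` that is smooth up to `ε = 0`, where it equals `κ s`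
with `κ = D/(R E)`; the multiplicity is `2 N (R D + ε s)`. On the spectrum `|s|` is bounded by a
multiple of `1 + |x|` uniformly in `ε` (`exists_one_add_abs_le_displacement`), so the Taylor
expansion of the summand in `ε` has summable remainders (`exists_symbols`,
`exists_symbolSum_taylor_bound`). Its coefficients `A_j(s)` are Schwartz functions, and extending
their sums from `n ≥ 0` to all integers costs `O(N^(-∞))`, because `n < 0` forces `s ≤ -(R D - 1/2)
N` (`exists_norm_lattice_neg_le`).

The resulting lattice sums of `A_j` are the coefficients `c_j`. Poisson summation (`hasSum_poisson`)
turns them into sums over `k`, the shift of the lattice producing the phase. Each `A_j` is a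
combination of polynomials times derivatives of `φ(κ s)`, so its Fourier transform at `k` is a
combination of derivatives of `φ̂` at `2πk/κ = τ_k` with coefficients polynomial in `k`
(`exists_operators`). The first two are worked out explicitly. -/

namespace Monopole
noncomputable section

/-! ### Wirtinger calculus in a stereographic chart -/

open ComplexConjugate in
/-- The conformal factor `1 + |z|²` of the stereographic chart, as a complex number. -/
def rho (z : ℂ) : ℂ := 1 + z * conj z

/-- The Wirtinger derivative `∂u/∂z`. -/
def dz (u : ℂ → ℂ) (z : ℂ) : ℂ := (fderiv ℝ u z 1 - Complex.I * fderiv ℝ u z Complex.I) / 2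

/-- The Wirtinger derivative `∂u/∂z̄`. -/
def dzbar (u : ℂ → ℂ) (z : ℂ) : ℂ := (fderiv ℝ u z 1 + Complex.I * fderiv ℝ u z Complex.I) / 2

open ComplexConjugate in
/-- The `(1,0)` part of the covariant derivative on the `N`-th power of the monopole bundle. -/
def nabla (N : ℕ) (u : ℂ → ℂ) (z : ℂ) : ℂ := dz u z - N / 2 * (conj z / rho z) * u z

/-- The `(0,1)` part of the covariant derivative on the `N`-th power of the monopole bundle. -/
def nablaBar (N : ℕ) (u : ℂ → ℂ) (z : ℂ) : ℂ := dzbar u z + N / 2 * (z / rho z) * u z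

/-- The magnetic Laplacian of the unit sphere in a stereographic chart. -/
def chartLaplacian (N : ℕ) (u : ℂ → ℂ) (z : ℂ) : ℂ :=
  -(rho z ^ 2 * nabla N (nablaBar N u) z) + N / 2 * u z

theorem rho_eq_ofReal (z : ℂ) : rho z = ((1 + Complex.normSq z : ℝ) : ℂ) := by
  simp [rho, Complex.mul_conj]

theorem rho_ne_zero (z : ℂ) : rho z ≠ 0 := by
  rw [rho_eq_ofReal]
  exact_mod_cast (by have := Complex.normSq_nonneg z; positivity : (1 + Complex.normSq z) ≠ 0)

theorem contDiff_conj : ContDiff ℝ ∞ (fun z : ℂ => (starRingEnd ℂ) z) :=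
  Complex.conjCLE.contDiff

theorem contDiff_rho : ContDiff ℝ ∞ rho :=
  contDiff_const.add (contDiff_id.mul contDiff_conj)

theorem contDiff_dz {u : ℂ → ℂ} (hu : ContDiff ℝ ∞ u) : ContDiff ℝ ∞ (dz u) := by
  have h : ∀ v : ℂ, ContDiff ℝ ∞ fun z => fderiv ℝ u z v := fun v =>
    (hu.fderiv_right (m := ∞) (by simp)).clm_apply contDiff_const
  exact ((h 1).sub (contDiff_const.mul (h Complex.I))).div_const _

theorem contDiff_dzbar {u : ℂ → ℂ} (hu : ContDiff ℝ ∞ u) : ContDiff ℝ ∞ (dzbar u) := by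
  have h : ∀ v : ℂ, ContDiff ℝ ∞ fun z => fderiv ℝ u z v := fun v =>
    (hu.fderiv_right (m := ∞) (by simp)).clm_apply contDiff_const
  exact ((h 1).add (contDiff_const.mul (h Complex.I))).div_const _

theorem contDiff_inv_rho : ContDiff ℝ ∞ fun z => (rho z)⁻¹ :=
  contDiff_rho.inv rho_ne_zero

theorem contDiff_nabla (N : ℕ) {u : ℂ → ℂ} (hu : ContDiff ℝ ∞ u) :
    ContDiff ℝ ∞ (nabla N u) := by
  exact (contDiff_dz hu).sub
    ((contDiff_const.mul (contDiff_conj.mul contDiff_inv_rho)).mul hu)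

theorem contDiff_nablaBar (N : ℕ) {u : ℂ → ℂ} (hu : ContDiff ℝ ∞ u) :
    ContDiff ℝ ∞ (nablaBar N u) := by
  exact (contDiff_dzbar hu).add
    ((contDiff_const.mul (contDiff_id.mul contDiff_inv_rho)).mul hu)

section Leibniz

variable {u v : ℂ → ℂ} {z : ℂ}

theorem dz_add (hu : DifferentiableAt ℝ u z) (hv : DifferentiableAt ℝ v z) :
    dz (fun w => u w + v w) z = dz u z + dz v z := by
  simp only [dz, fderiv_fun_add hu hv, add_apply]
  ring

theorem dzbar_add (hu : DifferentiableAt ℝ u z) (hv : DifferentiableAt ℝ v z) :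
    dzbar (fun w => u w + v w) z = dzbar u z + dzbar v z := by
  simp only [dzbar, fderiv_fun_add hu hv, add_apply]
  ring

theorem dz_mul (hu : DifferentiableAt ℝ u z) (hv : DifferentiableAt ℝ v z) :
    dz (fun w => u w * v w) z = dz u z * v z + u z * dz v z := by
  simp only [dz, fderiv_fun_mul hu hv, add_apply, smul_apply, smul_eq_mul]
  ring

theorem dzbar_mul (hu : DifferentiableAt ℝ u z) (hv : DifferentiableAt ℝ v z) :
    dzbar (fun w => u w * v w) z = dzbar u z * v z + u z * dzbar v z := by
  simp only [dzbar, fderiv_fun_mul hu hv, add_apply, smul_apply, smul_eq_mul]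
  ring

theorem dz_const (c : ℂ) : dz (fun _ => c) z = 0 := by simp [dz]

theorem dzbar_const (c : ℂ) : dzbar (fun _ => c) z = 0 := by simp [dzbar]

theorem dz_of_holomorphic (hu : DifferentiableAt ℂ u z) : dz u z = deriv u z := by
  have h := (hu.hasDerivAt.hasFDerivAt.restrictScalars ℝ).fderiv
  simp only [dz, h, ContinuousLinearMap.coe_restrictScalars',
    ContinuousLinearMap.toSpanSingleton_apply, smul_eq_mul]
  linear_combination (-(deriv u z) / 2) * Complex.I_mul_I

theorem dzbar_of_holomorphic (hu : DifferentiableAt ℂ u z) : dzbar u z = 0 := by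
  have h := (hu.hasDerivAt.hasFDerivAt.restrictScalars ℝ).fderiv
  simp only [dzbar, h, ContinuousLinearMap.coe_restrictScalars',
    ContinuousLinearMap.toSpanSingleton_apply, smul_eq_mul]
  linear_combination ((deriv u z) / 2) * Complex.I_mul_I

theorem dz_conj : dz (fun w => (starRingEnd ℂ) w) z = 0 := by
  have h : fderiv ℝ (fun w => (starRingEnd ℂ) w) z = Complex.conjCLE :=
    Complex.conjCLE.hasFDerivAt.fderiv
  simp [dz, h]

theorem dzbar_conj : dzbar (fun w => (starRingEnd ℂ) w) z = 1 := by
  have h : fderiv ℝ (fun w => (starRingEnd ℂ) w) z = Complex.conjCLE :=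
    Complex.conjCLE.hasFDerivAt.fderiv
  simp [dzbar, h]

theorem differentiableAt_conj : DifferentiableAt ℝ (fun w : ℂ => (starRingEnd ℂ) w) z :=
  contDiff_conj.contDiffAt.differentiableAt (by simp)

theorem differentiableAt_rho : DifferentiableAt ℝ rho z :=
  contDiff_rho.contDiffAt.differentiableAt (by simp)

theorem dz_rho : dz rho z = (starRingEnd ℂ) z := by
  unfold rho
  rw [dz_add (by fun_prop) (differentiableAt_fun_id.fun_mul differentiableAt_conj), dz_const,
    dz_mul differentiableAt_fun_id differentiableAt_conj, dz_conj,
    dz_of_holomorphic differentiableAt_fun_id]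
  simp

theorem dzbar_rho : dzbar rho z = z := by
  unfold rho
  rw [dzbar_add (by fun_prop) (differentiableAt_fun_id.fun_mul differentiableAt_conj), dzbar_const,
    dzbar_mul differentiableAt_fun_id differentiableAt_conj, dzbar_conj,
    dzbar_of_holomorphic differentiableAt_fun_id]
  simp

theorem differentiableAt_inv_rho : DifferentiableAt ℝ (fun w => (rho w)⁻¹) z :=
  contDiff_inv_rho.contDiffAt.differentiableAt (by simp)

/-- Differentiate `ρ ρ⁻¹ = 1`. -/
theorem dz_inv_rho : dz (fun w => (rho w)⁻¹) z = -(starRingEnd ℂ) z / rho z ^ 2 := by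
  have h : (fun w => rho w * (rho w)⁻¹) = fun _ => 1 := by
    funext w
    exact mul_inv_cancel₀ (rho_ne_zero w)
  have h2 := dz_mul (z := z) differentiableAt_rho differentiableAt_inv_rho
  rw [h, dz_const, dz_rho] at h2
  have h0 := rho_ne_zero z
  field_simp at h2 ⊢
  linear_combination -h2

theorem dzbar_inv_rho : dzbar (fun w => (rho w)⁻¹) z = -z / rho z ^ 2 := by
  have h : (fun w => rho w * (rho w)⁻¹) = fun _ => 1 := by
    funext w
    exact mul_inv_cancel₀ (rho_ne_zero w)
  have h2 := dzbar_mul (z := z) differentiableAt_rho differentiableAt_inv_rho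
  rw [h, dzbar_const, dzbar_rho] at h2
  have h0 := rho_ne_zero z
  field_simp at h2 ⊢
  linear_combination -h2

end Leibniz

theorem fderiv_fderiv_comm {u : ℂ → ℂ} (hu : ContDiff ℝ ∞ u) (z v w : ℂ) :
    fderiv ℝ (fun y => fderiv ℝ u y v) z w = fderiv ℝ (fun y => fderiv ℝ u y w) z v := by
  have hd : DifferentiableAt ℝ (fderiv ℝ u) z :=
    (hu.fderiv_right (m := ∞) (by simp)).contDiffAt.differentiableAt (by simp)
  have hs : IsSymmSndFDerivAt ℝ u z := hu.contDiffAt.isSymmSndFDerivAt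
    (by simpa using (WithTop.coe_le_coe.2 le_top : ((2 : ℕ∞) : WithTop ℕ∞) ≤ ∞))
  have h : ∀ a b : ℂ, fderiv ℝ (fun y => fderiv ℝ u y a) z b = fderiv ℝ (fderiv ℝ u) z b a := by
    intro a b
    rw [fderiv_clm_apply hd (differentiableAt_const a)]
    simp
  rw [h, h]
  exact hs.eq w v

/-- Both sides expand into second directional derivatives, and the mixed ones agree by symmetry of
the second derivative. -/
theorem dz_dzbar_comm {u : ℂ → ℂ} (hu : ContDiff ℝ ∞ u) (z : ℂ) :
    dz (dzbar u) z = dzbar (dz u) z := by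
  have h : ∀ v : ℂ, DifferentiableAt ℝ (fun z => fderiv ℝ u z v) z := fun v =>
    ((hu.fderiv_right (m := ∞) (by simp)).clm_apply contDiff_const).contDiffAt.differentiableAt
      (by simp)
  have e1 : dzbar u = fun w => (1 / 2) * (fderiv ℝ u w 1) +
      (Complex.I / 2) * fderiv ℝ u w Complex.I := by
    funext w; simp only [dzbar]; ring
  have e2 : dz u = fun w => (1 / 2) * (fderiv ℝ u w 1) +
      (-Complex.I / 2) * fderiv ℝ u w Complex.I := by
    funext w; simp only [dz]; ring
  rw [e1, e2, dz_add ((differentiableAt_const _).fun_mul (h _)) ((differentiableAt_const _).fun_mul (h _)),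
    dzbar_add ((differentiableAt_const _).fun_mul (h _)) ((differentiableAt_const _).fun_mul (h _)),
    dz_mul (differentiableAt_const _) (h _), dz_mul (differentiableAt_const _) (h _),
    dzbar_mul (differentiableAt_const _) (h _), dzbar_mul (differentiableAt_const _) (h _)]
  rw [dz_const, dz_const, dzbar_const, dzbar_const]
  simp only [dz, dzbar, fderiv_fderiv_comm hu z Complex.I 1]
  ring

/-! ### Curvature and the change of weight -/

section Covariant

variable {u v : ℂ → ℂ}

theorem ContDiff.diffAt (hu : ContDiff ℝ ∞ u) (z : ℂ) : DifferentiableAt ℝ u z :=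
  hu.contDiffAt.differentiableAt (by simp)

/-- This is the curvature of the bundle. The second-order and first-order terms cancel, and what
remains is `N/2` times `∂(z/ρ) + ∂̄(z̄/ρ)`, where each summand is `(ρ - |z|²)/ρ² = 1/ρ²`. -/
theorem nabla_nablaBar_sub (N : ℕ) (hu : ContDiff ℝ ∞ u) (z : ℂ) :
    nabla N (nablaBar N u) z - nablaBar N (nabla N u) z = N / rho z ^ 2 * u z := by
  have h0 := rho_ne_zero z
  have e1 : nablaBar N u = fun w => dzbar u w + ((N / 2 : ℂ) * w * (rho w)⁻¹) * u w := by
    funext w; simp only [nablaBar]; ring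
  have e2 : nabla N u = fun w => dz u w +
      ((-N / 2 : ℂ) * (starRingEnd ℂ) w * (rho w)⁻¹) * u w := by
    funext w; simp only [nabla]; ring
  have hu' := ContDiff.diffAt hu z
  have d1 : DifferentiableAt ℝ (fun w : ℂ => (N / 2 : ℂ) * w) z := by fun_prop
  have d2 : DifferentiableAt ℝ (fun w : ℂ => (-N / 2 : ℂ) * (starRingEnd ℂ) w) z :=
    (differentiableAt_const _).mul differentiableAt_conj
  have d3 := differentiableAt_inv_rho (z := z)
  have f1 : nabla N (nablaBar N u) z = dz (nablaBar N u) z -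
    N / 2 * ((starRingEnd ℂ) z / rho z) * nablaBar N u z := rfl
  have f2 : nablaBar N (nabla N u) z = dzbar (nabla N u) z +
    N / 2 * (z / rho z) * nabla N u z := rfl
  rw [f1, f2, e1, e2, dz_add (ContDiff.diffAt (contDiff_dzbar hu) z) ((d1.fun_mul d3).fun_mul hu'),
    dz_mul (d1.fun_mul d3) hu', dz_mul d1 d3, dz_mul (differentiableAt_const _) differentiableAt_fun_id,
    dz_const, dz_of_holomorphic differentiableAt_fun_id, dz_inv_rho,
    dzbar_add (ContDiff.diffAt (contDiff_dz hu) z) ((d2.fun_mul d3).fun_mul hu'),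
    dzbar_mul (d2.fun_mul d3) hu', dzbar_mul d2 d3,
    dzbar_mul (differentiableAt_const _) differentiableAt_conj,
    dzbar_const, dzbar_conj, dzbar_inv_rho, dz_dzbar_comm hu]
  have h1 : z * (starRingEnd ℂ) z = rho z - 1 := by simp [rho]
  simp only [deriv_id'']
  field_simp
  linear_combination (-4 * N * u z) * h1

/-- The term `∂ρ = z̄` is exactly absorbed by raising `N` to `N + 2` in the potential. Thus
multiplication by `ρ` relates the connections of weights `N` and `N + 2`, which lets the ladder
operators be composed. -/
theorem nabla_rho_mul (N : ℕ) (hu : ContDiff ℝ ∞ u) (z : ℂ) :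
    nabla (N + 2) (fun w => rho w * u w) z = rho z * nabla N u z := by
  have h0 := rho_ne_zero z
  simp only [nabla, dz_mul differentiableAt_rho (ContDiff.diffAt hu z), dz_rho]
  push_cast
  field_simp
  ring

theorem nablaBar_rho_mul (N : ℕ) (hu : ContDiff ℝ ∞ u) (z : ℂ) :
    nablaBar N (fun w => rho w * u w) z = rho z * nablaBar (N + 2) u z := by
  have h0 := rho_ne_zero z
  simp only [nablaBar, dzbar_mul differentiableAt_rho (ContDiff.diffAt hu z), dzbar_rho]
  push_cast
  field_simp
  ring

theorem nabla_add (N : ℕ) (hu : ContDiff ℝ ∞ u) (hv : ContDiff ℝ ∞ v) :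
    nabla N (u + v) = nabla N u + nabla N v := by
  funext z
  have := dz_add (ContDiff.diffAt hu z) (ContDiff.diffAt hv z)
  simp only [nabla, Pi.add_apply]
  change dz (fun w => u w + v w) z - _ = _
  rw [this]; ring

theorem nabla_smul (N : ℕ) (c : ℂ) (hu : ContDiff ℝ ∞ u) :
    nabla N (c • u) = c • nabla N u := by
  funext z
  have := dz_mul (differentiableAt_const c) (ContDiff.diffAt hu z)
  simp only [nabla, Pi.smul_apply, smul_eq_mul]
  change dz (fun w => c * u w) z - _ = _
  rw [this, dz_const]; ring

theorem nablaBar_add (N : ℕ) (hu : ContDiff ℝ ∞ u) (hv : ContDiff ℝ ∞ v) :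
    nablaBar N (u + v) = nablaBar N u + nablaBar N v := by
  funext z
  have := dzbar_add (ContDiff.diffAt hu z) (ContDiff.diffAt hv z)
  simp only [nablaBar, Pi.add_apply]
  change dzbar (fun w => u w + v w) z + _ = _
  rw [this]; ring

theorem nablaBar_smul (N : ℕ) (c : ℂ) (hu : ContDiff ℝ ∞ u) :
    nablaBar N (c • u) = c • nablaBar N u := by
  funext z
  have := dzbar_mul (differentiableAt_const c) (ContDiff.diffAt hu z)
  simp only [nablaBar, Pi.smul_apply, smul_eq_mul]
  change dzbar (fun w => c * u w) z + _ = _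
  rw [this, dzbar_const]; ring

end Covariant

/-! ### The change of chart `z ↦ 1/z` -/

/-- The direction `z / |z|` of a complex number. -/
def direction (z : ℂ) : ℂ := z / (‖z‖ : ℂ)

section Inversion

variable {z : ℂ}

theorem norm_mul_norm_eq (z : ℂ) : (‖z‖ : ℂ) * (‖z‖ : ℂ) = z * (starRingEnd ℂ) z := by
  rw [Complex.mul_conj, Complex.normSq_eq_norm_sq]
  push_cast
  ring

theorem differentiableAt_ofReal_norm (hz : z ≠ 0) :
    DifferentiableAt ℝ (fun w : ℂ => (‖w‖ : ℂ)) z :=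
  Complex.ofRealCLM.differentiableAt.comp z ((contDiffAt_norm ℝ hz).differentiableAt one_ne_zero)

theorem dz_norm (hz : z ≠ 0) :
    dz (fun w : ℂ => (‖w‖ : ℂ)) z = (starRingEnd ℂ) z / (2 * (‖z‖ : ℂ)) := by
  have hd := differentiableAt_ofReal_norm hz
  have h := dz_mul hd hd
  simp only [norm_mul_norm_eq] at h
  rw [dz_mul differentiableAt_fun_id differentiableAt_conj, dz_conj,
    dz_of_holomorphic differentiableAt_fun_id] at h
  have h0 : (‖z‖ : ℂ) ≠ 0 := by simpa using hz
  simp only [deriv_id''] at h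
  field_simp
  linear_combination -h

theorem dzbar_norm (hz : z ≠ 0) :
    dzbar (fun w : ℂ => (‖w‖ : ℂ)) z = z / (2 * (‖z‖ : ℂ)) := by
  have hd := differentiableAt_ofReal_norm hz
  have h := dzbar_mul hd hd
  simp only [norm_mul_norm_eq] at h
  rw [dzbar_mul differentiableAt_fun_id differentiableAt_conj, dzbar_conj,
    dzbar_of_holomorphic differentiableAt_fun_id] at h
  have h0 : (‖z‖ : ℂ) ≠ 0 := by simpa using hz
  field_simp
  linear_combination -h

theorem differentiableAt_direction (hz : z ≠ 0) : DifferentiableAt ℝ direction z :=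
  differentiableAt_fun_id.mul ((differentiableAt_ofReal_norm hz).inv (by simpa using hz))

theorem direction_mul_norm (z : ℂ) : direction z * (‖z‖ : ℂ) = z := by
  rcases eq_or_ne z 0 with rfl | hz
  · simp [direction]
  · exact div_mul_cancel₀ _ (by simpa using hz)

/-- Differentiate the identity `direction z * |z| = z`; the derivative of `|z|` comes in turn from
`|z|² = z z̄`. -/
theorem dz_direction (hz : z ≠ 0) : dz direction z = 1 / (2 * z) * direction z := by
  have h := dz_mul (differentiableAt_direction hz) (differentiableAt_ofReal_norm hz)
  simp only [direction_mul_norm] at h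
  have h0 : (‖z‖ : ℂ) ≠ 0 := by simpa using hz
  rw [dz_of_holomorphic differentiableAt_fun_id, dz_norm hz] at h
  simp only [deriv_id''] at h
  have h1 := norm_mul_norm_eq z
  unfold direction at h ⊢
  field_simp at h ⊢
  apply mul_left_cancel₀ (pow_ne_zero 2 h0)
  linear_combination -h + h1

theorem dzbar_direction (hz : z ≠ 0) :
    dzbar direction z = -1 / (2 * (starRingEnd ℂ) z) * direction z := by
  have h := dzbar_mul (differentiableAt_direction hz) (differentiableAt_ofReal_norm hz)
  simp only [direction_mul_norm] at h
  have h0 : (‖z‖ : ℂ) ≠ 0 := by simpa using hz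
  have h2 : (starRingEnd ℂ) z ≠ 0 := by simpa using hz
  rw [dzbar_of_holomorphic differentiableAt_fun_id, dzbar_norm hz] at h
  have h1 := norm_mul_norm_eq z
  unfold direction at h ⊢
  field_simp at h ⊢
  apply mul_left_cancel₀ hz
  linear_combination -h - 2 * (‖z‖ : ℂ) * dzbar (fun z => z / (‖z‖ : ℂ)) z * h1

theorem dz_direction_pow (hz : z ≠ 0) (N : ℕ) :
    dz (fun w => direction w ^ N) z = N / (2 * z) * direction z ^ N := by
  induction N with
  | zero => simp [dz_const]
  | succ n ih =>
    have hd := differentiableAt_direction hz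
    simp only [pow_succ]
    rw [dz_mul (hd.fun_pow n) hd, ih, dz_direction hz]
    push_cast
    field_simp

theorem dzbar_direction_pow (hz : z ≠ 0) (N : ℕ) :
    dzbar (fun w => direction w ^ N) z =
      -N / (2 * (starRingEnd ℂ) z) * direction z ^ N := by
  induction N with
  | zero => simp [dzbar_const]
  | succ n ih =>
    have hd := differentiableAt_direction hz
    have h2 : (starRingEnd ℂ) z ≠ 0 := by simpa using hz
    simp only [pow_succ]
    rw [dzbar_mul (hd.fun_pow n) hd, ih, dzbar_direction hz]
    push_cast
    field_simp
    ring

theorem fderiv_comp_inv {v : ℂ → ℂ} (hv : ContDiff ℝ ∞ v) (hz : z ≠ 0) (h : ℂ) :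
    fderiv ℝ (fun w => v w⁻¹) z h = fderiv ℝ v z⁻¹ (-h / z ^ 2) := by
  have h1 : HasFDerivAt (fun w : ℂ => w⁻¹) _ z :=
    (hasDerivAt_inv hz).hasFDerivAt.restrictScalars ℝ
  have h2 : HasFDerivAt v (fderiv ℝ v z⁻¹) z⁻¹ := (ContDiff.diffAt hv _).hasFDerivAt
  have h3 : HasFDerivAt (fun w => v w⁻¹) _ z := h2.comp z h1
  rw [h3.fderiv]
  simp only [ContinuousLinearMap.comp_apply, ContinuousLinearMap.coe_restrictScalars',
    ContinuousLinearMap.toSpanSingleton_apply, smul_eq_mul]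
  congr 1
  ring

/-- The real derivative splits into its complex linear and antilinear parts. In this form the chain
rule with the holomorphic inversion is immediate. -/
theorem fderiv_eq_dz_dzbar (v : ℂ → ℂ) (z h : ℂ) :
    fderiv ℝ v z h = dz v z * h + dzbar v z * (starRingEnd ℂ) h := by
  have h1 : h = h.re • (1 : ℂ) + h.im • Complex.I := by
    simp [Complex.re_add_im]
  have h2 : (starRingEnd ℂ) h = h.re - h.im * Complex.I := by
    apply Complex.ext <;> simp
  conv_lhs => rw [h1, map_add, map_smul, map_smul]
  rw [h2]
  nth_rw 3 [← Complex.re_add_im h]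
  simp only [dz, dzbar, Complex.real_smul]
  linear_combination (h.im * fderiv ℝ v z Complex.I) * Complex.I_mul_I

theorem dz_comp_inv {v : ℂ → ℂ} (hv : ContDiff ℝ ∞ v) (hz : z ≠ 0) :
    dz (fun w => v w⁻¹) z = -1 / z ^ 2 * dz v z⁻¹ := by
  rw [dz, fderiv_comp_inv hv hz, fderiv_comp_inv hv hz, fderiv_eq_dz_dzbar, fderiv_eq_dz_dzbar]
  simp only [map_div₀, map_neg, map_one, Complex.conj_I]
  linear_combination (-(dzbar v z⁻¹ / (starRingEnd ℂ) (z ^ 2)) / 2 +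
    dz v z⁻¹ / z ^ 2 / 2) * Complex.I_mul_I

theorem dzbar_comp_inv {v : ℂ → ℂ} (hv : ContDiff ℝ ∞ v) (hz : z ≠ 0) :
    dzbar (fun w => v w⁻¹) z = -1 / (starRingEnd ℂ) z ^ 2 * dzbar v z⁻¹ := by
  rw [dzbar, fderiv_comp_inv hv hz, fderiv_comp_inv hv hz, fderiv_eq_dz_dzbar, fderiv_eq_dz_dzbar]
  simp only [map_div₀, map_neg, map_one, Complex.conj_I, map_pow]
  linear_combination ((dzbar v z⁻¹ / (starRingEnd ℂ) z ^ 2) / 2 -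
    dz v z⁻¹ / z ^ 2 / 2) * Complex.I_mul_I

theorem dz_congr {u v : ℂ → ℂ} (h : u =ᶠ[nhds z] v) : dz u z = dz v z := by
  simp only [dz, h.fderiv_eq]

theorem dzbar_congr {u v : ℂ → ℂ} (h : u =ᶠ[nhds z] v) : dzbar u z = dzbar v z := by
  simp only [dzbar, h.fderiv_eq]

theorem rho_inv (hz : z ≠ 0) : rho z⁻¹ = rho z / (z * (starRingEnd ℂ) z) := by
  have h2 : (starRingEnd ℂ) z ≠ 0 := by simpa using hz
  simp only [rho, map_inv₀]
  field_simp
  ring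

theorem differentiableAt_comp_inv {v : ℂ → ℂ} (hv : ContDiff ℝ ∞ v) (hz : z ≠ 0) :
    DifferentiableAt ℝ (fun w => v w⁻¹) z :=
  (ContDiff.diffAt hv z⁻¹).comp z ((differentiableAt_inv (𝕜 := ℂ) hz).restrictScalars ℝ)

variable {N : ℕ} {u v : ℂ → ℂ}

/-- Gauge covariance: the logarithmic derivative `N/(2z)` of the transition factor makes up the
difference of the two potentials, because `N/(2z) - N z̄/(2ρ) = N/(2zρ)`. The factor `-1/z²` is the
derivative of the inversion. -/
theorem nabla_inversion (hv : ContDiff ℝ ∞ v)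
    (huv : ∀ z, z ≠ 0 → u z = direction z ^ N * v z⁻¹) (hz : z ≠ 0) :
    nabla N u z = -1 / z ^ 2 * direction z ^ N * nabla N v z⁻¹ := by
  have h2 : (starRingEnd ℂ) z ≠ 0 := by simpa using hz
  have h0 := rho_ne_zero z
  have he : u =ᶠ[nhds z] fun z => direction z ^ N * v z⁻¹ := by
    filter_upwards [isOpen_ne.mem_nhds hz] with w hw using huv w hw
  rw [nabla, dz_congr he, dz_mul ((differentiableAt_direction hz).fun_pow N)
    (differentiableAt_comp_inv hv hz), dz_direction_pow hz, dz_comp_inv hv hz, huv z hz, nabla,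
    rho_inv hz, map_inv₀]
  generalize v z⁻¹ = a
  field_simp
  have : z * (starRingEnd ℂ) z = rho z - 1 := by simp [rho]
  linear_combination (-N * a * direction z ^ N * z) * this

theorem nablaBar_inversion (hv : ContDiff ℝ ∞ v)
    (huv : ∀ z, z ≠ 0 → u z = direction z ^ N * v z⁻¹) (hz : z ≠ 0) :
    nablaBar N u z = -1 / (starRingEnd ℂ) z ^ 2 * direction z ^ N * nablaBar N v z⁻¹ := by
  have h2 : (starRingEnd ℂ) z ≠ 0 := by simpa using hz
  have h0 := rho_ne_zero z
  have he : u =ᶠ[nhds z] fun z => direction z ^ N * v z⁻¹ := by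
    filter_upwards [isOpen_ne.mem_nhds hz] with w hw using huv w hw
  rw [nablaBar, dzbar_congr he, dzbar_mul ((differentiableAt_direction hz).fun_pow N)
    (differentiableAt_comp_inv hv hz), dzbar_direction_pow hz, dzbar_comp_inv hv hz, huv z hz,
    nablaBar, rho_inv hz]
  generalize v z⁻¹ = a
  field_simp
  have : z * (starRingEnd ℂ) z = rho z - 1 := by simp [rho]
  linear_combination (N * a * direction z ^ N * (starRingEnd ℂ) z) * this

theorem direction_sq (hz : z ≠ 0) : direction z ^ 2 = z / (starRingEnd ℂ) z := by
  have h2 : (starRingEnd ℂ) z ≠ 0 := by simpa using hz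
  have h0 : (‖z‖ : ℂ) ≠ 0 := by simpa using hz
  have h1 := norm_mul_norm_eq z
  rw [direction, div_pow, div_eq_div_iff (pow_ne_zero 2 h0) h2]
  linear_combination (-z) * h1

end Inversion

/-! ### Sections, eigenspaces and ladder operators -/

/-- The smooth sections of the `N`-th power of the monopole bundle, in complex stereographic
coordinates. -/
def chartSections (N : ℕ) : Submodule ℂ ((ℂ → ℂ) × (ℂ → ℂ)) where
  carrier := {u | ContDiff ℝ ∞ u.1 ∧ ContDiff ℝ ∞ u.2 ∧
    ∀ z, z ≠ 0 → u.1 z = direction z ^ N * u.2 z⁻¹}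
  add_mem' := by
    rintro u v ⟨hu1, hu2, hu⟩ ⟨hv1, hv2, hv⟩
    refine ⟨hu1.add hv1, hu2.add hv2, fun z hz => ?_⟩
    simp only [Prod.snd_add, Prod.fst_add, Pi.add_apply, hu z hz, hv z hz]
    ring
  zero_mem' := ⟨contDiff_const, contDiff_const, fun z _ => by simp⟩
  smul_mem' := by
    rintro c u ⟨hu1, hu2, hu⟩
    refine ⟨hu1.const_smul c, hu2.const_smul c, fun z hz => ?_⟩
    simp only [Prod.smul_snd, Prod.smul_fst, Pi.smul_apply, smul_eq_mul, hu z hz]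
    ring

theorem chartLaplacian_add (N : ℕ) {u v : ℂ → ℂ} (hu : ContDiff ℝ ∞ u) (hv : ContDiff ℝ ∞ v) :
    chartLaplacian N (u + v) = chartLaplacian N u + chartLaplacian N v := by
  funext z
  simp only [chartLaplacian, nablaBar_add N hu hv,
    nabla_add N (contDiff_nablaBar N hu) (contDiff_nablaBar N hv), Pi.add_apply]
  ring

theorem chartLaplacian_smul (N : ℕ) (c : ℂ) {u : ℂ → ℂ} (hu : ContDiff ℝ ∞ u) :
    chartLaplacian N (c • u) = c • chartLaplacian N u := by
  funext z
  simp only [chartLaplacian, nablaBar_smul N c hu,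
    nabla_smul N c (contDiff_nablaBar N hu), Pi.smul_apply, smul_eq_mul]
  ring

/-- The eigenspaces of the magnetic Laplacian of the unit sphere, in complex stereographic
coordinates. -/
def chartEigenspace (N : ℕ) (α : ℂ) : Submodule ℂ ((ℂ → ℂ) × (ℂ → ℂ)) where
  carrier := {u | u ∈ chartSections N ∧
    chartLaplacian N u.1 = α • u.1 ∧ chartLaplacian N u.2 = α • u.2}
  add_mem' := by
    rintro u v ⟨hu, hu1, hu2⟩ ⟨hv, hv1, hv2⟩
    refine ⟨add_mem hu hv, ?_, ?_⟩
    · rw [Prod.fst_add, smul_add, ← hu1, ← hv1, chartLaplacian_add N hu.1 hv.1]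
    · rw [Prod.snd_add, smul_add, ← hu2, ← hv2, chartLaplacian_add N hu.2.1 hv.2.1]
  zero_mem' := by
    have h : chartLaplacian N 0 = 0 := by
      simpa using chartLaplacian_smul N 0 (u := 0) contDiff_const
    exact ⟨zero_mem _, by simp [h], by simp [h]⟩
  smul_mem' := by
    rintro c u ⟨hu, hu1, hu2⟩
    refine ⟨Submodule.smul_mem _ c hu, ?_, ?_⟩
    · rw [Prod.smul_fst, smul_comm, ← hu1, chartLaplacian_smul N c hu.1]
    · rw [Prod.smul_snd, smul_comm, ← hu2, chartLaplacian_smul N c hu.2.1]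

/-- The raising operator from the `N`-th to the `N + 2`-nd power of the monopole bundle. -/
def raise (N : ℕ) (u : (ℂ → ℂ) × (ℂ → ℂ)) : (ℂ → ℂ) × (ℂ → ℂ) :=
  (fun z => rho z * nablaBar N u.1 z, fun z => -(rho z * nablaBar N u.2 z))

/-- The lowering operator from the `N + 2`-nd to the `N`-th power of the monopole bundle. -/
def lower (N : ℕ) (v : (ℂ → ℂ) × (ℂ → ℂ)) : (ℂ → ℂ) × (ℂ → ℂ) :=
  (fun z => -(rho z * nabla (N + 2) v.1 z), fun z => rho z * nabla (N + 2) v.2 z)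

/-- Under inversion `∇̄` produces `-1/z̄²` and `ρ(1/z)` is `ρ/(z z̄)`, so the total extra factor is
`-z/z̄ = -direction²`. The square accounts for the passage from `N` to `N + 2`, and the sign is why
the second component of `raise` carries a minus. -/
theorem raise_mem {N : ℕ} {u : (ℂ → ℂ) × (ℂ → ℂ)} (hu : u ∈ chartSections N) :
    raise N u ∈ chartSections (N + 2) := by
  obtain ⟨h1, h2, h⟩ := hu
  refine ⟨contDiff_rho.mul (contDiff_nablaBar N h1),
    (contDiff_rho.mul (contDiff_nablaBar N h2)).neg, fun z hz => ?_⟩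
  have hc : (starRingEnd ℂ) z ≠ 0 := by simpa using hz
  simp only [raise]
  rw [nablaBar_inversion h2 h hz, pow_add, direction_sq hz, rho_inv hz]
  field_simp

theorem lower_mem {N : ℕ} {u : (ℂ → ℂ) × (ℂ → ℂ)} (hu : u ∈ chartSections (N + 2)) :
    lower N u ∈ chartSections N := by
  obtain ⟨h1, h2, h⟩ := hu
  refine ⟨(contDiff_rho.mul (contDiff_nabla (N + 2) h1)).neg,
    contDiff_rho.mul (contDiff_nabla (N + 2) h2), fun z hz => ?_⟩
  have hc : (starRingEnd ℂ) z ≠ 0 := by simpa using hz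
  simp only [lower]
  rw [nabla_inversion h2 h hz, pow_add, direction_sq hz, rho_inv hz]
  field_simp

theorem raise_add {N : ℕ} {u v : (ℂ → ℂ) × (ℂ → ℂ)} (hu : u ∈ chartSections N)
    (hv : v ∈ chartSections N) : raise N (u + v) = raise N u + raise N v := by
  ext z
  · simp only [raise, Prod.fst_add, nablaBar_add N hu.1 hv.1, Pi.add_apply]
    ring
  · simp only [raise, Prod.snd_add, nablaBar_add N hu.2.1 hv.2.1, Pi.add_apply]
    ring

theorem raise_smul {N : ℕ} (c : ℂ) {u : (ℂ → ℂ) × (ℂ → ℂ)} (hu : u ∈ chartSections N) :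
    raise N (c • u) = c • raise N u := by
  ext z
  · simp only [raise, Prod.smul_fst, nablaBar_smul N c hu.1, Pi.smul_apply, smul_eq_mul]
    ring
  · simp only [raise, Prod.smul_snd, nablaBar_smul N c hu.2.1, Pi.smul_apply, smul_eq_mul]
    ring

theorem lower_smul {N : ℕ} (c : ℂ) {u : (ℂ → ℂ) × (ℂ → ℂ)} (hu : u ∈ chartSections (N + 2)) :
    lower N (c • u) = c • lower N u := by
  ext z
  · simp only [lower, Prod.smul_fst, nabla_smul _ c hu.1, Pi.smul_apply, smul_eq_mul]
    ring
  · simp only [lower, Prod.smul_snd, nabla_smul _ c hu.2.1, Pi.smul_apply, smul_eq_mul]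
    ring

section Factorization

variable {N : ℕ} {u : ℂ → ℂ}

theorem nabla_neg_smooth (hu : ContDiff ℝ ∞ u) (z : ℂ) :
    nabla N (fun w => -u w) z = -nabla N u z := by
  have := congrFun (nabla_smul N (-1) hu) z
  simp only [Pi.smul_apply, smul_eq_mul, neg_mul, one_mul] at this
  rw [← this]
  congr 1
  funext w
  simp

theorem nablaBar_neg_smooth (hu : ContDiff ℝ ∞ u) (z : ℂ) :
    nablaBar N (fun w => -u w) z = -nablaBar N u z := by
  have := congrFun (nablaBar_smul N (-1) hu) z
  simp only [Pi.smul_apply, smul_eq_mul, neg_mul, one_mul] at this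
  rw [← this]
  congr 1
  funext w
  simp

theorem rho_nabla_rho_nablaBar (hu : ContDiff ℝ ∞ u) (z : ℂ) :
    -(rho z * nabla (N + 2) (fun w => rho w * nablaBar N u w) z) =
      chartLaplacian N u z - N / 2 * u z := by
  rw [nabla_rho_mul N (contDiff_nablaBar N hu), chartLaplacian]
  ring

/-- In the reversed order the curvature of `L^(N+2)` contributes `N + 2`, which changes the constant
from `-(N+2)/2` to `+(N+2)/2`. -/
theorem rho_nablaBar_rho_nabla (hu : ContDiff ℝ ∞ u) (z : ℂ) :
    -(rho z * nablaBar N (fun w => rho w * nabla (N + 2) u w) z) =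
      chartLaplacian (N + 2) u z + (N + 2) / 2 * u z := by
  have h := nabla_nablaBar_sub (N + 2) hu z
  have h0 := rho_ne_zero z
  rw [nablaBar_rho_mul N (contDiff_nabla (N + 2) hu), chartLaplacian]
  push_cast at h ⊢
  have h' := congrArg (fun t => rho z ^ 2 * t) h
  field_simp at h'
  linear_combination h'

theorem lower_raise {u : (ℂ → ℂ) × (ℂ → ℂ)} (hu : u ∈ chartSections N) :
    lower N (raise N u) = (fun z => chartLaplacian N u.1 z - N / 2 * u.1 z,
      fun z => chartLaplacian N u.2 z - N / 2 * u.2 z) := by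
  ext z
  · simp only [lower, raise]
    exact rho_nabla_rho_nablaBar hu.1 z
  · simp only [lower, raise]
    rw [nabla_neg_smooth (contDiff_rho.mul (contDiff_nablaBar N hu.2.1)),
      ← rho_nabla_rho_nablaBar hu.2.1 z]
    ring

theorem raise_lower {u : (ℂ → ℂ) × (ℂ → ℂ)} (hu : u ∈ chartSections (N + 2)) :
    raise N (lower N u) = (fun z => chartLaplacian (N + 2) u.1 z + (N + 2) / 2 * u.1 z,
      fun z => chartLaplacian (N + 2) u.2 z + (N + 2) / 2 * u.2 z) := by
  ext z
  · simp only [lower, raise]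
    rw [nablaBar_neg_smooth (contDiff_rho.mul (contDiff_nabla (N + 2) hu.1)),
      ← rho_nablaBar_rho_nabla hu.1 z]
    ring
  · simp only [lower, raise]
    exact rho_nablaBar_rho_nabla hu.2.1 z

variable {α : ℂ}

theorem mem_chartEigenspace_iff_lower_raise {u : (ℂ → ℂ) × (ℂ → ℂ)} (hu : u ∈ chartSections N) :
    u ∈ chartEigenspace N α ↔ lower N (raise N u) = (α - N / 2) • u := by
  rw [lower_raise hu]
  constructor
  · rintro ⟨-, h1, h2⟩
    ext z
    · simp only [h1, Pi.smul_apply, smul_eq_mul, Prod.smul_fst]; ring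
    · simp only [h2, Pi.smul_apply, smul_eq_mul, Prod.smul_snd]; ring
  · intro h
    refine ⟨hu, ?_, ?_⟩
    · funext z
      have := congrFun (congrArg Prod.fst h) z
      simp only [Pi.smul_apply, smul_eq_mul, Prod.smul_fst] at this ⊢
      linear_combination this
    · funext z
      have := congrFun (congrArg Prod.snd h) z
      simp only [Pi.smul_apply, smul_eq_mul, Prod.smul_snd] at this ⊢
      linear_combination this

theorem mem_chartEigenspace_iff_raise_lower {u : (ℂ → ℂ) × (ℂ → ℂ)}
    (hu : u ∈ chartSections (N + 2)) :
    u ∈ chartEigenspace (N + 2) α ↔ raise N (lower N u) = (α + (N + 2) / 2) • u := by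
  rw [raise_lower hu]
  constructor
  · rintro ⟨-, h1, h2⟩
    ext z
    · simp only [h1, Pi.smul_apply, smul_eq_mul, Prod.smul_fst]; ring
    · simp only [h2, Pi.smul_apply, smul_eq_mul, Prod.smul_snd]; ring
  · intro h
    refine ⟨hu, ?_, ?_⟩
    · funext z
      have := congrFun (congrArg Prod.fst h) z
      simp only [Pi.smul_apply, smul_eq_mul, Prod.smul_fst] at this ⊢
      linear_combination this
    · funext z
      have := congrFun (congrArg Prod.snd h) z
      simp only [Pi.smul_apply, smul_eq_mul, Prod.smul_snd] at this ⊢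
      linear_combination this

/-- Apply `raise` to the equation `lower (raise u) = (α - N/2) u`. The shift of the eigenvalue is
dictated by `α - N/2 = (α - (N+1)) + (N+2)/2`. -/
theorem raise_mem_chartEigenspace {u : (ℂ → ℂ) × (ℂ → ℂ)} (hu : u ∈ chartEigenspace N α) :
    raise N u ∈ chartEigenspace (N + 2) (α - (N + 1)) := by
  rw [mem_chartEigenspace_iff_raise_lower (raise_mem hu.1),
    (mem_chartEigenspace_iff_lower_raise hu.1).1 hu, raise_smul _ hu.1]
  congr 1
  ring

theorem lower_mem_chartEigenspace {u : (ℂ → ℂ) × (ℂ → ℂ)}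
    (hu : u ∈ chartEigenspace (N + 2) (α - (N + 1))) : lower N u ∈ chartEigenspace N α := by
  rw [mem_chartEigenspace_iff_lower_raise (lower_mem hu.1),
    (mem_chartEigenspace_iff_raise_lower hu.1).1 hu, lower_smul _ hu.1]
  congr 1
  ring

/-- Away from the lowest eigenvalue, the raising operator is an isomorphism of eigenspaces. -/
theorem nonempty_raiseEquiv (hα : α ≠ N / 2) :
    Nonempty (chartEigenspace N α ≃ₗ[ℂ] chartEigenspace (N + 2) (α - (N + 1))) := by
  let f : chartEigenspace N α →ₗ[ℂ] chartEigenspace (N + 2) (α - (N + 1)) :=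
    { toFun := fun u => ⟨raise N u, raise_mem_chartEigenspace u.2⟩
      map_add' := fun u v => Subtype.ext (raise_add u.2.1 v.2.1)
      map_smul' := fun c u => Subtype.ext (raise_smul c u.2.1) }
  have h0 : α - N / 2 ≠ 0 := sub_ne_zero.2 hα
  refine ⟨LinearEquiv.ofBijective f ⟨?_, ?_⟩⟩
  · intro u v huv
    have h : lower N (raise N u) = lower N (raise N v) :=
      congrArg (lower N) (congrArg Subtype.val huv)
    rw [(mem_chartEigenspace_iff_lower_raise u.2.1).1 u.2,
      (mem_chartEigenspace_iff_lower_raise v.2.1).1 v.2] at h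
    exact Subtype.ext (smul_right_injective _ h0 h)
  · intro v
    -- The inverse of raising is lowering divided by `α - N/2`, since both composites are
    -- multiplication by that number on these eigenspaces.
    refine ⟨(α - N / 2)⁻¹ • ⟨lower N v, lower_mem_chartEigenspace v.2⟩, ?_⟩
    rw [map_smul, inv_smul_eq_iff₀ h0]
    apply Subtype.ext
    change raise N (lower N v) = _
    rw [(mem_chartEigenspace_iff_raise_lower v.2.1).1 v.2]
    simp only [Submodule.coe_smul]
    congr 1
    ring

end Factorization

/-! ### The maximum principle -/

/-- Restrict to a line. A positive second derivative at a maximum would make the point a local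
minimum too, hence the restriction locally constant, with vanishing second derivative. -/
theorem second_directional_deriv_nonpos {g : ℂ → ℝ} (hg : ContDiff ℝ ∞ g) {z : ℂ}
    (hz : ∀ w, g w ≤ g z) (h : ℂ) : fderiv ℝ (fun w => fderiv ℝ g w h) z h ≤ 0 := by
  have hl : ∀ t : ℝ, HasDerivAt (fun t : ℝ => z + t • h) h t := fun t => by
    simpa using ((hasDerivAt_id t).smul_const h).const_add z
  have hd : ∀ {f : ℂ → ℝ}, ContDiff ℝ ∞ f →
      deriv (fun t : ℝ => f (z + t • h)) = fun t : ℝ => fderiv ℝ f (z + t • h) h := by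
    intro f hf
    funext t
    have h1 : HasFDerivAt f (fderiv ℝ f (z + t • h)) (z + t • h) :=
      (hf.contDiffAt.differentiableAt (by simp)).hasFDerivAt
    exact (h1.comp_hasDerivAt t (hl t)).deriv
  have hg' : ContDiff ℝ ∞ fun w => fderiv ℝ g w h :=
    (hg.fderiv_right (m := ∞) (by simp)).clm_apply contDiff_const
  set γ : ℝ → ℝ := fun t => g (z + t • h) with hγ
  have h2 : deriv (deriv γ) 0 = fderiv ℝ (fun w => fderiv ℝ g w h) z h := by
    rw [hγ, hd hg, hd hg']
    simp
  rw [← h2]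
  by_contra! hpos
  have hmax : IsLocalMax γ 0 := Filter.Eventually.of_forall fun t => by
    simpa [hγ] using hz (z + t • h)
  have hcont : ContinuousAt γ 0 :=
    (hg.continuous.comp (by fun_prop : Continuous fun t : ℝ => z + t • h)).continuousAt
  have hmin : IsLocalMin γ 0 := isLocalMin_of_deriv_deriv_pos hpos hmax.deriv_eq_zero hcont
  have hconst : γ =ᶠ[nhds 0] fun _ => γ 0 := by
    filter_upwards [hmax, hmin] with t h1 h2 using le_antisymm h1 h2
  have := hconst.deriv.deriv.eq_of_nhds
  simp at this
  exact hpos.ne' this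

section MaximumPrinciple

variable {N : ℕ} {u v : ℂ → ℂ}

theorem contDiff_conj_comp (hu : ContDiff ℝ ∞ u) : ContDiff ℝ ∞ fun w => (starRingEnd ℂ) (u w) :=
  contDiff_conj.comp hu

theorem fderiv_conj_comp (hu : ContDiff ℝ ∞ u) (z h : ℂ) :
    fderiv ℝ (fun w => (starRingEnd ℂ) (u w)) z h = (starRingEnd ℂ) (fderiv ℝ u z h) := by
  have h1 : HasFDerivAt (fun w => (starRingEnd ℂ) (u w)) _ z :=
    (Complex.conjCLE.hasFDerivAt (x := u z)).comp z (ContDiff.diffAt hu z).hasFDerivAt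
  rw [h1.fderiv]
  simp

theorem dz_conj_comp (hu : ContDiff ℝ ∞ u) (z : ℂ) :
    dz (fun w => (starRingEnd ℂ) (u w)) z = (starRingEnd ℂ) (dzbar u z) := by
  simp only [dz, dzbar, fderiv_conj_comp hu, map_div₀, map_add, map_mul, Complex.conj_I,
    Complex.conj_ofNat]
  ring

theorem dzbar_conj_comp (hu : ContDiff ℝ ∞ u) (z : ℂ) :
    dzbar (fun w => (starRingEnd ℂ) (u w)) z = (starRingEnd ℂ) (dz u z) := by
  simp only [dz, dzbar, fderiv_conj_comp hu, map_div₀, map_sub, map_mul, Complex.conj_I,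
    Complex.conj_ofNat]
  ring

theorem conj_rho (z : ℂ) : (starRingEnd ℂ) (rho z) = rho z := by
  rw [rho_eq_ofReal, Complex.conj_ofReal]

/-- The connection is Hermitian: the potential terms of the two factors cancel, so the covariant
derivatives obey a Leibniz rule for the pairing. -/
theorem dz_mul_conj (N : ℕ) (hu : ContDiff ℝ ∞ u) (hv : ContDiff ℝ ∞ v) (z : ℂ) :
    dz (fun w => u w * (starRingEnd ℂ) (v w)) z =
      nabla N u z * (starRingEnd ℂ) (v z) + u z * (starRingEnd ℂ) (nablaBar N v z) := by
  rw [dz_mul (ContDiff.diffAt hu z) (ContDiff.diffAt (contDiff_conj_comp hv) z), dz_conj_comp hv]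
  simp only [nabla, nablaBar, map_add, map_mul, map_div₀, conj_rho, map_natCast,
    Complex.conj_ofNat]
  ring

theorem dzbar_mul_conj (N : ℕ) (hu : ContDiff ℝ ∞ u) (hv : ContDiff ℝ ∞ v) (z : ℂ) :
    dzbar (fun w => u w * (starRingEnd ℂ) (v w)) z =
      nablaBar N u z * (starRingEnd ℂ) (v z) + u z * (starRingEnd ℂ) (nabla N v z) := by
  rw [dzbar_mul (ContDiff.diffAt hu z) (ContDiff.diffAt (contDiff_conj_comp hv) z),
    dzbar_conj_comp hv]
  simp only [nabla, nablaBar, map_sub, map_mul, map_div₀, conj_rho, map_natCast,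
    Complex.conj_ofNat, Complex.conj_conj]
  ring

/-- The Bochner formula for the pointwise norm of a section. -/
theorem dz_dzbar_normSq (hu : ContDiff ℝ ∞ u) {α : ℂ} (hα : chartLaplacian N u = α • u) (z : ℂ) :
    dz (dzbar fun w => u w * (starRingEnd ℂ) (u w)) z =
      ((Complex.normSq (nabla N u z) + Complex.normSq (nablaBar N u z) -
        2 * α.re * Complex.normSq (u z) / (1 + Complex.normSq z) ^ 2 : ℝ) : ℂ) := by
  have h0 := rho_ne_zero z
  have e : dzbar (fun w => u w * (starRingEnd ℂ) (u w)) = fun w =>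
      nablaBar N u w * (starRingEnd ℂ) (u w) + u w * (starRingEnd ℂ) (nabla N u w) := by
    funext w
    exact dzbar_mul_conj N hu hu w
  have hn := contDiff_nabla N hu
  have hb := contDiff_nablaBar N hu
  -- The two mixed second derivatives are multiples of `u` with curvature terms `+N/2` and `-N/2`.
  -- These cancel in the sum below, which leaves `-2 Re α`.
  have h1 : nabla N (nablaBar N u) z = -(α - N / 2) * u z / rho z ^ 2 := by
    have := congrFun hα z
    simp only [chartLaplacian, Pi.smul_apply, smul_eq_mul] at this
    field_simp
    linear_combination -2 * this
  have h2 : nablaBar N (nabla N u) z = -(α + N / 2) * u z / rho z ^ 2 := by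
    have := nabla_nablaBar_sub N hu z
    rw [h1] at this
    linear_combination -this
  rw [e, dz_add (ContDiff.diffAt (hb.mul (contDiff_conj_comp hu)) z)
    (ContDiff.diffAt (hu.mul (contDiff_conj_comp hn)) z), dz_mul_conj N hb hu, dz_mul_conj N hu hn,
    h1, h2]
  have hre : ((α.re : ℝ) : ℂ) = (α + (starRingEnd ℂ) α) / 2 := by
    rw [Complex.add_conj]; push_cast; ring
  push_cast
  rw [← Complex.mul_conj, ← Complex.mul_conj, ← Complex.mul_conj, hre]
  have hρ : (1 + (Complex.normSq z : ℂ)) = rho z := by rw [rho_eq_ofReal]; push_cast; rfl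
  rw [hρ]
  simp only [map_mul, map_neg, map_add, map_div₀, map_pow, conj_rho, map_natCast,
    Complex.conj_ofNat]
  field_simp
  ring

/-- The real part of `∂∂̄` is a quarter of the Euclidean Laplacian, a sum of two second directional
derivatives. -/
theorem re_dz_dzbar_ofReal_nonpos {g : ℂ → ℝ} (hg : ContDiff ℝ ∞ g) {z : ℂ}
    (hz : ∀ w, g w ≤ g z) : (dz (dzbar fun w => (g w : ℂ)) z).re ≤ 0 := by
  have hc : ∀ {f : ℂ → ℝ}, ContDiff ℝ ∞ f → ∀ z h : ℂ,
      fderiv ℝ (fun w => (f w : ℂ)) z h = (fderiv ℝ f z h : ℝ) := by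
    intro f hf z h
    have h1 : HasFDerivAt (fun w => (f w : ℂ)) _ z :=
      (Complex.ofRealCLM.hasFDerivAt (x := f z)).comp z
        (hf.contDiffAt.differentiableAt (by simp)).hasFDerivAt
    rw [h1.fderiv]
    simp
  have hD : ∀ h : ℂ, ContDiff ℝ ∞ fun w => fderiv ℝ g w h := fun h =>
    (hg.fderiv_right (m := ∞) (by simp)).clm_apply contDiff_const
  have hC : ∀ h : ℂ, ContDiff ℝ ∞ fun w => ((fderiv ℝ g w h : ℝ) : ℂ) := fun h =>
    Complex.ofRealCLM.contDiff.comp (hD h)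
  have e : dzbar (fun w => (g w : ℂ)) = fun w => (1 / 2) * ((fderiv ℝ g w 1 : ℝ) : ℂ) +
      Complex.I / 2 * ((fderiv ℝ g w Complex.I : ℝ) : ℂ) := by
    funext w
    simp only [dzbar, hc hg]
    ring
  rw [e, dz_add ((differentiableAt_const _).fun_mul (ContDiff.diffAt (hC _) z))
    ((differentiableAt_const _).fun_mul (ContDiff.diffAt (hC _) z)),
    dz_mul (differentiableAt_const _) (ContDiff.diffAt (hC _) z),
    dz_mul (differentiableAt_const _) (ContDiff.diffAt (hC _) z), dz_const, dz_const]
  simp only [dz, hc (hD _)]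
  have h1 := second_directional_deriv_nonpos hg hz 1
  have h2 := second_directional_deriv_nonpos hg hz Complex.I
  simp
  linarith

/-- At a maximum of `|u|²` the value of `∂∂̄|u|²` is at most `0`, while the Bochner formula bounds
it below by `-2 Re α |u|²/ρ²`, which is positive unless `u` vanishes there. -/
theorem eq_zero_of_isMax (hu : ContDiff ℝ ∞ u) {α : ℂ} (hα : chartLaplacian N u = α • u)
    (hneg : α.re < 0) {z : ℂ} (hz : ∀ w, ‖u w‖ ≤ ‖u z‖) : u z = 0 := by
  have hg : ContDiff ℝ ∞ fun w => Complex.normSq (u w) := by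
    have : (fun w => Complex.normSq (u w)) = fun w => (u w * (starRingEnd ℂ) (u w)).re := by
      funext w
      rw [Complex.mul_conj, Complex.ofReal_re]
    rw [this]
    exact Complex.reCLM.contDiff.comp (hu.mul (contDiff_conj_comp hu))
  have h1 := re_dz_dzbar_ofReal_nonpos hg (z := z) fun w => by
    rw [Complex.normSq_eq_norm_sq, Complex.normSq_eq_norm_sq]
    exact pow_le_pow_left₀ (norm_nonneg _) (hz w) 2
  have h2 := dz_dzbar_normSq hu hα z
  simp only [Complex.mul_conj] at h2
  rw [h2, Complex.ofReal_re] at h1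
  have h3 := Complex.normSq_nonneg (nabla N u z)
  have h4 := Complex.normSq_nonneg (nablaBar N u z)
  have h5 := Complex.normSq_nonneg (u z)
  have h6 := Complex.normSq_nonneg z
  rw [← Complex.normSq_eq_zero]
  by_contra hne
  have h7 : 0 < Complex.normSq (u z) := lt_of_le_of_ne h5 (Ne.symm hne)
  have h8 : 2 * α.re * Complex.normSq (u z) / (1 + Complex.normSq z) ^ 2 < 0 :=
    div_neg_of_neg_of_pos (by nlinarith) (by positivity)
  linarith

theorem norm_direction_pow {z : ℂ} (hz : z ≠ 0) (N : ℕ) : ‖direction z ^ N‖ = 1 := by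
  rw [norm_pow, direction, norm_div, Complex.norm_real, norm_norm,
    div_self (norm_ne_zero_iff.2 hz), one_pow]

/-- Compactness of the sphere: the closed unit discs of the two charts cover it, and the transition
factor has modulus one, so the norm of a section does not depend on the chart. -/
theorem exists_isMax {u : (ℂ → ℂ) × (ℂ → ℂ)} (hu : u ∈ chartSections N) :
    (∃ z, (∀ w, ‖u.1 w‖ ≤ ‖u.1 z‖) ∧ ∀ w, ‖u.2 w‖ ≤ ‖u.1 z‖) ∨
      ∃ z, (∀ w, ‖u.1 w‖ ≤ ‖u.2 z‖) ∧ ∀ w, ‖u.2 w‖ ≤ ‖u.2 z‖ := by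
  obtain ⟨h1, h2, h⟩ := hu
  have hK : IsCompact (Metric.closedBall (0 : ℂ) 1) := isCompact_closedBall 0 1
  have hne : (Metric.closedBall (0 : ℂ) 1).Nonempty := ⟨0, by simp⟩
  obtain ⟨a, -, ha⟩ := hK.exists_isMaxOn hne h1.continuous.norm.continuousOn
  obtain ⟨b, -, hb⟩ := hK.exists_isMaxOn hne h2.continuous.norm.continuousOn
  have ha' : ∀ w : ℂ, ‖w‖ ≤ 1 → ‖u.1 w‖ ≤ ‖u.1 a‖ := fun w hw => ha (by simpa using hw)
  have hb' : ∀ w : ℂ, ‖w‖ ≤ 1 → ‖u.2 w‖ ≤ ‖u.2 b‖ := fun w hw => hb (by simpa using hw)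
  have hn : ∀ z, z ≠ 0 → ‖u.1 z‖ = ‖u.2 z⁻¹‖ := fun z hz => by
    rw [h z hz, norm_mul, norm_direction_pow hz, one_mul]
  have hinv : ∀ w : ℂ, 1 < ‖w‖ → w ≠ 0 ∧ ‖w⁻¹‖ ≤ 1 := fun w hw =>
    ⟨norm_pos_iff.1 (one_pos.trans hw), by rw [norm_inv]; exact inv_le_one_of_one_le₀ hw.le⟩
  have k1 : ∀ w, ‖u.1 w‖ ≤ max ‖u.1 a‖ ‖u.2 b‖ := fun w => by
    rcases le_or_gt ‖w‖ 1 with hw | hw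
    · exact (ha' w hw).trans (le_max_left _ _)
    · rw [hn w (hinv w hw).1]
      exact (hb' _ (hinv w hw).2).trans (le_max_right _ _)
  have k2 : ∀ w, ‖u.2 w‖ ≤ max ‖u.1 a‖ ‖u.2 b‖ := fun w => by
    rcases le_or_gt ‖w‖ 1 with hw | hw
    · exact (hb' w hw).trans (le_max_right _ _)
    · have := hn w⁻¹ (inv_ne_zero (hinv w hw).1)
      rw [inv_inv] at this
      rw [← this]
      exact (ha' _ (hinv w hw).2).trans (le_max_left _ _)
  rcases le_total ‖u.1 a‖ ‖u.2 b‖ with hab | hab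
  · rw [max_eq_right hab] at k1 k2
    exact Or.inr ⟨b, k1, k2⟩
  · rw [max_eq_left hab] at k1 k2
    exact Or.inl ⟨a, k1, k2⟩

theorem chartEigenspace_eq_bot {α : ℂ} (hα : α.re < 0) : chartEigenspace N α = ⊥ := by
  rw [eq_bot_iff]
  rintro u ⟨hu, e1, e2⟩
  have key : (∀ w, ‖u.1 w‖ ≤ 0) ∧ ∀ w, ‖u.2 w‖ ≤ 0 := by
    rcases exists_isMax hu with ⟨z, h1, h2⟩ | ⟨z, h1, h2⟩
    · have e := eq_zero_of_isMax hu.1 e1 hα h1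
      rw [e, norm_zero] at h1 h2
      exact ⟨h1, h2⟩
    · have e := eq_zero_of_isMax hu.2.1 e2 hα h2
      rw [e, norm_zero] at h1 h2
      exact ⟨h1, h2⟩
  rw [Submodule.mem_bot]
  ext w
  · exact norm_le_zero_iff.1 (key.1 w)
  · exact norm_le_zero_iff.1 (key.2 w)

end MaximumPrinciple

/-! ### The lowest eigenvalue and polynomials -/

/-- The square root of the conformal factor `1 + |z|²`. -/
def weight (z : ℂ) : ℂ := ((√(1 + Complex.normSq z) : ℝ) : ℂ)

theorem one_add_normSq_pos (z : ℂ) : 0 < 1 + Complex.normSq z := by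
  have := Complex.normSq_nonneg z
  positivity

theorem weight_sq (z : ℂ) : weight z ^ 2 = rho z := by
  rw [weight, rho_eq_ofReal, ← Complex.ofReal_pow, Real.sq_sqrt (one_add_normSq_pos z).le]

theorem weight_ne_zero (z : ℂ) : weight z ≠ 0 := by
  intro h
  have := weight_sq z
  rw [h] at this
  exact rho_ne_zero z (by rw [← this]; simp)

theorem contDiff_weight : ContDiff ℝ ∞ weight := by
  have h : ContDiff ℝ ∞ fun z : ℂ => 1 + Complex.normSq z := by
    have : (fun z : ℂ => 1 + Complex.normSq z) = fun z => (rho z).re := by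
      funext z
      rw [rho_eq_ofReal, Complex.ofReal_re]
    rw [this]
    exact Complex.reCLM.contDiff.comp contDiff_rho
  exact Complex.ofRealCLM.contDiff.comp (h.sqrt fun z => (one_add_normSq_pos z).ne')

theorem contDiff_weight_inv_pow (N : ℕ) : ContDiff ℝ ∞ fun z => (weight z)⁻¹ ^ N :=
  (contDiff_weight.inv weight_ne_zero).pow N

theorem differentiableAt_weight_inv (z : ℂ) : DifferentiableAt ℝ (fun w => (weight w)⁻¹) z :=
  ContDiff.diffAt (contDiff_weight.inv weight_ne_zero) z

theorem dzbar_weight_inv (z : ℂ) :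
    dzbar (fun w => (weight w)⁻¹) z = -(z / (2 * rho z)) * (weight z)⁻¹ := by
  have hd := differentiableAt_weight_inv z
  have h := dzbar_mul hd hd
  have e : (fun w => (weight w)⁻¹ * (weight w)⁻¹) = fun w => (rho w)⁻¹ := by
    funext w
    rw [← weight_sq]
    ring
  rw [e, dzbar_inv_rho, ← weight_sq] at h
  rw [← weight_sq]
  have h0 := weight_ne_zero z
  field_simp at h ⊢
  linear_combination -h

theorem dzbar_weight_inv_pow (z : ℂ) (N : ℕ) :
    dzbar (fun w => (weight w)⁻¹ ^ N) z = -(N / 2 * (z / rho z)) * (weight z)⁻¹ ^ N := by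
  induction N with
  | zero => simp [dzbar_const]
  | succ n ih =>
    simp only [pow_succ]
    rw [dzbar_mul (ContDiff.diffAt (contDiff_weight_inv_pow n) z)
      (differentiableAt_weight_inv z), ih, dzbar_weight_inv]
    have h0 := rho_ne_zero z
    push_cast
    field_simp
    ring

/-- The factor `ρ^(-N/2)` passes from the unitary to the holomorphic frame, in which `∇̄` is `∂̄`.
Hence the kernel of `∇̄` corresponds to holomorphic functions. -/
theorem nablaBar_weight_mul (N : ℕ) {f : ℂ → ℂ} (hf : ContDiff ℝ ∞ f) (z : ℂ) :
    nablaBar N (fun w => (weight w)⁻¹ ^ N * f w) z = (weight z)⁻¹ ^ N * dzbar f z := by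
  rw [nablaBar, dzbar_mul (ContDiff.diffAt (contDiff_weight_inv_pow N) z) (ContDiff.diffAt hf z),
    dzbar_weight_inv_pow]
  ring

theorem chartLaplacian_eq_of_nablaBar_eq_zero {N : ℕ} {u : ℂ → ℂ} (h : nablaBar N u = 0) :
    chartLaplacian N u = (N / 2 : ℂ) • u := by
  have h1 : nabla N 0 = 0 := by
    simpa using nabla_smul N 0 (u := 0) contDiff_const
  funext z
  simp [chartLaplacian, h, h1]

theorem weight_inv (z : ℂ) (hz : z ≠ 0) : weight z⁻¹ * (‖z‖ : ℂ) = weight z := by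
  have h : 1 + Complex.normSq z⁻¹ = (1 + Complex.normSq z) / ‖z‖ ^ 2 := by
    have h0 : ‖z‖ ≠ 0 := norm_ne_zero_iff.2 hz
    rw [Complex.normSq_eq_norm_sq, Complex.normSq_eq_norm_sq, norm_inv]
    field_simp
    ring
  have h0 : ‖z‖ ≠ 0 := norm_ne_zero_iff.2 hz
  rw [weight, weight, h, Real.sqrt_div (one_add_normSq_pos z).le, Real.sqrt_sq (norm_nonneg z),
    ← Complex.ofReal_mul, div_mul_cancel₀ _ h0]

/-- The section of the `N`-th power of the monopole bundle that corresponds to the polynomial with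
coefficients `c`. -/
def holomorphicSection (N : ℕ) (c : Fin (N + 1) → ℂ) : (ℂ → ℂ) × (ℂ → ℂ) :=
  (fun z => (weight z)⁻¹ ^ N * ∑ k, c k * z ^ (k : ℕ),
    fun z => (weight z)⁻¹ ^ N * ∑ k, c k * z ^ (N - k : ℕ))

theorem nablaBar_weight_mul_polynomial (N : ℕ) {ι : Type*} [Fintype ι] (c : ι → ℂ) (e : ι → ℕ) :
    nablaBar N (fun w => (weight w)⁻¹ ^ N * ∑ k, c k * w ^ e k) = 0 := by
  funext z
  rw [nablaBar_weight_mul N (by fun_prop), dzbar_of_holomorphic (by fun_prop)]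
  simp

/-- In the second chart the polynomial `p` is replaced by its reversal, of value `z^N p(1/z)`. The
powers of `|z|` in the transition factor are absorbed by `weight (1/z) * |z| = weight z`. -/
theorem holomorphicSection_mem (N : ℕ) (c : Fin (N + 1) → ℂ) :
    holomorphicSection N c ∈ chartEigenspace N (N / 2) := by
  refine ⟨⟨(contDiff_weight_inv_pow N).mul (by fun_prop),
    (contDiff_weight_inv_pow N).mul (by fun_prop), fun z hz => ?_⟩,
    chartLaplacian_eq_of_nablaBar_eq_zero (nablaBar_weight_mul_polynomial N c _),
    chartLaplacian_eq_of_nablaBar_eq_zero (nablaBar_weight_mul_polynomial N c _)⟩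
  have h0 : (‖z‖ : ℂ) ≠ 0 := by simpa using hz
  have h1 := weight_ne_zero z⁻¹
  simp only [holomorphicSection]
  rw [← weight_inv z hz, ← mul_assoc, ← mul_pow, Finset.mul_sum, Finset.mul_sum]
  refine Finset.sum_congr rfl fun k _ => ?_
  have hk : z ^ N = z ^ (k : ℕ) * z ^ (N - k : ℕ) := by
    rw [← pow_add]
    congr 1
    have := k.2
    omega
  rw [direction, mul_inv, mul_pow, mul_pow, div_pow, hk, inv_pow z, inv_pow (‖z‖ : ℂ)]
  field_simp

/-- The first chart misses a single point of the sphere, so continuity determines the second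
component. -/
theorem chartSections_ext {N : ℕ} {u v : (ℂ → ℂ) × (ℂ → ℂ)} (hu : u ∈ chartSections N)
    (hv : v ∈ chartSections N) (h : u.1 = v.1) : u = v := by
  refine Prod.ext h ?_
  have hne : ∀ w, w ≠ 0 → u.2 w = v.2 w := by
    intro w hw
    have h1 := hu.2.2 w⁻¹ (inv_ne_zero hw)
    have h2 := hv.2.2 w⁻¹ (inv_ne_zero hw)
    rw [h, h2, inv_inv] at h1
    refine (mul_left_cancel₀ (norm_ne_zero_iff.1 ?_) h1).symm
    rw [norm_direction_pow (inv_ne_zero hw)]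
    exact one_ne_zero
  exact Continuous.ext_on (dense_compl_singleton (0 : ℂ)) hu.2.1.continuous hv.2.1.continuous
    fun w hw => hne w hw

/-- An entire function of polynomial growth is a polynomial. -/
theorem eq_sum_of_norm_le {f : ℂ → ℂ} (hf : Differentiable ℂ f) {C : ℝ} {N : ℕ}
    (h : ∀ z, ‖f z‖ ≤ C * (1 + ‖z‖) ^ N) :
    ∃ c : Fin (N + 1) → ℂ, ∀ z, f z = ∑ k, c k * z ^ (k : ℕ) := by
  -- Cauchy's estimate on the circle of radius `r ≥ 1`, where `1 + r ≤ 2r`, gives a bound of order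
  -- `r^N / r^n ≤ 1/r`; then `r → ∞`.
  have hzero : ∀ n, N < n → iteratedDeriv n f 0 = 0 := by
    intro n hn
    have hC : 0 ≤ C := by simpa using (norm_nonneg _).trans (h 0)
    have hb : ∀ r : ℝ, 1 ≤ r → ‖iteratedDeriv n f 0‖ ≤ n.factorial * (C * 2 ^ N) / r := by
      intro r hr
      have hr0 : 0 < r := one_pos.trans_le hr
      have := Complex.norm_iteratedDeriv_le_of_forall_mem_sphere_norm_le (c := 0)
        (C := C * (2 * r) ^ N) n hr0 hf.diffContOnCl fun z hz => (h z).trans (by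
          have hz' : ‖z‖ = r := by simpa using hz
          rw [hz']
          gcongr
          linarith)
      refine this.trans ?_
      rw [div_le_div_iff₀ (by positivity) hr0]
      calc n.factorial * (C * (2 * r) ^ N) * r = n.factorial * (C * 2 ^ N) * r ^ (N + 1) := by ring
        _ ≤ n.factorial * (C * 2 ^ N) * r ^ n := by
          gcongr
          exact hn
    have hlim : Filter.Tendsto (fun r : ℝ => n.factorial * (C * 2 ^ N) / r) Filter.atTop (nhds 0) :=
      Filter.Tendsto.div_atTop tendsto_const_nhds Filter.tendsto_id
    exact norm_le_zero_iff.1 (ge_of_tendsto hlim (Filter.eventually_atTop.2 ⟨1, hb⟩))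
  refine ⟨fun k => (((k : ℕ).factorial : ℂ))⁻¹ * iteratedDeriv k f 0, fun z => ?_⟩
  rw [← Complex.taylorSeries_eq_of_entire' 0 z hf, tsum_eq_sum (s := Finset.range (N + 1))
    (fun n hn => by rw [hzero n (by have := Finset.mem_range.not.1 hn; omega)]; simp),
    Finset.sum_range]
  simp

theorem exists_norm_le {N : ℕ} {u : (ℂ → ℂ) × (ℂ → ℂ)} (hu : u ∈ chartSections N) :
    ∃ C, ∀ z, ‖u.1 z‖ ≤ C := by
  rcases exists_isMax hu with ⟨z, h, -⟩ | ⟨z, h, -⟩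
  exacts [⟨_, h⟩, ⟨_, h⟩]

theorem norm_weight_le (z : ℂ) : ‖weight z‖ ≤ 1 + ‖z‖ := by
  rw [weight, Complex.norm_real, Real.norm_of_nonneg (Real.sqrt_nonneg _),
    Complex.normSq_eq_norm_sq]
  apply Real.sqrt_le_iff.2
  constructor
  · positivity
  · nlinarith [norm_nonneg z]

/-- Raising would produce an eigensection with eigenvalue `N/2 - (N+1) = -(N/2 + 1)`, which is
negative, so it vanishes by the maximum principle. -/
theorem nablaBar_eq_zero_of_mem {N : ℕ} {u : (ℂ → ℂ) × (ℂ → ℂ)}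
    (hu : u ∈ chartEigenspace N (N / 2)) : nablaBar N u.1 = 0 := by
  have h := raise_mem_chartEigenspace hu
  rw [chartEigenspace_eq_bot, Submodule.mem_bot] at h
  · funext z
    have := congrFun (congrArg Prod.fst h) z
    simp only [raise, Prod.fst_zero, Pi.zero_apply, mul_eq_zero] at this
    exact this.resolve_left (rho_ne_zero z)
  · have : (N / 2 - (N + 1) : ℂ) = ((-(N / 2 + 1) : ℝ) : ℂ) := by push_cast; ring
    rw [this, Complex.ofReal_re]
    have : (0 : ℝ) ≤ N := N.cast_nonneg
    linarith

/-- In the holomorphic frame the section becomes an entire function. Sections are bounded and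
`weight z ≤ 1 + |z|`, so it grows at most like `(1 + |z|)^N`. -/
theorem exists_eq_holomorphicSection {N : ℕ} {u : (ℂ → ℂ) × (ℂ → ℂ)}
    (hu : u ∈ chartEigenspace N (N / 2)) : ∃ c, holomorphicSection N c = u := by
  set f : ℂ → ℂ := fun z => weight z ^ N * u.1 z with hf
  have hfs : ContDiff ℝ ∞ f := (contDiff_weight.pow N).mul hu.1.1
  have hu1 : u.1 = fun z => (weight z)⁻¹ ^ N * f z := by
    funext z
    rw [hf, ← mul_assoc, ← mul_pow, inv_mul_cancel₀ (weight_ne_zero z), one_pow, one_mul]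
  have hdz : ∀ z, dzbar f z = 0 := fun z => by
    have h := congrFun (nablaBar_eq_zero_of_mem hu) z
    rw [hu1, nablaBar_weight_mul N hfs] at h
    exact (mul_eq_zero.1 h).resolve_left (pow_ne_zero _ (inv_ne_zero (weight_ne_zero z)))
  have hhol : Differentiable ℂ f := fun z => by
    rw [differentiableAt_complex_iff_differentiableAt_real]
    refine ⟨ContDiff.diffAt hfs z, ?_⟩
    have h := hdz z
    simp only [dzbar, div_eq_zero_iff, OfNat.ofNat_ne_zero, or_false] at h
    rw [smul_eq_mul]
    linear_combination (-Complex.I) * h + fderiv ℝ f z Complex.I * Complex.I_mul_I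
  obtain ⟨C, hC⟩ := exists_norm_le hu.1
  obtain ⟨c, hc⟩ := eq_sum_of_norm_le hhol (C := C) (N := N) fun z => by
    rw [hf, norm_mul, norm_pow, mul_comm]
    have := hC z
    have h0 := norm_weight_le z
    have : 0 ≤ C := (norm_nonneg _).trans this
    gcongr
  refine ⟨c, chartSections_ext (holomorphicSection_mem N c).1 hu.1 ?_⟩
  rw [hu1]
  funext z
  rw [hc]
  rfl

theorem rank_chartEigenspace_lowest (N : ℕ) :
    Module.rank ℂ (chartEigenspace N (N / 2)) = (N + 1 : ℕ) := by
  let f : (Fin (N + 1) → ℂ) →ₗ[ℂ] chartEigenspace N (N / 2) :=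
    { toFun := fun c => ⟨holomorphicSection N c, holomorphicSection_mem N c⟩
      map_add' := fun c d => by
        apply Subtype.ext
        ext z <;> simp [holomorphicSection, add_mul, Finset.sum_add_distrib, mul_add]
      map_smul' := fun a c => by
        apply Subtype.ext
        ext z <;> simp [holomorphicSection, Finset.mul_sum, mul_left_comm, mul_assoc] }
  have hf : Function.Bijective f := by
    constructor
    · rw [injective_iff_map_eq_zero]
      intro c hc
      have h : (∑ k, Polynomial.C (c k) * Polynomial.X ^ (k : ℕ) : Polynomial ℂ) = 0 := by
        apply Polynomial.funext
        intro z
        have h1 := congrFun (congrArg Prod.fst (congrArg Subtype.val hc)) z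
        change (weight z)⁻¹ ^ N * ∑ k, c k * z ^ (k : ℕ) = 0 at h1
        have h2 := (mul_eq_zero.1 h1).resolve_left
          (pow_ne_zero _ (inv_ne_zero (weight_ne_zero z)))
        simpa [Polynomial.eval_finsetSum] using h2
      funext k
      have := congrArg (fun p => Polynomial.coeff p k) h
      simpa [Polynomial.finsetSum_coeff, Polynomial.coeff_X_pow, Fin.val_inj] using this
    · intro u
      obtain ⟨c, hc⟩ := exists_eq_holomorphicSection u.2
      exact ⟨c, Subtype.ext hc⟩
  rw [← (LinearEquiv.ofBijective f hf).rank_eq, rank_fin_fun]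

/-! ### The whole spectrum of the unit sphere -/

/-- The eigenvalues of the magnetic Laplacian on the `N`-th power of the monopole bundle over the
unit sphere. -/
def level (N n : ℕ) : ℝ := (n + (N + 1) / 2 : ℝ) ^ 2 - 1 / 4 - (N : ℝ) ^ 2 / 4

theorem level_zero (N : ℕ) : level N 0 = N / 2 := by
  simp only [level]; push_cast; ring

theorem level_succ (N n : ℕ) : level N (n + 1) = level (N + 2) n + (N + 1) := by
  simp only [level]; push_cast; ring

theorem level_strictMono (N : ℕ) : StrictMono (level N) := by
  intro a b hab
  have h : (a : ℝ) < b := by exact_mod_cast hab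
  have ha : (0 : ℝ) ≤ a := a.cast_nonneg
  have hN : (0 : ℝ) ≤ N := N.cast_nonneg
  simp only [level]
  nlinarith

/-- Raising `n` times carries the eigenspace to the lowest one of `L^(N+2n)`, of dimension `N + 2n +
1`. -/
theorem rank_chartEigenspace_level (n N : ℕ) :
    Module.rank ℂ (chartEigenspace N (level N n : ℝ)) = (N + 2 * n + 1 : ℕ) := by
  induction n generalizing N with
  | zero =>
    have hl : ((N / 2 : ℝ) : ℂ) = N / 2 := by push_cast; ring
    rw [level_zero, mul_zero, add_zero, ← rank_chartEigenspace_lowest N, hl]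
  | succ n ih =>
    have hne : ((level N (n + 1) : ℝ) : ℂ) ≠ N / 2 := by
      have h := level_strictMono N (Nat.succ_pos n)
      rw [level_zero] at h
      intro h2
      have h3 : level N (n + 1) = N / 2 := Complex.ofReal_injective (by push_cast; exact h2)
      exact h.ne' h3
    obtain ⟨e⟩ := nonempty_raiseEquiv hne
    have hl : ((level N (n + 1) : ℝ) : ℂ) - (N + 1) = (level (N + 2) n : ℝ) := by
      rw [level_succ]; push_cast; ring
    rw [e.rank_eq, hl, ih (N + 2)]
    congr 1
    ring

/-- Each raising lowers the real part of the eigenvalue by `N + 1 ≥ 1` and never meets the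
exceptional value. After finitely many steps the real part is negative, so the induction runs on an
integer upper bound `K` for it. -/
theorem chartEigenspace_eq_bot_of_ne_level {α : ℂ} {N : ℕ} (h : ∀ n, α ≠ (level N n : ℝ)) :
    Module.rank ℂ (chartEigenspace N α) = 0 := by
  obtain ⟨K, hK⟩ := exists_nat_gt α.re
  induction K generalizing N α with
  | zero =>
    rw [chartEigenspace_eq_bot (by simpa using hK)]
    simp
  | succ K ih =>
    have hne : α ≠ N / 2 := by
      have := h 0
      rw [level_zero] at this
      push_cast at this
      exact this
    obtain ⟨e⟩ := nonempty_raiseEquiv hne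
    rw [e.rank_eq]
    refine ih (fun n hn => h (n + 1) ?_) ?_
    · rw [level_succ]
      push_cast
      rw [← hn]
      ring
    · have : (0 : ℝ) ≤ N := N.cast_nonneg
      push_cast at hK
      simp
      linarith

/-! ### From complex coordinates to real ones and radius `R` -/

/-- The identification of the complex plane with `ℝ²`. -/
def planeEquiv : ℂ ≃L[ℝ] (Fin 2 → ℝ) := Complex.basisOneI.equivFun.toContinuousLinearEquiv

@[simp] theorem planeEquiv_zero (z : ℂ) : planeEquiv z 0 = z.re := by
  simp [planeEquiv]

@[simp] theorem planeEquiv_one (z : ℂ) : planeEquiv z 1 = z.im := by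
  simp [planeEquiv]

theorem planeEquiv_apply_one : planeEquiv 1 = Pi.single 0 1 := by
  ext i
  fin_cases i <;> simp

theorem planeEquiv_apply_I : planeEquiv Complex.I = Pi.single 1 1 := by
  ext i
  fin_cases i <;> simp

theorem one_add_sq_planeEquiv (z : ℂ) :
    1 + planeEquiv z 0 ^ 2 + planeEquiv z 1 ^ 2 = 1 + Complex.normSq z := by
  rw [planeEquiv_zero, planeEquiv_one, Complex.normSq_apply]
  ring

theorem fderiv_comp_planeEquiv (u : (Fin 2 → ℝ) → ℂ) (z h : ℂ) :
    fderiv ℝ (u ∘ planeEquiv) z h = fderiv ℝ u (planeEquiv z) (planeEquiv h) := by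
  rw [planeEquiv.comp_right_fderiv]
  rfl

theorem covDeriv_zero_planeEquiv (N : ℕ) (u : (Fin 2 → ℝ) → ℂ) (z : ℂ) :
    covDeriv monopolePotential N 0 u (planeEquiv z) =
      nabla N (u ∘ planeEquiv) z + nablaBar N (u ∘ planeEquiv) z := by
  have h1 : z - (starRingEnd ℂ) z = 2 * z.im * Complex.I := by
    rw [Complex.sub_conj]; push_cast; ring
  have hA : ((monopolePotential (planeEquiv z) 0 : ℝ) : ℂ) = -z.im / rho z := by
    rw [rho_eq_ofReal, ← one_add_sq_planeEquiv]
    simp [monopolePotential]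
  simp only [covDeriv, partialDeriv, ← planeEquiv_apply_one, ← fderiv_comp_planeEquiv,
    hA, nabla, nablaBar, dz, dzbar, Function.comp_apply]
  linear_combination (-(N / 2 / rho z * u (planeEquiv z))) * h1

theorem covDeriv_one_planeEquiv (N : ℕ) (u : (Fin 2 → ℝ) → ℂ) (z : ℂ) :
    covDeriv monopolePotential N 1 u (planeEquiv z) =
      Complex.I * (nabla N (u ∘ planeEquiv) z - nablaBar N (u ∘ planeEquiv) z) := by
  have h1 : z + (starRingEnd ℂ) z = 2 * z.re := by
    rw [Complex.add_conj]; push_cast; ring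
  have hA : ((monopolePotential (planeEquiv z) 1 : ℝ) : ℂ) = z.re / rho z := by
    rw [rho_eq_ofReal, ← one_add_sq_planeEquiv]
    simp [monopolePotential]
  simp only [covDeriv, partialDeriv, ← planeEquiv_apply_I, ← fderiv_comp_planeEquiv,
    hA, nabla, nablaBar, dz, dzbar, Function.comp_apply]
  linear_combination (N / 2 / rho z * u (planeEquiv z) * Complex.I) * h1 +
    fderiv ℝ (u ∘ planeEquiv) z Complex.I * Complex.I_mul_I

/-- Since the real covariant derivatives are `∇ + ∇̄` and `i(∇ - ∇̄)`, the sum of their squares is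
`2(∇∇̄ + ∇̄∇)`, that is, `4∇∇̄ - 2N/ρ²` by the curvature identity. -/
theorem sum_covDeriv_covDeriv_planeEquiv (N : ℕ) {u : (Fin 2 → ℝ) → ℂ} (hu : ContDiff ℝ ∞ u)
    (z : ℂ) :
    covDeriv monopolePotential N 0 (covDeriv monopolePotential N 0 u) (planeEquiv z) +
      covDeriv monopolePotential N 1 (covDeriv monopolePotential N 1 u) (planeEquiv z) =
      -(4 / rho z ^ 2) * chartLaplacian N (u ∘ planeEquiv) z := by
  set v := u ∘ planeEquiv with hv
  have hvs : ContDiff ℝ ∞ v := hu.comp planeEquiv.contDiff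
  have hn := contDiff_nabla N hvs
  have hb := contDiff_nablaBar N hvs
  have e0 : covDeriv monopolePotential N 0 u ∘ planeEquiv = nabla N v + nablaBar N v :=
    funext fun z => covDeriv_zero_planeEquiv N u z
  have e1 : covDeriv monopolePotential N 1 u ∘ planeEquiv =
      Complex.I • (nabla N v + (-1 : ℂ) • nablaBar N v) := by
    funext z
    have := covDeriv_one_planeEquiv N u z
    simp only [Function.comp_apply, this, Pi.smul_apply, Pi.add_apply, smul_eq_mul, hv]
    ring
  have hc := nabla_nablaBar_sub N hvs z
  have hb' : ContDiff ℝ ∞ ((-1 : ℂ) • nablaBar N v) := hb.const_smul (-1 : ℂ)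
  have hd : ContDiff ℝ ∞ (nabla N v + (-1 : ℂ) • nablaBar N v) := hn.add hb'
  rw [covDeriv_zero_planeEquiv, covDeriv_one_planeEquiv, e0, e1, nabla_add N hn hb,
    nablaBar_add N hn hb, nabla_smul N _ hd, nablaBar_smul N _ hd,
    nabla_add N hn hb', nablaBar_add N hn hb',
    nabla_smul N _ hb, nablaBar_smul N _ hb]
  simp only [Pi.add_apply, Pi.smul_apply, smul_eq_mul, chartLaplacian]
  have h0 := rho_ne_zero z
  have h3 : nablaBar N (nabla N v) z = nabla N (nablaBar N v) z - N / rho z ^ 2 * v z := by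
    linear_combination -hc
  rw [h3]
  field_simp
  linear_combination 2 * (rho z ^ 2 * (nabla N (nabla N v) z - 2 * nabla N (nablaBar N v) z
    + nablaBar N (nablaBar N v) z) + N * v z) * Complex.I_sq

/-- In dimension two `|g|^(1/2) g⁻¹` is the identity matrix for a conformally flat metric. The
metric only enters through the prefactor `|g|^(-1/2) = ρ²/(4R²)`. -/
theorem magneticLaplacian_planeEquiv {g : (Fin 2 → ℝ) → Matrix (Fin 2) (Fin 2) ℝ} {R : ℝ}
    (hR : 0 < R) (hg : ∀ x, g x = (4 * R ^ 2 / (1 + x 0 ^ 2 + x 1 ^ 2) ^ 2) • 1) (N : ℕ)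
    {u : (Fin 2 → ℝ) → ℂ} (hu : ContDiff ℝ ∞ u) (z : ℂ) :
    magneticLaplacian g monopolePotential N u (planeEquiv z) =
      chartLaplacian N (u ∘ planeEquiv) z / R ^ 2 := by
  have hdet : ∀ y : Fin 2 → ℝ, √((g y).det) = 4 * R ^ 2 / (1 + y 0 ^ 2 + y 1 ^ 2) ^ 2 := by
    intro y
    have hpos : 0 < 4 * R ^ 2 / (1 + y 0 ^ 2 + y 1 ^ 2) ^ 2 := by positivity
    rw [hg, Matrix.det_smul, Matrix.det_one, mul_one, Fintype.card_fin, Real.sqrt_sq hpos.le]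
  have hcoeff : ∀ (y : Fin 2 → ℝ) (j l : Fin 2),
      √((g y).det) * (g y)⁻¹ j l = (1 : Matrix (Fin 2) (Fin 2) ℝ) j l := by
    intro y j l
    have hpos : 0 < 4 * R ^ 2 / (1 + y 0 ^ 2 + y 1 ^ 2) ^ 2 := by positivity
    rw [hdet, hg, Matrix.inv_eq_right_inv (B := (4 * R ^ 2 / (1 + y 0 ^ 2 + y 1 ^ 2) ^ 2)⁻¹ • 1)
      (by rw [Matrix.smul_mul, Matrix.mul_smul, smul_smul, mul_inv_cancel₀ hpos.ne', one_smul,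
        Matrix.one_mul]), Matrix.smul_apply, smul_eq_mul, mul_inv_cancel_left₀ hpos.ne']
  have hz : ∀ j x, covDeriv monopolePotential N j (fun _ => (0 : ℂ)) x = 0 := by
    intro j x
    simp [covDeriv, partialDeriv]
  have h01 : (1 : Matrix (Fin 2) (Fin 2) ℝ) 0 1 = 0 := rfl
  have h10 : (1 : Matrix (Fin 2) (Fin 2) ℝ) 1 0 = 0 := rfl
  have hs := sum_covDeriv_covDeriv_planeEquiv N hu z
  simp only [magneticLaplacian, hcoeff, Fin.sum_univ_two, Matrix.one_apply_eq, h01, h10,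
    Complex.ofReal_zero, Complex.ofReal_one, zero_mul, one_mul, hz, add_zero, zero_add]
  rw [hdet, one_add_sq_planeEquiv]
  change -(_ * (covDeriv monopolePotential N 0 (covDeriv monopolePotential N 0 u) (planeEquiv z) +
      covDeriv monopolePotential N 1 (covDeriv monopolePotential N 1 u) (planeEquiv z))) = _
  rw [hs]
  have h0 := rho_ne_zero z
  have hR' : (R : ℂ) ≠ 0 := by exact_mod_cast hR.ne'
  push_cast
  rw [rho_eq_ofReal] at h0 ⊢
  push_cast at h0 ⊢
  field_simp

theorem northParam_eq_southParam_iff {R : ℝ} (hR : 0 < R) (z w : ℂ) :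
    northParam R (planeEquiv z) = southParam R (planeEquiv w) ↔ z ≠ 0 ∧ w = z⁻¹ := by
  have ha := Complex.normSq_nonneg z
  have hb := Complex.normSq_nonneg w
  have ea := Complex.normSq_apply z
  have eb := Complex.normSq_apply w
  constructor
  · intro h
    have h0 := congrFun h 0
    have h1 := congrFun h 1
    have h2 := congrFun h 2
    simp only [northParam, southParam, Pi.smul_apply, smul_eq_mul, one_add_sq_planeEquiv] at h0 h1 h2
    simp at h0 h1 h2
    have e2 : 1 - z.re ^ 2 - z.im ^ 2 = 1 - Complex.normSq z := by rw [ea]; ring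
    have e3 : w.re ^ 2 + w.im ^ 2 - 1 = Complex.normSq w - 1 := by rw [eb]; ring
    rw [e2, e3] at h2
    have pa : (1 + Complex.normSq z) ≠ 0 := by positivity
    have pb : (1 + Complex.normSq w) ≠ 0 := by positivity
    field_simp at h0 h1 h2
    -- The height coordinate alone gives `|z|² |w|² = 1`; the two horizontal ones then give `w z =
    -- 1`.
    have hab : Complex.normSq z * Complex.normSq w = 1 := by linarith
    have k0 : z.re = Complex.normSq z * w.re := by
      apply mul_right_cancel₀ pb
      linear_combination h0 - w.re * hab
    have k1 : z.im = -(Complex.normSq z * w.im) := by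
      apply mul_right_cancel₀ pb
      linear_combination h1 + w.im * hab
    have hzw : w * z = 1 := by
      apply Complex.ext
      · rw [Complex.mul_re, k0, k1, Complex.one_re]
        linear_combination hab - Complex.normSq z * eb
      · rw [Complex.mul_im, k0, k1, Complex.one_im]
        ring
    have hz0 : z ≠ 0 := by rintro rfl; simp at hzw
    exact ⟨hz0, eq_inv_of_mul_eq_one_left hzw⟩
  · rintro ⟨hz, rfl⟩
    have hp : 0 < Complex.normSq z := Complex.normSq_pos.2 hz
    have pa : (1 + Complex.normSq z) ≠ 0 := by positivity
    have hp' := hp.ne'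
    have e1 : 1 + Complex.normSq z⁻¹ = (1 + Complex.normSq z) / Complex.normSq z := by
      rw [Complex.normSq_inv]
      field_simp
      ring
    funext i
    simp only [northParam, southParam, Pi.smul_apply, smul_eq_mul, one_add_sq_planeEquiv, e1]
    fin_cases i
    · simp [Complex.inv_re]
      field_simp
    · simp [Complex.inv_im]
      field_simp
    · simp [Complex.inv_re, Complex.inv_im]
      field_simp
      rw [ea]
      ring

theorem transition_planeEquiv_mul_direction {z : ℂ} (hz : z ≠ 0) :
    transition (planeEquiv z) * direction z = 1 := by
  have h0 : (‖z‖ : ℂ) ≠ 0 := by simpa using hz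
  have e1 : √(planeEquiv z 0 ^ 2 + planeEquiv z 1 ^ 2) = ‖z‖ := by
    rw [planeEquiv_zero, planeEquiv_one, Complex.norm_def, Complex.normSq_apply]
    ring_nf
  have e2 : (planeEquiv z 0 : ℂ) - Complex.I * planeEquiv z 1 = (starRingEnd ℂ) z := by
    rw [planeEquiv_zero, planeEquiv_one]
    apply Complex.ext <;> simp
  rw [transition, e1, e2, direction, div_mul_div_comm, norm_mul_norm_eq, mul_comm, div_self]
  rw [← norm_mul_norm_eq]
  exact mul_ne_zero h0 h0

/-- The factor `e^(-iϕ)` is the inverse of `direction`, and the two parametrizations agree exactly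
at inverse points, so both gluing conditions are the same one solved for different components. -/
theorem mem_smoothSections_iff {R : ℝ} (hR : 0 < R) (N : ℕ)
    (u : ((Fin 2 → ℝ) → ℂ) × ((Fin 2 → ℝ) → ℂ)) :
    u ∈ smoothSections R N ↔ (u.1 ∘ planeEquiv, u.2 ∘ planeEquiv) ∈ chartSections N := by
  have hs : ∀ v : (Fin 2 → ℝ) → ℂ, ContDiff ℝ ∞ (v ∘ planeEquiv) ↔ ContDiff ℝ ∞ v := fun v =>
    planeEquiv.contDiff_comp_iff
  have hk : (∀ x y, northParam R x = southParam R y → u.2 y = transition x ^ N * u.1 x) ↔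
      ∀ z, z ≠ 0 → u.1 (planeEquiv z) = direction z ^ N * u.2 (planeEquiv z⁻¹) := by
    have hT : ∀ z, z ≠ 0 → transition (planeEquiv z) ^ N * direction z ^ N = 1 := fun z hz => by
      rw [← mul_pow, transition_planeEquiv_mul_direction hz, one_pow]
    constructor
    · intro h z hz
      rw [h _ _ ((northParam_eq_southParam_iff hR z z⁻¹).2 ⟨hz, rfl⟩)]
      linear_combination (-(u.1 (planeEquiv z))) * hT z hz
    · intro h x y hxy
      obtain ⟨z, rfl⟩ := planeEquiv.surjective x
      obtain ⟨w, rfl⟩ := planeEquiv.surjective y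
      obtain ⟨hz, rfl⟩ := (northParam_eq_southParam_iff hR z w).1 hxy
      rw [h z hz]
      linear_combination (-(u.2 (planeEquiv z⁻¹))) * hT z hz
  change (_ ∧ _ ∧ _) ↔ (_ ∧ _ ∧ _)
  rw [hk, hs, hs]
  rfl

theorem mem_eigenspace_iff {R : ℝ} (hR : 0 < R) (N : ℕ) (μ : ℂ)
    (u : ((Fin 2 → ℝ) → ℂ) × ((Fin 2 → ℝ) → ℂ)) :
    u ∈ eigenspace R N μ ↔
      (u.1 ∘ planeEquiv, u.2 ∘ planeEquiv) ∈ chartEigenspace N (R ^ 2 * μ) := by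
  have hR' : (R : ℂ) ^ 2 ≠ 0 := pow_ne_zero 2 (by exact_mod_cast hR.ne')
  have key : ∀ {g : (Fin 2 → ℝ) → Matrix (Fin 2) (Fin 2) ℝ} {v : (Fin 2 → ℝ) → ℂ},
      (∀ x, g x = (4 * R ^ 2 / (1 + x 0 ^ 2 + x 1 ^ 2) ^ 2) • 1) → ContDiff ℝ ∞ v →
      (magneticLaplacian g monopolePotential N v = μ • v ↔
        chartLaplacian N (v ∘ planeEquiv) = (R ^ 2 * μ : ℂ) • (v ∘ planeEquiv)) := by
    intro g v hg hv
    rw [funext_iff, funext_iff, planeEquiv.surjective.forall]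
    refine forall_congr' fun z => ?_
    rw [magneticLaplacian_planeEquiv hR hg N hv, div_eq_iff hR']
    simp only [Pi.smul_apply, smul_eq_mul, Function.comp_apply]
    rw [show (R : ℂ) ^ 2 * μ * v (planeEquiv z) = μ * v (planeEquiv z) * R ^ 2 by ring]
  change (_ ∧ _ ∧ _) ↔ (_ ∧ _ ∧ _)
  rw [mem_smoothSections_iff hR]
  refine and_congr_right fun hu => ?_
  have h1 : ContDiff ℝ ∞ u.1 := planeEquiv.contDiff_comp_iff.1 hu.1
  have h2 : ContDiff ℝ ∞ u.2 := planeEquiv.contDiff_comp_iff.1 hu.2.1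
  rw [northLaplacian, southLaplacian, key (inducedMetric_northParam R) h1,
    key (inducedMetric_southParam R) h2]

theorem rank_eigenspace_eq {R : ℝ} (hR : 0 < R) (N : ℕ) (μ : ℂ) :
    Module.rank ℂ (eigenspace R N μ) = Module.rank ℂ (chartEigenspace N (R ^ 2 * μ)) := by
  let f : eigenspace R N μ →ₗ[ℂ] chartEigenspace N (R ^ 2 * μ) :=
    { toFun := fun u => ⟨(u.1.1 ∘ planeEquiv, u.1.2 ∘ planeEquiv),
        (mem_eigenspace_iff hR N μ u.1).1 u.2⟩
      map_add' := fun u v => rfl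
      map_smul' := fun c u => rfl }
  refine (LinearEquiv.ofBijective f ⟨fun u v h => ?_, fun v => ?_⟩).rank_eq
  · have h1 := congrArg (fun w => w.1.1) h
    have h2 := congrArg (fun w => w.1.2) h
    exact Subtype.ext (Prod.ext (planeEquiv.surjective.injective_comp_right h1)
      (planeEquiv.surjective.injective_comp_right h2))
  · have e : ∀ w : ℂ → ℂ, (w ∘ planeEquiv.symm) ∘ planeEquiv = w := fun w => by
      funext z
      simp
    refine ⟨⟨(v.1.1 ∘ planeEquiv.symm, v.1.2 ∘ planeEquiv.symm), ?_⟩, ?_⟩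
    · rw [mem_eigenspace_iff hR]
      simp only [e]
      exact v.2
    · apply Subtype.ext
      change ((v.1.1 ∘ planeEquiv.symm) ∘ planeEquiv, (v.1.2 ∘ planeEquiv.symm) ∘ planeEquiv) = _
      rw [e, e]

theorem rank_eigenspace_level {R : ℝ} (hR : 0 < R) (N n : ℕ) :
    Module.rank ℂ (eigenspace R N ((level N n / R ^ 2 : ℝ) : ℂ)) = (N + 2 * n + 1 : ℕ) := by
  have hR' : (R : ℂ) ^ 2 ≠ 0 := pow_ne_zero 2 (by exact_mod_cast hR.ne')
  have hl : (R : ℂ) ^ 2 * ((level N n / R ^ 2 : ℝ) : ℂ) = (level N n : ℝ) := by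
    push_cast
    rw [← mul_div_assoc, mul_div_cancel_left₀ _ hR']
  rw [rank_eigenspace_eq hR, hl, rank_chartEigenspace_level]

theorem rank_eigenspace_eq_zero {R : ℝ} (hR : 0 < R) {N : ℕ} {μ : ℂ}
    (h : ∀ n, μ ≠ ((level N n / R ^ 2 : ℝ) : ℂ)) : Module.rank ℂ (eigenspace R N μ) = 0 := by
  have hR' : (R : ℂ) ^ 2 ≠ 0 := pow_ne_zero 2 (by exact_mod_cast hR.ne')
  rw [rank_eigenspace_eq hR]
  refine chartEigenspace_eq_bot_of_ne_level fun n hn => h n ?_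
  push_cast
  rw [← hn, mul_div_cancel_left₀ _ hR']

/-! ### Eigenvalue sequences and multiplicities -/

/-- The distinct eigenvalues of the magnetic Laplacian, in increasing order. -/
def energy (R : ℝ) (N n : ℕ) : ℝ := level N n / R ^ 2

theorem energy_injective {R : ℝ} (hR : 0 < R) (N : ℕ) : Function.Injective (energy R N) := by
  intro a b h
  have hR2 : R ^ 2 ≠ 0 := by positivity
  exact (level_strictMono N).injective ((div_left_inj' hR2).1 h)

theorem exists_isEigenvalueSequence {R : ℝ} (hR : 0 < R) (N : ℕ) :
    ∃ ν : ℕ → ℝ, IsEigenvalueSequence R N ν := by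
  -- One index for each basis vector of each eigenspace: this set is countably infinite, and any
  -- enumeration of it will do.
  let S := Σ n : ℕ, Fin (N + 2 * n + 1)
  have : Infinite S := Infinite.of_injective (fun n : ℕ => (⟨n, 0⟩ : S)) fun a b h => by
    simpa using congrArg Sigma.fst h
  obtain ⟨e⟩ : Nonempty (ℕ ≃ S) := nonempty_equiv_of_countable
  refine ⟨fun j => energy R N (e j).1, fun μ => ?_⟩
  by_cases h : ∃ n, μ = (energy R N n : ℂ)
  · obtain ⟨n, rfl⟩ := h
    rw [energy, rank_eigenspace_level hR, ← Cardinal.mk_fin]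
    have k1 : ∀ (p : S) (h : p.1 = n), (⟨n, p.2.cast (by rw [h])⟩ : S) = p := by
      rintro ⟨m, i⟩ rfl
      rfl
    have k2 : ∀ (i : Fin (N + 2 * n + 1)) (p : S), p = ⟨n, i⟩ → (p.2 : ℕ) = i := by
      rintro i _ rfl
      rfl
    have k3 : ∀ j : {j : ℕ | ((energy R N (e j).1 : ℝ) : ℂ) = ((level N n / R ^ 2 : ℝ) : ℂ)},
        (e j).1 = n := fun j => energy_injective hR N (Complex.ofReal_injective j.2)
    refine Cardinal.mk_congr ⟨fun i => ⟨e.symm ⟨n, i⟩, by simp [energy]⟩,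
      fun j => (e j.1).2.cast (by rw [k3 j]), fun i => ?_, fun j => ?_⟩
    · exact Fin.ext (k2 i _ (e.apply_symm_apply _))
    · exact Subtype.ext ((e.symm_apply_eq).2 (k1 (e j.1) (k3 j)))
  · push Not at h
    rw [rank_eigenspace_eq_zero hR h, eq_comm, Cardinal.mk_eq_zero_iff]
    exact ⟨fun j => h _ j.2.symm⟩

section Counting

variable {R : ℝ} {N : ℕ} {ν : ℕ → ℝ}

/-- A value outside the spectrum has a zero eigenspace, so it cannot occur in the sequence even
once. -/
theorem IsEigenvalueSequence.exists_index (hR : 0 < R) (hν : IsEigenvalueSequence R N ν) :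
    ∃ g : ℕ → ℕ, ∀ j, ν j = energy R N (g j) := by
  suffices h : ∀ j, ∃ n, ν j = energy R N n from Classical.skolem.1 h
  intro j
  by_contra! h
  have h1 := hν (ν j)
  rw [rank_eigenspace_eq_zero hR (fun n hn => h n (Complex.ofReal_injective hn)), eq_comm,
    Cardinal.mk_eq_zero_iff] at h1
  exact h1.elim ⟨j, rfl⟩

/-- A sum over the eigenvalues with multiplicities is a sum over the distinct eigenvalues. -/
theorem IsEigenvalueSequence.hasSum (hR : 0 < R) (hν : IsEigenvalueSequence R N ν) (f : ℝ → ℂ)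
    (hf : Summable fun n : ℕ => (N + 2 * n + 1 : ℝ) * ‖f (energy R N n)‖) :
    HasSum (fun j => f (ν j)) (∑' n : ℕ, (N + 2 * n + 1 : ℂ) * f (energy R N n)) := by
  obtain ⟨g, hg⟩ := hν.exists_index hR
  -- The fibre of the index map over `n` has as many elements as the dimension of the eigenspace.
  -- Gluing these bijections reindexes the sequence by pairs of a level and a position in it.
  have hcard : ∀ n, Nonempty (Fin (N + 2 * n + 1) ≃ {j // g j = n}) := fun n => by
    have h1 := hν (energy R N n : ℝ)
    rw [energy, rank_eigenspace_level hR, ← Cardinal.mk_fin, Cardinal.eq] at h1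
    obtain ⟨e⟩ := h1
    refine ⟨e.trans (Equiv.subtypeEquivRight fun j => ?_)⟩
    change ((ν j : ℂ) = ((energy R N n : ℝ) : ℂ)) ↔ _
    rw [hg, Complex.ofReal_inj, (energy_injective hR N).eq_iff]
  have e : ∀ n, Fin (N + 2 * n + 1) ≃ {j // g j = n} := fun n => (hcard n).some
  let E : (Σ n : ℕ, Fin (N + 2 * n + 1)) ≃ ℕ :=
    (Equiv.sigmaCongrRight e).trans (Equiv.sigmaFiberEquiv g)
  have hE : ∀ p, ν (E p) = energy R N p.1 := fun p => by
    rw [hg]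
    congr 1
    exact (e p.1 p.2).2
  rw [← E.hasSum_iff]
  have hcomp : (fun j => f (ν j)) ∘ E = fun p => f (energy R N p.1) := funext fun p =>
    congrArg f (hE p)
  rw [hcomp]
  have hs : Summable fun p : (Σ n : ℕ, Fin (N + 2 * n + 1)) => f (energy R N p.1) := by
    apply Summable.of_norm
    rw [summable_sigma_of_nonneg fun p => norm_nonneg _]
    refine ⟨fun n => (hasSum_fintype _).summable, ?_⟩
    simpa [tsum_fintype] using hf
  have h2 := hs.hasSum
  rw [hs.tsum_sigma] at h2
  simpa [tsum_fintype] using h2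

end Counting

/-! ### Absolute convergence of the trace -/

theorem level_lower_bound (N n : ℕ) : (n : ℝ) ^ 2 ≤ level N n := by
  have hn : (0 : ℝ) ≤ n := n.cast_nonneg
  have hN : (0 : ℝ) ≤ N := N.cast_nonneg
  simp only [level]
  nlinarith [mul_nonneg hn hN]

theorem exists_schwartz_bound (φ : SchwartzMap ℝ ℂ) (K : ℕ) :
    ∃ C, 0 < C ∧ ∀ x, ‖φ x‖ * (1 + |x|) ^ K ≤ C := by
  obtain ⟨C, hC⟩ : ∃ C : ℝ, ∀ x, (1 + ‖x‖) ^ K * ‖φ x‖ ≤ C := by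
    refine ⟨2 ^ K * (Finset.Iic (K, 0)).sup (fun m => SchwartzMap.seminorm ℝ m.1 m.2) φ,
      fun x => ?_⟩
    simpa using SchwartzMap.one_add_le_sup_seminorm_apply (𝕜 := ℝ) (m := (K, 0))
      (k := K) (n := 0) le_rfl le_rfl φ x
  refine ⟨max C 1, by positivity, fun x => ?_⟩
  have := hC x
  rw [Real.norm_eq_abs] at this
  linarith [le_max_left C 1]

/-- Here `λ ≥ n/R`, so cubic decay of `φ` beats the linear growth of the multiplicity and leaves a
multiple of `1/(n+1)²`. -/
theorem summable_energy {R : ℝ} (hR : 0 < R) (E : ℝ) (hE : 0 ≤ E) (φ : SchwartzMap ℝ ℂ) (N : ℕ) :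
    Summable fun n : ℕ => (N + 2 * n + 1 : ℝ) *
      ‖φ (√(energy R N n + (N : ℝ) ^ 2) - E * N)‖ := by
  obtain ⟨C, hC0, hC⟩ := exists_schwartz_bound φ 3
  have hN : (0 : ℝ) ≤ N := N.cast_nonneg
  set c : ℝ := (1 + R) * (1 + E * N) with hc
  have hc0 : 0 < c := by positivity
  have hmain : Summable fun n : ℕ => (N + 2) * c ^ 3 * C * (1 / ((n : ℝ) + 1) ^ 2) := by
    apply Summable.mul_left
    have := (summable_nat_add_iff 1).2 (Real.summable_one_div_nat_pow.2 one_lt_two)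
    simpa using this
  refine Summable.of_nonneg_of_le (fun n => by positivity) (fun n => ?_) hmain
  have hn : (0 : ℝ) ≤ n := n.cast_nonneg
  set x := √(energy R N n + (N : ℝ) ^ 2) with hx
  have h1 : n / R ≤ x := by
    apply Real.le_sqrt_of_sq_le
    rw [div_pow, energy]
    have := level_lower_bound N n
    have h3 : (n : ℝ) ^ 2 / R ^ 2 ≤ level N n / R ^ 2 := by gcongr
    nlinarith
  have h2 : (n : ℝ) + 1 ≤ c * (1 + |x - E * N|) := by
    have hx1 : x ≤ |x - E * N| + E * N := by linarith [le_abs_self (x - E * N)]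
    have hn1 : (n : ℝ) ≤ R * x := by rwa [div_le_iff₀' hR] at h1
    have ha : 0 ≤ |x - E * N| := abs_nonneg _
    have hEN : 0 ≤ E * N := by positivity
    have hx0 : 0 ≤ x := Real.sqrt_nonneg _
    calc (n : ℝ) + 1 ≤ R * x + 1 := by linarith
      _ ≤ (1 + R) * (1 + x) := by nlinarith
      _ ≤ (1 + R) * ((1 + E * N) * (1 + |x - E * N|)) := by
        gcongr
        nlinarith
      _ = _ := by rw [hc]; ring
  have h3 : ((n : ℝ) + 1) ^ 3 ≤ c ^ 3 * (1 + |x - E * N|) ^ 3 := by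
    rw [← mul_pow]
    gcongr
  have h4 := hC (x - E * N)
  have h5 : ‖φ (x - E * N)‖ * ((n : ℝ) + 1) ^ 3 ≤ c ^ 3 * C := by
    calc ‖φ (x - E * N)‖ * ((n : ℝ) + 1) ^ 3
        ≤ ‖φ (x - E * N)‖ * (c ^ 3 * (1 + |x - E * N|) ^ 3) := by gcongr
      _ = c ^ 3 * (‖φ (x - E * N)‖ * (1 + |x - E * N|) ^ 3) := by ring
      _ ≤ c ^ 3 * C := by gcongr
  have h6 : (N + 2 * n + 1 : ℝ) ≤ (N + 2) * (n + 1) := by nlinarith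
  rw [mul_one_div, le_div_iff₀ (by positivity)]
  calc (N + 2 * n + 1 : ℝ) * ‖φ (x - E * N)‖ * ((n : ℝ) + 1) ^ 2
      ≤ (N + 2) * (n + 1) * ‖φ (x - E * N)‖ * ((n : ℝ) + 1) ^ 2 := by gcongr
    _ = (N + 2) * (‖φ (x - E * N)‖ * ((n : ℝ) + 1) ^ 3) := by ring
    _ ≤ (N + 2) * (c ^ 3 * C) := by gcongr
    _ = _ := by ring

theorem hasSum_traceTerm {R E : ℝ} (hR : 0 < R) (hE : 0 ≤ E) (φ : SchwartzMap ℝ ℂ) {N : ℕ}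
    {ν : ℕ → ℝ} (hν : IsEigenvalueSequence R N ν) :
    HasSum (traceTerm E φ N ν)
      (∑' n : ℕ, (N + 2 * n + 1 : ℂ) * φ (√(energy R N n + (N : ℝ) ^ 2) - E * N)) :=
  hν.hasSum hR (fun x => φ (√(x + (N : ℝ) ^ 2) - E * N)) (summable_energy hR E hE φ N)

/-! ### The summand as a function of `s` and `1/N` -/

section Geometry

variable {R E : ℝ}

theorem speed_radicand_pos (hR : 0 < R) (hE : 1 < E) : 0 < E ^ 2 - 1 + 1 / (4 * R ^ 2) := by
  have : 0 < 1 / (4 * R ^ 2) := by positivity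
  nlinarith

theorem speed_pos (hR : 0 < R) (hE : 1 < E) : 0 < speed R E :=
  Real.sqrt_pos.2 (speed_radicand_pos hR hE)

theorem speed_sq (hR : 0 < R) (hE : 1 < E) : speed R E ^ 2 = E ^ 2 - 1 + 1 / (4 * R ^ 2) :=
  Real.sq_sqrt (speed_radicand_pos hR hE).le

theorem mul_speed_sq (hR : 0 < R) (hE : 1 < E) :
    (R * speed R E) ^ 2 = R ^ 2 * (E ^ 2 - 1) + 1 / 4 := by
  rw [mul_pow, speed_sq hR hE]
  field_simp

theorem half_lt_mul_speed (hR : 0 < R) (hE : 1 < E) : 1 / 2 < R * speed R E := by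
  have h := mul_speed_sq hR hE
  have h1 : 0 < R ^ 2 * (E ^ 2 - 1) := mul_pos (by positivity) (by nlinarith)
  have h2 : 0 < R * speed R E := mul_pos hR (speed_pos hR hE)
  nlinarith

variable (R E) in
/-- The square of the rescaled frequency `λ / N` at the point `s` of the shifted lattice, as a
function of `(s, 1 / N)`. -/
def radicand (p : ℝ × ℝ) : ℝ :=
  E ^ 2 + p.2 * (2 * speed R E * p.1 / R) + p.2 ^ 2 * ((p.1 ^ 2 - 1 / 4) / R ^ 2)

variable (R E) in
/-- The rescaled frequency `λ / N`, as a function of `(s, 1 / N)`. -/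
def frequency (p : ℝ × ℝ) : ℝ := √(radicand R E p)

variable (R E) in
/-- The difference `λ - E N`, as a function of `(s, 1 / N)` that is smooth up to `1 / N = 0`. -/
def displacement (p : ℝ × ℝ) : ℝ :=
  (2 * speed R E / R * p.1 + p.2 * (p.1 ^ 2 - 1 / 4) * (1 / R ^ 2)) * (frequency R E p + E)⁻¹

variable (R E) in
/-- The range of `(s, 1 / N)` that corresponds to the spectrum. -/
def Admissible (p : ℝ × ℝ) : Prop :=
  0 ≤ p.2 ∧ p.2 ≤ 1 ∧ 1 / 2 + p.2 / 2 ≤ R * speed R E + p.2 * p.1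

/-- The last condition is affine in `ε` and holds at `ε = 0` because `1/2 < R D`, which uses `E >
1`. So the whole segment from `(s, 0)` is available for Taylor's formula. -/
theorem Admissible.mono (hR : 0 < R) (hE : 1 < E) {s a b : ℝ} (h : Admissible R E (s, b))
    (ha : 0 ≤ a) (hab : a ≤ b) : Admissible R E (s, a) := by
  obtain ⟨h0, h1, h2⟩ := h
  refine ⟨ha, hab.trans h1, ?_⟩
  have h3 := half_lt_mul_speed hR hE
  simp only at *
  rcases h0.eq_or_lt with hb | hb
  · have : a = 0 := le_antisymm (hab.trans hb.ge) ha
    subst this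
    linarith
  · have hk : b * (1 / 2 + a / 2) ≤ b * (R * speed R E + a * s) := by nlinarith
    exact le_of_mul_le_mul_left hk hb

/-- Completing the square in `s`; the value of `D` is what makes the constant term match `E²`. -/
theorem sq_mul_radicand (hR : 0 < R) (hE : 1 < E) (p : ℝ × ℝ) :
    R ^ 2 * radicand R E p =
      (R * speed R E + p.2 * p.1) ^ 2 + R ^ 2 - 1 / 4 - p.2 ^ 2 / 4 := by
  have h := mul_speed_sq hR hE
  have e : R ^ 2 * radicand R E p = R ^ 2 * E ^ 2 + 2 * (R * speed R E) * (p.2 * p.1) +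
      p.2 ^ 2 * (p.1 ^ 2 - 1 / 4) := by
    rw [radicand]
    field_simp
  rw [e]
  linear_combination -h

/-- From `R D + ε s ≥ 1/2 + ε/2` the square is at least `1/4 + ε²/4`, which cancels the negative
terms of the completed square. Square roots and inverses thus stay uniformly away from zero. -/
theorem Admissible.one_le_radicand (hR : 0 < R) (hE : 1 < E) {p : ℝ × ℝ}
    (hp : Admissible R E p) : 1 ≤ radicand R E p := by
  obtain ⟨h0, h1, h2⟩ := hp
  have h := sq_mul_radicand hR hE p
  have hR2 : 0 < R ^ 2 := by positivity
  nlinarith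

theorem Admissible.one_le_frequency (hR : 0 < R) (hE : 1 < E) {p : ℝ × ℝ}
    (hp : Admissible R E p) : 1 ≤ frequency R E p :=
  Real.one_le_sqrt.2 (hp.one_le_radicand hR hE)

theorem Admissible.mul_frequency_le (hR : 0 < R) (hE : 1 < E) {p : ℝ × ℝ}
    (hp : Admissible R E p) : R * frequency R E p ≤ R * speed R E + p.2 * p.1 + R := by
  obtain ⟨h0, h1, h2⟩ := hp
  have h := sq_mul_radicand hR hE p
  have e : R * frequency R E p = √(R ^ 2 * radicand R E p) := by
    rw [Real.sqrt_mul (by positivity), Real.sqrt_sq hR.le, frequency]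
  rw [e]
  apply Real.sqrt_le_iff.2
  constructor
  · linarith
  · rw [h]
    nlinarith

theorem radicand_zero (s : ℝ) : radicand R E (s, 0) = E ^ 2 := by
  simp [radicand]

theorem frequency_zero (hE : 1 < E) (s : ℝ) : frequency R E (s, 0) = E := by
  rw [frequency, radicand_zero, Real.sqrt_sq (by linarith)]

theorem displacement_zero (hE : 1 < E) (s : ℝ) :
    displacement R E (s, 0) = speed R E / (R * E) * s := by
  have : E ≠ 0 := by linarith
  rw [displacement, frequency_zero hE]
  rcases eq_or_ne R 0 with rfl | hR
  · simp
  · simp only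
    field_simp
    ring

/-- Writing `μ = R D + ε s` and `Q` for the frequency, one has `s (D R + μ) = R² (Q + E) x + ε/4`.
As `Q` grows at most linearly in `μ > 0`, dividing by `D R + μ` bounds `|s|` by a multiple of `1 +
|x|`. This converts decay of `φ` in `x` into decay in `s`, uniformly in `ε`. -/
theorem exists_one_add_abs_le_displacement (hR : 0 < R) (hE : 1 < E) :
    ∃ C, 0 < C ∧ ∀ p, Admissible R E p → 1 + |p.1| ≤ C * (1 + |displacement R E p|) := by
  have hD := speed_pos hR hE
  set D := speed R E with hDdef
  refine ⟨1 + 1 / (4 * (D * R)) + (R + R * (1 + E) / D), by positivity, fun p hp => ?_⟩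
  have hQ := hp.one_le_frequency hR hE
  have hQ2 := hp.mul_frequency_le hR hE
  obtain ⟨h0, h1, h2⟩ := hp
  rw [← hDdef] at h2 hQ2
  set μ := R * D + p.2 * p.1 with hμ
  set Q := frequency R E p
  set y := |displacement R E p| with hy
  have hy0 : 0 ≤ y := abs_nonneg _
  have hs0 : 0 ≤ |p.1| := abs_nonneg _
  have hQE : 0 < Q + E := by linarith
  have hμ0 : 0 < μ := by linarith
  have e1 : p.1 * (D * R + μ) = R ^ 2 * (Q + E) * displacement R E p + p.2 / 4 := by
    have e0 : displacement R E p * (Q + E) =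
        2 * D / R * p.1 + p.2 * (p.1 ^ 2 - 1 / 4) * (1 / R ^ 2) :=
      inv_mul_cancel_right₀ hQE.ne' _
    rw [mul_assoc, mul_comm (Q + E), e0, hμ]
    field_simp
    ring
  have e2 : |p.1| * (D * R + μ) ≤ R ^ 2 * (Q + E) * y + 1 / 4 := by
    have hpos : 0 < D * R + μ := by positivity
    calc |p.1| * (D * R + μ) = |p.1 * (D * R + μ)| := by rw [abs_mul, abs_of_pos hpos]
      _ ≤ |R ^ 2 * (Q + E) * displacement R E p| + |p.2 / 4| := by rw [e1]; exact abs_add_le _ _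
      _ ≤ R ^ 2 * (Q + E) * y + 1 / 4 := by
        rw [abs_mul, abs_of_pos (by positivity : 0 < R ^ 2 * (Q + E)),
          abs_of_nonneg (by positivity : 0 ≤ p.2 / 4)]
        linarith
  have e3 : R ^ 2 * (Q + E) ≤ (R + R * (1 + E) / D) * (D * R + μ) := by
    have : (R + R * (1 + E) / D) * (D * R + μ) =
        R * μ + R ^ 2 * (1 + E) + R ^ 2 * D + R * (1 + E) / D * μ := by
      field_simp
      ring
    rw [this]
    have h5 : 0 ≤ R ^ 2 * D + R * (1 + E) / D * μ := by positivity
    nlinarith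
  have e4 : 1 / 4 ≤ 1 / (4 * (D * R)) * (D * R + μ) := by
    have : 1 / (4 * (D * R)) * (D * R + μ) = 1 / 4 + 1 / (4 * (D * R)) * μ := by
      field_simp
    rw [this]
    have : 0 ≤ 1 / (4 * (D * R)) * μ := by positivity
    linarith
  have e5 : |p.1| ≤ (R + R * (1 + E) / D) * y + 1 / (4 * (D * R)) := by
    have hpos : 0 < D * R + μ := by positivity
    refine le_of_mul_le_mul_right ?_ hpos
    calc |p.1| * (D * R + μ) ≤ R ^ 2 * (Q + E) * y + 1 / 4 := e2
      _ ≤ (R + R * (1 + E) / D) * (D * R + μ) * y + 1 / (4 * (D * R)) * (D * R + μ) := by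
        gcongr
      _ = _ := by ring
  have h6 : 0 ≤ 1 / (4 * (D * R)) * y := by positivity
  have h7 : 0 ≤ R + R * (1 + E) / D := by positivity
  nlinarith

/-! ### The algebra of symbols -/

variable (R E) in
/-- The algebra generated by the functions `s`, `1 / N`, `λ / N`, `N / λ`, `N / (λ + E N)`. -/
def symbolAlgebra : Subalgebra ℝ (ℝ × ℝ → ℝ) :=
  Algebra.adjoin ℝ {Prod.fst, Prod.snd, frequency R E, (frequency R E)⁻¹,
    fun p => (frequency R E p + E)⁻¹}

theorem fst_mem_symbolAlgebra : Prod.fst ∈ symbolAlgebra R E :=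
  Algebra.subset_adjoin (by simp)

theorem snd_mem_symbolAlgebra : Prod.snd ∈ symbolAlgebra R E :=
  Algebra.subset_adjoin (by simp)

theorem inv_frequency_mem_symbolAlgebra : (frequency R E)⁻¹ ∈ symbolAlgebra R E :=
  Algebra.subset_adjoin (by simp)

theorem inv_frequency_add_mem_symbolAlgebra :
    (fun p => (frequency R E p + E)⁻¹) ∈ symbolAlgebra R E :=
  Algebra.subset_adjoin (by simp)

theorem const_mem_symbolAlgebra (c : ℝ) : (fun _ => c) ∈ symbolAlgebra R E :=
  (symbolAlgebra R E).algebraMap_mem c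

theorem affine_mem_symbolAlgebra (a b c : ℝ) :
    (fun p : ℝ × ℝ => a + b * p.1 + c * p.2 * (p.1 ^ 2 - 1 / 4)) ∈ symbolAlgebra R E :=
  add_mem (add_mem (const_mem_symbolAlgebra a)
    (mul_mem (const_mem_symbolAlgebra b) fst_mem_symbolAlgebra))
    (mul_mem (mul_mem (const_mem_symbolAlgebra c) snd_mem_symbolAlgebra)
      (sub_mem (pow_mem fst_mem_symbolAlgebra 2) (const_mem_symbolAlgebra (1 / 4))))

theorem displacement_mem_symbolAlgebra : displacement R E ∈ symbolAlgebra R E := by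
  have h := mul_mem (affine_mem_symbolAlgebra (R := R) (E := E) 0 (2 * speed R E / R) (1 / R ^ 2))
    inv_frequency_add_mem_symbolAlgebra
  convert h using 1
  funext p
  simp only [displacement, Pi.mul_apply]
  ring

variable (R E) in
/-- The derivative of `frequency` in the second variable. -/
def frequencyDeriv (p : ℝ × ℝ) : ℝ :=
  (0 + speed R E / R * p.1 + 1 / R ^ 2 * p.2 * (p.1 ^ 2 - 1 / 4)) * (frequency R E p)⁻¹

theorem frequencyDeriv_mem_symbolAlgebra : frequencyDeriv R E ∈ symbolAlgebra R E :=
  mul_mem (affine_mem_symbolAlgebra 0 (speed R E / R) (1 / R ^ 2)) inv_frequency_mem_symbolAlgebra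

theorem hasDerivAt_frequency {s ε : ℝ} (h : 0 < radicand R E (s, ε)) :
    HasDerivAt (fun e => frequency R E (s, e)) (frequencyDeriv R E (s, ε)) ε := by
  have h1 : HasDerivAt (fun e => radicand R E (s, e))
      (2 * speed R E * s / R + 2 * ε * ((s ^ 2 - 1 / 4) / R ^ 2)) ε := by
    have ha := ((hasDerivAt_id ε).mul_const (2 * speed R E * s / R)).const_add (E ^ 2)
    have hb := ((hasDerivAt_id ε).pow 2).mul_const ((s ^ 2 - 1 / 4) / R ^ 2)
    convert! ha.add hb using 1
    simp
  convert! h1.sqrt h.ne' using 1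
  have h2 : √(radicand R E (s, ε)) ≠ 0 := (Real.sqrt_pos.2 h).ne'
  simp only [frequencyDeriv, frequency]
  ring

/-- The generators are chosen so that the algebra is closed under `∂/∂ε`: the derivatives of the
frequency and of the two inverses are again polynomials in them. -/
theorem exists_hasDerivAt_of_mem (hE : 1 < E) {b : ℝ × ℝ → ℝ} (hb : b ∈ symbolAlgebra R E) :
    ∃ b' ∈ symbolAlgebra R E, ∀ s ε, 0 < radicand R E (s, ε) →
      HasDerivAt (fun e => b (s, e)) (b' (s, ε)) ε := by
  induction hb using Algebra.adjoin_induction with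
  | mem b hb =>
    have hQ : ∀ s ε, 0 < radicand R E (s, ε) → frequency R E (s, ε) ≠ 0 := fun s ε h =>
      (Real.sqrt_pos.2 h).ne'
    have hQE : ∀ p, frequency R E p + E ≠ 0 := fun p => by
      have : 0 ≤ frequency R E p := Real.sqrt_nonneg _
      linarith
    simp only [Set.mem_insert_iff, Set.mem_singleton_iff] at hb
    rcases hb with rfl | rfl | rfl | rfl | rfl
    · exact ⟨_, const_mem_symbolAlgebra 0, fun s ε _ => hasDerivAt_const ε s⟩
    · exact ⟨_, const_mem_symbolAlgebra 1, fun s ε _ => hasDerivAt_id ε⟩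
    · exact ⟨_, frequencyDeriv_mem_symbolAlgebra, fun s ε h => hasDerivAt_frequency h⟩
    · refine ⟨_, mul_mem (neg_mem frequencyDeriv_mem_symbolAlgebra)
        (pow_mem inv_frequency_mem_symbolAlgebra 2), fun s ε h => ?_⟩
      convert! (hasDerivAt_frequency h).inv (hQ s ε h) using 1
      simp only [Pi.mul_apply, Pi.neg_apply, Pi.pow_apply, Pi.inv_apply]
      ring
    · refine ⟨_, mul_mem (neg_mem frequencyDeriv_mem_symbolAlgebra)
        (pow_mem inv_frequency_add_mem_symbolAlgebra 2), fun s ε h => ?_⟩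
      convert! ((hasDerivAt_frequency h).add_const E).inv (hQE (s, ε)) using 1
      simp [div_eq_mul_inv]
  | algebraMap c => exact ⟨_, const_mem_symbolAlgebra 0, fun s ε _ => hasDerivAt_const ε c⟩
  | add x y _ _ hx hy =>
    obtain ⟨x', hx', hx⟩ := hx
    obtain ⟨y', hy', hy⟩ := hy
    exact ⟨_, add_mem hx' hy', fun s ε h => (hx s ε h).add (hy s ε h)⟩
  | mul x y hx0 hy0 hx hy =>
    obtain ⟨x', hx', hx⟩ := hx
    obtain ⟨y', hy', hy⟩ := hy
    exact ⟨_, add_mem (mul_mem hx' hy0) (mul_mem hx0 hy'), fun s ε h => (hx s ε h).mul (hy s ε h)⟩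

/-- On the admissible range every generator grows at most linearly in `s`, and polynomial growth
passes to sums and products. -/
theorem exists_growth_of_mem (hR : 0 < R) (hE : 1 < E) {b : ℝ × ℝ → ℝ}
    (hb : b ∈ symbolAlgebra R E) :
    ∃ (C : ℝ) (a : ℕ), 0 ≤ C ∧ ∀ p, Admissible R E p → |b p| ≤ C * (1 + |p.1|) ^ a := by
  have h1 : ∀ p : ℝ × ℝ, 1 ≤ 1 + |p.1| := fun p => by linarith [abs_nonneg p.1]
  induction hb using Algebra.adjoin_induction with
  | mem b hb =>
    simp only [Set.mem_insert_iff, Set.mem_singleton_iff] at hb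
    rcases hb with rfl | rfl | rfl | rfl | rfl
    · exact ⟨1, 1, zero_le_one, fun p _ => by simp⟩
    · exact ⟨1, 0, zero_le_one, fun p hp => by simpa [abs_of_nonneg hp.1] using hp.2.1⟩
    · have hD := speed_pos hR hE
      refine ⟨speed R E + 1 / R + 1, 1, by positivity, fun p hp => ?_⟩
      have h2 := hp.mul_frequency_le hR hE
      have h3 := hp.one_le_frequency hR hE
      rw [abs_of_nonneg (by linarith), pow_one]
      have h4 : p.2 * p.1 ≤ |p.1| := by
        calc p.2 * p.1 ≤ |p.2 * p.1| := le_abs_self _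
          _ = p.2 * |p.1| := by rw [abs_mul, abs_of_nonneg hp.1]
          _ ≤ 1 * |p.1| := by gcongr; exact hp.2.1
          _ = |p.1| := one_mul _
      have ha := abs_nonneg p.1
      refine le_of_mul_le_mul_left ?_ hR
      calc R * frequency R E p ≤ R * speed R E + |p.1| + R := by linarith
        _ ≤ R * speed R E + |p.1| + R + (R * speed R E * |p.1| + 1 + R * |p.1|) := by
          have : 0 ≤ R * speed R E * |p.1| + 1 + R * |p.1| := by positivity
          linarith
        _ = R * ((speed R E + 1 / R + 1) * (1 + |p.1|)) := by
          field_simp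
          ring
    · refine ⟨1, 0, zero_le_one, fun p hp => ?_⟩
      have h3 := hp.one_le_frequency hR hE
      rw [Pi.inv_apply, abs_of_nonneg (by positivity)]
      simpa using inv_le_one_of_one_le₀ h3
    · refine ⟨1, 0, zero_le_one, fun p hp => ?_⟩
      have h3 := hp.one_le_frequency hR hE
      rw [abs_of_nonneg (by positivity)]
      simpa using inv_le_one_of_one_le₀ (by linarith : 1 ≤ frequency R E p + E)
  | algebraMap c => exact ⟨|c|, 0, abs_nonneg c, fun p _ => by simp⟩
  | add x y _ _ hx hy =>
    obtain ⟨C, a, hC, hx⟩ := hx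
    obtain ⟨C', a', hC', hy⟩ := hy
    refine ⟨C + C', max a a', by positivity, fun p hp => ?_⟩
    calc |x p + y p| ≤ |x p| + |y p| := abs_add_le _ _
      _ ≤ C * (1 + |p.1|) ^ a + C' * (1 + |p.1|) ^ a' := add_le_add (hx p hp) (hy p hp)
      _ ≤ C * (1 + |p.1|) ^ max a a' + C' * (1 + |p.1|) ^ max a a' := by
        gcongr
        · exact h1 p
        · exact le_max_left _ _
        · exact h1 p
        · exact le_max_right _ _
      _ = _ := by ring
  | mul x y _ _ hx hy =>
    obtain ⟨C, a, hC, hx⟩ := hx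
    obtain ⟨C', a', hC', hy⟩ := hy
    refine ⟨C * C', a + a', by positivity, fun p hp => ?_⟩
    calc |x p * y p| = |x p| * |y p| := abs_mul _ _
      _ ≤ (C * (1 + |p.1|) ^ a) * (C' * (1 + |p.1|) ^ a') := by
        gcongr
        · exact hx p hp
        · exact hy p hp
      _ = _ := by ring

/-- At `ε = 0` the frequency is the constant `E`, so `s` is the only generator that still varies. -/
theorem exists_polynomial_of_mem (hE : 1 < E) {b : ℝ × ℝ → ℝ} (hb : b ∈ symbolAlgebra R E) :
    ∃ P : Polynomial ℝ, ∀ s, b (s, 0) = P.eval s := by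
  induction hb using Algebra.adjoin_induction with
  | mem b hb =>
    simp only [Set.mem_insert_iff, Set.mem_singleton_iff] at hb
    rcases hb with rfl | rfl | rfl | rfl | rfl
    · exact ⟨Polynomial.X, fun s => by simp⟩
    · exact ⟨0, fun s => by simp⟩
    · exact ⟨Polynomial.C E, fun s => by rw [frequency_zero hE, Polynomial.eval_C]⟩
    · exact ⟨Polynomial.C E⁻¹, fun s => by
        rw [Pi.inv_apply, frequency_zero hE, Polynomial.eval_C]⟩
    · exact ⟨Polynomial.C (E + E)⁻¹, fun s => by
        simp only [frequency_zero hE, Polynomial.eval_C]⟩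
  | algebraMap c => exact ⟨Polynomial.C c, fun s => by simp⟩
  | add x y _ _ hx hy =>
    obtain ⟨P, hx⟩ := hx
    obtain ⟨P', hy⟩ := hy
    exact ⟨P + P', fun s => by simp [hx, hy]⟩
  | mul x y _ _ hx hy =>
    obtain ⟨P, hx⟩ := hx
    obtain ⟨P', hy⟩ := hy
    exact ⟨P * P', fun s => by simp [hx, hy]⟩

end Geometry

/-! ### Taylor expansion in `1/N` -/

/-- The `l`-th derivative of a Schwartz function. -/
def iterDeriv : ℕ → SchwartzMap ℝ ℂ → SchwartzMap ℝ ℂ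
  | 0, φ => φ
  | l + 1, φ => SchwartzMap.derivCLM ℂ ℂ (iterDeriv l φ)

theorem hasDerivAt_iterDeriv (l : ℕ) (φ : SchwartzMap ℝ ℂ) (x : ℝ) :
    HasDerivAt (iterDeriv l φ) (iterDeriv (l + 1) φ x) x :=
  (iterDeriv l φ).hasDerivAt x

variable {R E : ℝ}

/-- The function `∑ b_l(p) φ^{(l)}(x(p))` of `p = (s, 1 / N)`, where `x` is the displacement. -/
def symbolSum (R E : ℝ) (b : ℕ → ℝ × ℝ → ℝ) (φ : SchwartzMap ℝ ℂ) (j : ℕ) (p : ℝ × ℝ) : ℂ :=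
  ∑ l ∈ Finset.range (j + 1), (b l p : ℂ) * iterDeriv l φ (displacement R E p)

theorem hasDerivAt_displacement_zero (hR : 0 < R) (hE : 1 < E) (s : ℝ) :
    HasDerivAt (fun e => displacement R E (s, e))
      ((s ^ 2 - 1 / 4) / (2 * R ^ 2 * E) - speed R E ^ 2 * s ^ 2 / (2 * R ^ 2 * E ^ 3)) 0 := by
  have hE0 : E ≠ 0 := by linarith
  have hr : 0 < radicand R E (s, 0) := by rw [radicand_zero]; positivity
  have hQ := (hasDerivAt_frequency hr).add_const E
  have h1 : HasDerivAt (fun e : ℝ => 2 * speed R E / R * s + e * (s ^ 2 - 1 / 4) * (1 / R ^ 2))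
      ((s ^ 2 - 1 / 4) * (1 / R ^ 2)) 0 := by
    simpa only [one_mul, id] using! (((hasDerivAt_id (0 : ℝ)).mul_const (s ^ 2 - 1 / 4)).mul_const
      (1 / R ^ 2)).const_add (2 * speed R E / R * s)
  have hne : frequency R E (s, 0) + E ≠ 0 := by
    rw [frequency_zero hE]
    linarith
  convert! h1.mul (hQ.inv hne) using 1
  simp only [frequencyDeriv, Pi.inv_apply, frequency_zero hE]
  field_simp
  ring

/-- The chain rule gives the recursion `b_{j+1,l} = ∂_ε b_{j,l} + (∂_ε x) b_{j,l-1}`, starting from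
the multiplicity divided by `N`. The symbols do not depend on `φ`, which is why the final
polynomials do not either. -/
theorem exists_symbols (hR : 0 < R) (hE : 1 < E) :
    ∃ b : ℕ → ℕ → ℝ × ℝ → ℝ, (∀ j l, b j l ∈ symbolAlgebra R E) ∧
      (b 0 0 = fun p => 2 * (R * speed R E + p.2 * p.1)) ∧
      (∀ s, b 1 0 (s, 0) = 2 * s) ∧
      (∀ s, b 1 1 (s, 0) = 2 * (R * speed R E) *
        ((s ^ 2 - 1 / 4) / (2 * R ^ 2 * E) - speed R E ^ 2 * s ^ 2 / (2 * R ^ 2 * E ^ 3))) ∧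
      ∀ φ j s ε, 0 < radicand R E (s, ε) → HasDerivAt (fun e => symbolSum R E (b j) φ j (s, e))
        (symbolSum R E (b (j + 1)) φ (j + 1) (s, ε)) ε := by
  choose! dd hdmem hdd using fun b (hb : b ∈ symbolAlgebra R E) => exists_hasDerivAt_of_mem hE hb
  set b₀ : ℝ × ℝ → ℝ := fun p => 2 * (R * speed R E + p.2 * p.1) with hb₀
  have hb₀mem : b₀ ∈ symbolAlgebra R E :=
    mul_mem (const_mem_symbolAlgebra 2) (add_mem (const_mem_symbolAlgebra (R * speed R E))
      (mul_mem snd_mem_symbolAlgebra fst_mem_symbolAlgebra))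
  set Y' := dd (displacement R E) with hY'
  have hY'mem : Y' ∈ symbolAlgebra R E := hdmem _ displacement_mem_symbolAlgebra
  -- The guard `l ≤ j` drops the derivatives of entries outside the sum; `dd` is an arbitrary choice
  -- and need not be zero on the zero function.
  obtain ⟨b, hzero, hsucc⟩ : ∃ b : ℕ → ℕ → ℝ × ℝ → ℝ, (∀ l, b 0 l = if l = 0 then b₀ else 0) ∧
      ∀ j l, b (j + 1) l =
        (if l ≤ j then dd (b j l) else 0) + if l = 0 then 0 else Y' * b j (l - 1) :=
    ⟨fun j => Nat.rec (fun l => if l = 0 then b₀ else 0)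
      (fun j bj l => (if l ≤ j then dd (bj l) else 0) + if l = 0 then 0 else Y' * bj (l - 1)) j,
      fun _ => rfl, fun _ _ => rfl⟩
  have hmem : ∀ j l, b j l ∈ symbolAlgebra R E := by
    intro j
    induction j with
    | zero =>
      intro l
      rw [hzero]
      split_ifs
      exacts [hb₀mem, zero_mem _]
    | succ j ih =>
      intro l
      rw [hsucc]
      refine add_mem ?_ ?_
      · split_ifs
        exacts [hdmem _ (ih l), zero_mem _]
      · split_ifs
        exacts [zero_mem _, mul_mem hY'mem (ih _)]
  have hr0 : ∀ s, 0 < radicand R E (s, 0) := fun s => by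
    rw [radicand_zero]
    have : 0 < E := by linarith
    positivity
  refine ⟨b, hmem, by simp [hzero], fun s => ?_, fun s => ?_, fun φ j s ε h => ?_⟩
  · have h1 : b 1 0 = dd b₀ := (hsucc 0 0).trans (by simp [hzero])
    have h2 : HasDerivAt (fun e => b₀ (s, e)) (2 * s) 0 := by
      simpa using (((hasDerivAt_id (0 : ℝ)).mul_const s).const_add (R * speed R E)).const_mul 2
    rw [h1]
    exact (hdd b₀ hb₀mem s 0 (hr0 s)).unique h2
  · have h1 : b 1 1 = Y' * b₀ := (hsucc 0 1).trans (by simp [hzero])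
    have h2 : Y' (s, 0) = _ := (hdd _ displacement_mem_symbolAlgebra s 0 (hr0 s)).unique
      (hasDerivAt_displacement_zero hR hE s)
    rw [h1, Pi.mul_apply, h2, hb₀]
    ring
  · have hd : ∀ l, HasDerivAt (fun e => iterDeriv l φ (displacement R E (s, e)))
        ((Y' (s, ε) : ℂ) * iterDeriv (l + 1) φ (displacement R E (s, ε))) ε := fun l => by
      have := (hasDerivAt_iterDeriv l φ (displacement R E (s, ε))).scomp ε
        (hdd _ displacement_mem_symbolAlgebra s ε h)
      simpa [Function.comp_def] using this
    have hs : HasDerivAt (fun e => symbolSum R E (b j) φ j (s, e))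
        (∑ l ∈ Finset.range (j + 1), ((dd (b j l) (s, ε) : ℂ) *
          iterDeriv l φ (displacement R E (s, ε)) + (b j l (s, ε) : ℂ) *
          ((Y' (s, ε) : ℂ) * iterDeriv (l + 1) φ (displacement R E (s, ε))))) ε := by
      simp only [symbolSum]
      refine HasDerivAt.fun_sum fun l _ => ?_
      have h3 : HasDerivAt (fun e => (b j l (s, e) : ℂ)) ((dd (b j l) (s, ε) : ℝ) : ℂ) ε :=
        (hdd _ (hmem j l) s ε h).ofReal_comp
      exact h3.mul (hd l)
    convert hs using 1
    simp only [symbolSum, hsucc, Pi.add_apply, Complex.ofReal_add, add_mul, Finset.sum_add_distrib]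
    congr 1
    · rw [Finset.sum_range_succ]
      simp only [Nat.add_one_le_iff, lt_irrefl, if_false, Pi.zero_apply, Complex.ofReal_zero,
        zero_mul, add_zero]
      refine Finset.sum_congr rfl fun l hl => ?_
      rw [if_pos (Nat.lt_succ_iff.1 (Finset.mem_range.1 hl))]
    · rw [Finset.sum_range_succ']
      simp only [Nat.add_one_ne_zero, if_false, if_true, Pi.zero_apply, Complex.ofReal_zero,
        zero_mul, add_zero, Nat.add_sub_cancel, Pi.mul_apply, Complex.ofReal_mul]
      refine Finset.sum_congr rfl fun l _ => ?_
      ring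

/-- Taylor's formula with a uniform bound on the last derivative. -/
theorem norm_sub_taylor_le {G : ℕ → ℝ → ℂ} {ε C : ℝ} (hε : 0 ≤ ε) (J : ℕ)
    (hG : ∀ j, ∀ x ∈ Set.Icc 0 ε, HasDerivAt (G j) (G (j + 1) x) x)
    (hC : ∀ x ∈ Set.Icc 0 ε, ‖G J x‖ ≤ C) :
    ∀ x ∈ Set.Icc 0 ε, ‖G 0 x - ∑ j ∈ Finset.range J, G j 0 / (j.factorial : ℂ) * (x : ℂ) ^ j‖
      ≤ C * ε ^ J := by
  induction J generalizing G with
  | zero => simpa using hC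
  | succ J ih =>
    intro x hx
    -- The derivative of a Taylor remainder is the remainder of the shifted family, one order lower.
    -- The mean value inequality then supplies one more factor `ε`.
    have ih' := ih (G := fun j => G (j + 1)) (fun j => hG (j + 1)) hC
    set H : ℝ → ℂ := fun x =>
      G 0 x - ∑ j ∈ Finset.range (J + 1), G j 0 / (j.factorial : ℂ) * (x : ℂ) ^ j with hH
    have hH0 : H 0 = 0 := by
      simp [hH, Finset.sum_range_succ']
    have hd : ∀ y ∈ Set.Icc 0 ε, HasDerivWithinAt H (G 1 y -
        ∑ j ∈ Finset.range J, G (j + 1) 0 / (j.factorial : ℂ) * (y : ℂ) ^ j) (Set.Icc 0 ε) y := by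
      intro y hy
      refine HasDerivAt.hasDerivWithinAt ?_
      have h1 : HasDerivAt (fun x : ℝ =>
          ∑ j ∈ Finset.range (J + 1), G j 0 / (j.factorial : ℂ) * (x : ℂ) ^ j)
          (∑ j ∈ Finset.range (J + 1), G j 0 / (j.factorial : ℂ) * (j * (y : ℂ) ^ (j - 1))) y := by
        refine HasDerivAt.fun_sum fun j _ => ?_
        have h2 : HasDerivAt (fun x : ℝ => (x : ℂ) ^ j) (j * (y : ℂ) ^ (j - 1)) y := by
          simpa using (Complex.ofRealCLM.hasDerivAt (x := y)).fun_pow j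
        exact h2.const_mul _
      convert! (hG 0 y hy).sub h1 using 2
      rw [Finset.sum_range_succ']
      simp only [Nat.cast_zero, zero_mul, mul_zero, add_zero]
      refine Finset.sum_congr rfl fun j _ => ?_
      have : (j.factorial : ℂ) ≠ 0 := by exact_mod_cast j.factorial_ne_zero
      have h3 : ((j : ℂ) + 1) ≠ 0 := by exact_mod_cast Nat.succ_ne_zero j
      rw [Nat.factorial_succ, Nat.add_sub_cancel]
      push_cast
      field_simp
    have h := (convex_Icc (0 : ℝ) ε).norm_image_sub_le_of_norm_hasDerivWithin_le hd ih'
      (Set.left_mem_Icc.2 hε) hx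
    rw [hH0, sub_zero, sub_zero, Real.norm_of_nonneg hx.1] at h
    refine h.trans ?_
    have hC0 : 0 ≤ C * ε ^ J := (norm_nonneg _).trans (ih' x hx)
    calc C * ε ^ J * x ≤ C * ε ^ J * ε := by gcongr; exact hx.2
      _ = _ := by ring

/-- If a symbol grows like `(1 + |s|)^a`, take Schwartz decay of order `a + 2` in the displacement;
two powers of `1 + |s|` survive, enough for summation over the lattice. -/
theorem exists_symbolSum_bound (hR : 0 < R) (hE : 1 < E) {b : ℕ → ℝ × ℝ → ℝ}
    (hb : ∀ l, b l ∈ symbolAlgebra R E) (φ : SchwartzMap ℝ ℂ) (j : ℕ) :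
    ∃ C, 0 ≤ C ∧ ∀ p, Admissible R E p →
      ‖symbolSum R E b φ j p‖ ≤ C * ((1 + |p.1|) ^ 2)⁻¹ := by
  obtain ⟨K, hK0, hK⟩ := exists_one_add_abs_le_displacement hR hE
  have hterm : ∀ l, ∃ C, 0 ≤ C ∧ ∀ p, Admissible R E p →
      ‖(b l p : ℂ) * iterDeriv l φ (displacement R E p)‖ ≤ C * ((1 + |p.1|) ^ 2)⁻¹ := by
    intro l
    obtain ⟨A, a, hA0, hA⟩ := exists_growth_of_mem hR hE (hb l)
    obtain ⟨C, hC0, hC⟩ := exists_schwartz_bound (iterDeriv l φ) (a + 2)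
    refine ⟨A * (K ^ (a + 2) * C), by positivity, fun p hp => ?_⟩
    have hs : 0 < 1 + |p.1| := by positivity
    rw [norm_mul, Complex.norm_real, Real.norm_eq_abs, ← div_eq_mul_inv, le_div_iff₀ (by positivity)]
    have h1 := hA p hp
    have h2 := hC (displacement R E p)
    have h3 : (1 + |p.1|) ^ (a + 2) ≤ K ^ (a + 2) * (1 + |displacement R E p|) ^ (a + 2) := by
      rw [← mul_pow]
      gcongr
      exact hK p hp
    calc |b l p| * ‖iterDeriv l φ (displacement R E p)‖ * (1 + |p.1|) ^ 2
        ≤ A * (1 + |p.1|) ^ a * ‖iterDeriv l φ (displacement R E p)‖ * (1 + |p.1|) ^ 2 := by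
          gcongr
      _ = A * (‖iterDeriv l φ (displacement R E p)‖ * (1 + |p.1|) ^ (a + 2)) := by ring
      _ ≤ A * (‖iterDeriv l φ (displacement R E p)‖ *
          (K ^ (a + 2) * (1 + |displacement R E p|) ^ (a + 2))) := by gcongr
      _ = A * (K ^ (a + 2) * (‖iterDeriv l φ (displacement R E p)‖ *
          (1 + |displacement R E p|) ^ (a + 2))) := by ring
      _ ≤ A * (K ^ (a + 2) * C) := by gcongr
  choose C hC0 hC using hterm
  refine ⟨∑ l ∈ Finset.range (j + 1), C l, Finset.sum_nonneg fun l _ => hC0 l, fun p hp => ?_⟩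
  rw [Finset.sum_mul]
  exact (norm_sum_le _ _).trans (Finset.sum_le_sum fun l _ => hC l p hp)

/-- The expansion of the summand of the trace in powers of `1 / N`, uniformly on the spectrum. -/
theorem exists_symbolSum_taylor_bound (hR : 0 < R) (hE : 1 < E) {b : ℕ → ℕ → ℝ × ℝ → ℝ}
    (hb : ∀ j l, b j l ∈ symbolAlgebra R E)
    (hd : ∀ φ j s ε, 0 < radicand R E (s, ε) →
      HasDerivAt (fun e => symbolSum R E (b j) φ j (s, e))
        (symbolSum R E (b (j + 1)) φ (j + 1) (s, ε)) ε) (φ : SchwartzMap ℝ ℂ) (J : ℕ) :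
    ∃ C, 0 ≤ C ∧ ∀ s ε, Admissible R E (s, ε) → ‖symbolSum R E (b 0) φ 0 (s, ε) -
      ∑ j ∈ Finset.range J, symbolSum R E (b j) φ j (s, 0) / (j.factorial : ℂ) * (ε : ℂ) ^ j‖ ≤
      C * ε ^ J * ((1 + |s|) ^ 2)⁻¹ := by
  obtain ⟨C, hC0, hC⟩ := exists_symbolSum_bound hR hE (hb J) φ J
  refine ⟨C, hC0, fun s ε h => ?_⟩
  have h1 := norm_sub_taylor_le (G := fun j e => symbolSum R E (b j) φ j (s, e)) h.1 J
    (C := C * ((1 + |s|) ^ 2)⁻¹)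
    (fun j x hx => hd φ j s x (one_pos.trans_le
      ((h.mono hR hE hx.1 hx.2).one_le_radicand hR hE)))
    (fun x hx => hC (s, x) (h.mono hR hE hx.1 hx.2)) ε (Set.right_mem_Icc.2 h.1)
  calc _ ≤ C * ((1 + |s|) ^ 2)⁻¹ * ε ^ J := h1
    _ = _ := by ring

/-! ### Lattice sums and Poisson summation -/

theorem summable_inv_one_add_abs_sq (t : ℝ) :
    Summable fun n : ℤ => ((1 + |(n : ℝ) + t|) ^ 2)⁻¹ := by
  have h0 : Summable fun n : ℤ => ((1 + |(n : ℝ)|) ^ 2)⁻¹ := by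
    have h1 : Summable fun n : ℕ => ((1 + |(n : ℝ)|) ^ 2)⁻¹ := by
      have := (summable_nat_add_iff 1).2 (Real.summable_one_div_nat_pow.2 one_lt_two)
      simpa [add_comm, abs_of_nonneg] using this
    exact Summable.of_nat_of_neg (by simpa using h1) (by simpa using h1)
  refine Summable.of_nonneg_of_le (fun n => by positivity) (fun n => ?_)
    (h0.mul_left ((1 + |t|) ^ 2))
  have h2 : 1 + |(n : ℝ)| ≤ (1 + |t|) * (1 + |(n : ℝ) + t|) := by
    have h3 : |(n : ℝ)| ≤ |(n : ℝ) + t| + |t| := by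
      have := abs_sub ((n : ℝ) + t) t
      rwa [add_sub_cancel_right] at this
    nlinarith [abs_nonneg t, abs_nonneg ((n : ℝ) + t)]
  rw [← div_eq_mul_inv, inv_eq_one_div, div_le_div_iff₀ (by positivity) (by positivity), one_mul,
    ← mul_pow]
  gcongr

/-- The sum is periodic in `t` of period one, so `t` may be taken in `[0, 1)`. Uniformity in `t` is
needed because the offset of the lattice varies with `N`. -/
theorem exists_tsum_inv_one_add_abs_sq_le :
    ∃ C, 0 ≤ C ∧ ∀ t : ℝ, ∑' n : ℤ, ((1 + |(n : ℝ) + t|) ^ 2)⁻¹ ≤ C := by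
  refine ⟨4 * ∑' n : ℤ, ((1 + |(n : ℝ) + 0|) ^ 2)⁻¹, by positivity, fun t => ?_⟩
  have hshift : ∑' n : ℤ, ((1 + |(n : ℝ) + t|) ^ 2)⁻¹ =
      ∑' n : ℤ, ((1 + |(n : ℝ) + Int.fract t|) ^ 2)⁻¹ := by
    rw [← (Equiv.addRight ⌊t⌋).tsum_eq fun n : ℤ => ((1 + |(n : ℝ) + Int.fract t|) ^ 2)⁻¹]
    refine tsum_congr fun n => ?_
    have : ((Equiv.addRight ⌊t⌋ n : ℤ) : ℝ) + Int.fract t = n + t := by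
      rw [Equiv.coe_addRight, Int.fract]
      push_cast
      ring
    rw [this]
  rw [hshift, ← tsum_mul_left]
  refine (summable_inv_one_add_abs_sq _).tsum_le_tsum (fun n => ?_)
    ((summable_inv_one_add_abs_sq 0).mul_left 4)
  have h1 := Int.fract_nonneg t
  have h2 := (Int.fract_lt_one t).le
  have h3 : 1 + |(n : ℝ) + 0| ≤ 2 * (1 + |(n : ℝ) + Int.fract t|) := by
    have h4 : |(n : ℝ) + 0| ≤ |(n : ℝ) + Int.fract t| + |Int.fract t| := by
      have := abs_sub ((n : ℝ) + Int.fract t) (Int.fract t)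
      rw [add_sub_cancel_right] at this
      rwa [add_zero]
    rw [abs_of_nonneg h1] at h4
    linarith [abs_nonneg ((n : ℝ) + Int.fract t)]
  rw [← div_eq_mul_inv, inv_eq_one_div, div_le_div_iff₀ (by positivity) (by positivity), one_mul]
  calc (1 + |(n : ℝ) + 0|) ^ 2 ≤ (2 * (1 + |(n : ℝ) + Int.fract t|)) ^ 2 := by gcongr
    _ = _ := by ring

/-- The offset of the lattice over which the trace is a sum. -/
def offset (R E : ℝ) (N : ℕ) : ℝ := (N + 1) / 2 - R * speed R E * N

open FourierTransform SchwartzMap in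
-- Poisson summation on the shifted lattice: the character of frequency `k` at the offset is
-- precisely the phase.
theorem hasSum_poisson (R E : ℝ) (A : SchwartzMap ℝ ℂ) (N : ℕ) :
    HasSum (fun k : ℤ => 𝓕 A (k : ℝ) * phase R E k N) (∑' n : ℤ, A (n + offset R E N)) := by
  have hphase : ∀ k : ℤ, fourier k ((offset R E N : ℝ) : UnitAddCircle) = phase R E k N := by
    intro k
    rw [fourier_coe_apply, phase, ← Complex.exp_add, offset]
    congr 1
    push_cast
    ring
  have hs : Summable fun k : ℤ => 𝓕 A (k : ℝ) * phase R E k N := by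
    obtain ⟨C, hC0, hC⟩ := exists_schwartz_bound (𝓕 A) 2
    refine Summable.of_norm_bounded ((summable_inv_one_add_abs_sq 0).mul_left C) fun k => ?_
    have h1 : ‖phase R E k N‖ = 1 := by
      rw [← hphase, fourier_apply]
      exact Circle.norm_coe _
    rw [norm_mul, h1, mul_one, ← div_eq_mul_inv, le_div_iff₀ (by positivity), add_zero]
    exact hC k
  have h := SchwartzMap.tsum_eq_tsum_fourier A (offset R E N)
  simp only [hphase] at h
  have e : (fun n : ℤ => A (n + offset R E N)) = fun n : ℤ => A (offset R E N + n) := by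
    funext n
    rw [add_comm]
  rw [e, h]
  exact hs.hasSum

/-! ### Operators with polynomial coefficients under the Fourier transform -/

section FourierOperators

open FourierTransform SchwartzMap Real

/-- Multiplication of a Schwartz function by the coordinate. -/
def mulX (ψ : SchwartzMap ℝ ℂ) : SchwartzMap ℝ ℂ := smulLeftCLM ℂ (fun x : ℝ => x) ψ

theorem mulX_apply (ψ : SchwartzMap ℝ ℂ) (x : ℝ) : mulX ψ x = x * ψ x := by
  rw [mulX, smulLeftCLM_apply_apply Function.HasTemperateGrowth.id']
  simp

theorem fourier_mulX (ψ : SchwartzMap ℝ ℂ) (ξ : ℝ) :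
    𝓕 (mulX ψ) ξ = Complex.I / (2 * π) * iterDeriv 1 (𝓕 ψ) ξ := by
  have h1 : MeasureTheory.Integrable (fun x : ℝ => x • ψ x) := by
    have := (mulX ψ).integrable (μ := MeasureTheory.volume)
    refine this.congr (Filter.Eventually.of_forall fun x => ?_)
    simp [mulX_apply]
  have h := Real.deriv_fourier ψ.integrable h1
  have h2 : iterDeriv 1 (𝓕 ψ) ξ = deriv (𝓕 (ψ : ℝ → ℂ)) ξ := rfl
  have h3 : (fun x : ℝ => (-2 * π * Complex.I * x) • ψ x) =
      (-2 * π * Complex.I : ℂ) • (mulX ψ : ℝ → ℂ) := by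
    funext x
    simp only [Pi.smul_apply, mulX_apply, smul_eq_mul]
    ring
  have h4 : 𝓕 ((-2 * π * Complex.I : ℂ) • (mulX ψ : ℝ → ℂ)) ξ =
      (-2 * π * Complex.I : ℂ) * 𝓕 (mulX ψ) ξ := by
    have := congrFun (congrArg DFunLike.coe
      (FourierTransform.fourier_smul (-2 * π * Complex.I : ℂ) (mulX ψ))) ξ
    exact this
  rw [h2, h, h3, h4]
  have hpi : (π : ℂ) ≠ 0 := by exact_mod_cast Real.pi_ne_zero
  field_simp
  linear_combination (𝓕 (mulX ψ) ξ) * Complex.I_sq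

theorem fourier_iterDeriv_one (ψ : SchwartzMap ℝ ℂ) (ξ : ℝ) :
    𝓕 (derivCLM ℂ ℂ ψ) ξ = 2 * π * Complex.I * ξ * 𝓕 ψ ξ :=
  congrFun (Real.fourier_deriv ψ.integrable ψ.differentiable (derivCLM ℂ ℂ ψ).integrable) ξ

/-- The operators on Schwartz functions that the Fourier transform turns into differential operators
with polynomial coefficients. -/
def IsPolynomialOperator (T : SchwartzMap ℝ ℂ → SchwartzMap ℝ ℂ) : Prop :=
  ∃ (n : ℕ) (q : ℕ → Polynomial ℂ), (∀ i, n ≤ i → q i = 0) ∧ ∀ ψ (ξ : ℝ),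
    𝓕 (T ψ) ξ = ∑ i ∈ Finset.range n, (q i).eval (ξ : ℂ) * iterDeriv i (𝓕 ψ) ξ

variable {T T' : SchwartzMap ℝ ℂ → SchwartzMap ℝ ℂ}

theorem sum_range_eq_of_eq_zero {n m : ℕ} {q : ℕ → Polynomial ℂ} (hq : ∀ i, n ≤ i → q i = 0)
    (hnm : n ≤ m) (z : ℂ) (f : ℕ → ℂ) :
    ∑ i ∈ Finset.range n, (q i).eval z * f i = ∑ i ∈ Finset.range m, (q i).eval z * f i := by
  refine Finset.sum_subset (Finset.range_mono hnm) fun i _ hi => ?_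
  rw [hq i (by simpa using hi)]
  simp

theorem IsPolynomialOperator.add (h : IsPolynomialOperator T) (h' : IsPolynomialOperator T') :
    IsPolynomialOperator fun ψ => T ψ + T' ψ := by
  obtain ⟨n, q, hq, h⟩ := h
  obtain ⟨n', q', hq', h'⟩ := h'
  refine ⟨max n n', fun i => q i + q' i, fun i hi => ?_, fun ψ ξ => ?_⟩
  · simp only [hq i (le_of_max_le_left hi), hq' i (le_of_max_le_right hi), add_zero]
  · rw [FourierTransform.fourier_add, add_apply, h, h',
      sum_range_eq_of_eq_zero hq (le_max_left n n'),
      sum_range_eq_of_eq_zero hq' (le_max_right n n'), ← Finset.sum_add_distrib]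
    refine Finset.sum_congr rfl fun i _ => ?_
    rw [Polynomial.eval_add]
    ring

theorem IsPolynomialOperator.smul (c : ℂ) (h : IsPolynomialOperator T) :
    IsPolynomialOperator fun ψ => c • T ψ := by
  obtain ⟨n, q, hq, h⟩ := h
  refine ⟨n, fun i => Polynomial.C c * q i, fun i hi => by simp only [hq i hi, mul_zero],
    fun ψ ξ => ?_⟩
  rw [FourierTransform.fourier_smul, smul_apply, h, smul_eq_mul, Finset.mul_sum]
  refine Finset.sum_congr rfl fun i _ => ?_
  rw [Polynomial.eval_mul, Polynomial.eval_C]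
  ring

theorem isPolynomialOperator_zero : IsPolynomialOperator fun _ => 0 :=
  ⟨0, 0, fun _ _ => rfl, fun ψ ξ => by
    have : 𝓕 (0 : SchwartzMap ℝ ℂ) = 0 := FourierTransform.fourier_zero ..
    simp [this]⟩

theorem isPolynomialOperator_sum {s : Finset ℕ} {T : ℕ → SchwartzMap ℝ ℂ → SchwartzMap ℝ ℂ}
    (h : ∀ l, IsPolynomialOperator (T l)) : IsPolynomialOperator fun ψ => ∑ l ∈ s, T l ψ := by
  induction s using Finset.induction_on with
  | empty => simpa using isPolynomialOperator_zero
  | insert a s ha ih => simpa [Finset.sum_insert ha] using (h a).add ih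

theorem isPolynomialOperator_iterDeriv (l : ℕ) : IsPolynomialOperator (iterDeriv l) := by
  refine ⟨1, fun i => if i = 0 then (Polynomial.C (2 * π * Complex.I) * Polynomial.X) ^ l else 0,
    fun i hi => if_neg (by omega), fun ψ ξ => ?_⟩
  simp only [Finset.sum_range_one, if_true, Polynomial.eval_pow, Polynomial.eval_mul,
    Polynomial.eval_C, Polynomial.eval_X]
  induction l with
  | zero => simp [iterDeriv]
  | succ l ih =>
    have h : iterDeriv (l + 1) ψ = derivCLM ℂ ℂ (iterDeriv l ψ) := rfl
    rw [h, fourier_iterDeriv_one, ih]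
    ring

/-- Multiplication by `x` becomes `(i/2π) d/dξ`, and by the Leibniz rule the coefficients `q_i` turn
into `q_i' + q_{i-1}`. -/
theorem IsPolynomialOperator.mulX (h : IsPolynomialOperator T) :
    IsPolynomialOperator fun ψ => mulX (T ψ) := by
  obtain ⟨n, q, hq, h⟩ := h
  have h1 : ∀ ψ (ξ : ℝ), iterDeriv 1 (𝓕 (T ψ)) ξ = ∑ i ∈ Finset.range (n + 1),
      (Polynomial.derivative (q i) + if i = 0 then 0 else q (i - 1)).eval (ξ : ℂ) *
        iterDeriv i (𝓕 ψ) ξ := by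
    intro ψ ξ
    have e : ⇑(𝓕 (T ψ) : SchwartzMap ℝ ℂ) = fun ξ : ℝ =>
        ∑ i ∈ Finset.range (n + 1), (q i).eval (ξ : ℂ) * iterDeriv i (𝓕 ψ) ξ := by
      funext ξ
      rw [h, sum_range_eq_of_eq_zero hq (Nat.le_succ n)]
    have hd : HasDerivAt ⇑(𝓕 (T ψ) : SchwartzMap ℝ ℂ) (∑ i ∈ Finset.range (n + 1),
        ((Polynomial.derivative (q i)).eval (ξ : ℂ) * iterDeriv i (𝓕 ψ) ξ +
          (q i).eval (ξ : ℂ) * iterDeriv (i + 1) (𝓕 ψ) ξ)) ξ := by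
      rw [e]
      refine HasDerivAt.fun_sum fun i _ => ?_
      exact ((q i).hasDerivAt (ξ : ℂ)).comp_ofReal.mul (hasDerivAt_iterDeriv i (𝓕 ψ) ξ)
    have h2 : iterDeriv 1 (𝓕 (T ψ)) ξ = deriv ⇑(𝓕 (T ψ) : SchwartzMap ℝ ℂ) ξ := rfl
    rw [h2, hd.deriv, Finset.sum_add_distrib]
    simp only [Polynomial.eval_add, add_mul, Finset.sum_add_distrib]
    congr 1
    trans ∑ i ∈ Finset.range n, (q i).eval (ξ : ℂ) * iterDeriv (i + 1) (𝓕 ψ) ξ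
    · rw [Finset.sum_range_succ, hq n le_rfl]
      simp
    · rw [Finset.sum_range_succ']
      simp
  have h3 := IsPolynomialOperator.smul (T := fun ψ => Monopole.mulX (T ψ)) 1 (by
    refine ⟨n + 1, fun i => Polynomial.C (Complex.I / (2 * π)) *
      (Polynomial.derivative (q i) + if i = 0 then 0 else q (i - 1)), fun i hi => ?_,
      fun ψ ξ => ?_⟩
    · simp [hq i (by omega), hq (i - 1) (by omega)]
    · rw [fourier_mulX, h1, Finset.mul_sum]
      refine Finset.sum_congr rfl fun i _ => ?_
      rw [Polynomial.eval_mul, Polynomial.eval_C]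
      ring)
  simpa using h3

theorem exists_polynomial_mul (P : Polynomial ℝ) (hT : IsPolynomialOperator T) :
    ∃ T', IsPolynomialOperator T' ∧ ∀ ψ (x : ℝ), T' ψ x = (P.eval x : ℝ) * T ψ x := by
  induction P using Polynomial.induction_on with
  | C a => exact ⟨_, hT.smul (a : ℂ), fun ψ x => by simp⟩
  | add p q hp hq =>
    obtain ⟨T₁, h₁, e₁⟩ := hp
    obtain ⟨T₂, h₂, e₂⟩ := hq
    refine ⟨_, h₁.add h₂, fun ψ x => ?_⟩
    rw [add_apply, e₁, e₂, Polynomial.eval_add]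
    push_cast
    ring
  | monomial n a h =>
    obtain ⟨T₁, h₁, e₁⟩ := h
    refine ⟨_, h₁.mulX, fun ψ x => ?_⟩
    rw [mulX_apply, e₁]
    simp only [Polynomial.eval_mul, Polynomial.eval_C, Polynomial.eval_pow, Polynomial.eval_X]
    push_cast
    ring

end FourierOperators

open FourierTransform SchwartzMap

/-! ### Dilations and the normalization of the Fourier transform -/

section Dilation

open Real

/-- The Schwartz function `x ↦ φ(κ x)`. -/
def dilate (κ : ℝ) (hκ : κ ≠ 0) (φ : SchwartzMap ℝ ℂ) : SchwartzMap ℝ ℂ :=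
  compCLMOfContinuousLinearEquiv ℂ
    (ContinuousLinearEquiv.unitsEquivAut ℝ (Units.mk0 κ hκ)) φ

variable {κ : ℝ} (hκ : κ ≠ 0) (φ : SchwartzMap ℝ ℂ)

theorem dilate_apply (x : ℝ) : dilate κ hκ φ x = φ (κ * x) := by
  simp [dilate, mul_comm]

theorem iterDeriv_succ_apply (l : ℕ) (x : ℝ) :
    iterDeriv (l + 1) φ x = deriv (iterDeriv l φ) x := rfl

theorem iterDeriv_dilate (l : ℕ) (x : ℝ) :
    iterDeriv l (dilate κ hκ φ) x = (κ : ℂ) ^ l * iterDeriv l φ (κ * x) := by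
  induction l generalizing x with
  | zero => simp [iterDeriv, dilate_apply]
  | succ l ih =>
    rw [iterDeriv_succ_apply, funext ih]
    have h1 : HasDerivAt (fun x : ℝ => κ * x) κ x := by
      simpa using (hasDerivAt_id x).const_mul κ
    have h2 := ((hasDerivAt_iterDeriv l φ (κ * x)).scomp x h1).const_mul ((κ : ℂ) ^ l)
    have h3 := h2.deriv
    simp only [Function.comp_def] at h3
    rw [h3, Complex.real_smul]
    ring

theorem iterDeriv_eq_iteratedDeriv (l : ℕ) : ⇑(iterDeriv l φ) = iteratedDeriv l φ := by
  induction l with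
  | zero => simp [iterDeriv]
  | succ l ih =>
    rw [iteratedDeriv_succ, ← ih]
    rfl

/-- The substitution `x ↦ κ x` also translates between the kernels `e^(-2πixξ)` and `e^(-ixξ)`. -/
theorem fourier_dilate (hpos : 0 < κ) (ξ : ℝ) :
    𝓕 (dilate κ hκ φ) ξ = (κ : ℂ)⁻¹ * fourierHat φ (2 * π / κ * ξ) := by
  have h1 : 𝓕 (dilate κ hκ φ) ξ = 𝓕 (dilate κ hκ φ : ℝ → ℂ) ξ := rfl
  rw [h1, Real.fourier_real_eq_integral_exp_smul, fourierHat]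
  have h2 : ∀ v : ℝ, Complex.exp (((-2 * π * v * ξ : ℝ) : ℂ) * Complex.I) • dilate κ hκ φ v =
      (fun x : ℝ => φ x * Complex.exp (-(Complex.I * ((2 * π / κ * ξ : ℝ) : ℂ) * x))) (κ * v) := by
    intro v
    have hκ' : (κ : ℂ) ≠ 0 := by exact_mod_cast hκ
    simp only [dilate_apply, smul_eq_mul]
    rw [mul_comm]
    congr 2
    push_cast
    field_simp
  rw [funext h2, MeasureTheory.Measure.integral_comp_mul_left
    (fun x : ℝ => φ x * Complex.exp (-(Complex.I * ((2 * π / κ * ξ : ℝ) : ℂ) * x))),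
    abs_of_pos (inv_pos.2 hpos), Complex.real_smul, Complex.ofReal_inv]

theorem contDiff_fourierHat : ContDiff ℝ ∞ (fourierHat φ) := by
  have h : fourierHat φ = fun ξ => 𝓕 (dilate 1 one_ne_zero φ) (ξ * (2 * π)⁻¹) := by
    funext ξ
    rw [fourier_dilate one_ne_zero φ one_pos]
    have hpi : π ≠ 0 := Real.pi_ne_zero
    simp only [Complex.ofReal_one, inv_one, one_mul, div_one]
    congr 1
    field_simp
  rw [h]
  exact ((𝓕 (dilate 1 one_ne_zero φ)).smooth ⊤).comp (contDiff_id.mul contDiff_const)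

theorem iterDeriv_fourier_dilate (hpos : 0 < κ) (l : ℕ) (ξ : ℝ) :
    iterDeriv l (𝓕 (dilate κ hκ φ)) ξ = (κ : ℂ)⁻¹ * ((2 * π / κ : ℝ) : ℂ) ^ l *
      iteratedDeriv l (fourierHat φ) (2 * π / κ * ξ) := by
  rw [iterDeriv_eq_iteratedDeriv, funext (fourier_dilate hκ φ hpos), iteratedDeriv_const_mul_field]
  have h := iteratedDeriv_comp_const_smul (n := l) ((contDiff_fourierHat φ).of_le
    (by exact_mod_cast le_top)) (2 * π / κ)
  rw [h]
  simp only [Complex.real_smul]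
  push_cast
  ring

end Dilation

/-! ### The Fourier transform of `x² ψ'` -/

section SecondCoefficient

theorem derivCLM_mulX (ψ : SchwartzMap ℝ ℂ) :
    derivCLM ℂ ℂ (mulX ψ) = ψ + mulX (derivCLM ℂ ℂ ψ) := by
  ext x
  have e : ⇑(mulX ψ) = fun x : ℝ => (x : ℂ) * ψ x := funext (mulX_apply ψ)
  have h : HasDerivAt (fun x : ℝ => (x : ℂ) * ψ x) (1 * ψ x + x * deriv ψ x) x :=
    (Complex.ofRealCLM.hasDerivAt (x := x)).mul (ψ.hasDerivAt x)
  rw [derivCLM_apply, e, h.deriv, add_apply, mulX_apply, derivCLM_apply, one_mul]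

theorem fourier_mulX_eq (ψ : SchwartzMap ℝ ℂ) :
    𝓕 (mulX ψ) = (Complex.I / (2 * Real.pi)) • derivCLM ℂ ℂ (𝓕 ψ) := by
  ext ξ
  rw [fourier_mulX, smul_apply, smul_eq_mul]
  rfl

theorem fourier_derivCLM_eq (ψ : SchwartzMap ℝ ℂ) :
    𝓕 (derivCLM ℂ ℂ ψ) = (2 * Real.pi * Complex.I : ℂ) • mulX (𝓕 ψ) := by
  ext ξ
  rw [fourier_iterDeriv_one, smul_apply, mulX_apply, smul_eq_mul]
  ring

/-- The left side is `(i/2π)² · 2πi · (ξ ψ̂)''`. -/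
theorem fourier_mulX_mulX_deriv (ψ : SchwartzMap ℝ ℂ) (ξ : ℝ) :
    𝓕 (mulX (mulX (derivCLM ℂ ℂ ψ))) ξ = -(Complex.I / (2 * Real.pi)) *
      (2 * iterDeriv 1 (𝓕 ψ) ξ + ξ * iterDeriv 2 (𝓕 ψ) ξ) := by
  have hpi : (Real.pi : ℂ) ≠ 0 := by exact_mod_cast Real.pi_ne_zero
  rw [fourier_mulX_eq, fourier_mulX_eq, fourier_derivCLM_eq]
  simp only [map_smul, derivCLM_mulX, map_add, smul_apply, add_apply, mulX_apply, smul_eq_mul]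
  have e1 : derivCLM ℂ ℂ (𝓕 ψ) ξ = iterDeriv 1 (𝓕 ψ) ξ := rfl
  have e2 : derivCLM ℂ ℂ (derivCLM ℂ ℂ (𝓕 ψ)) ξ = iterDeriv 2 (𝓕 ψ) ξ := rfl
  rw [e1, e2]
  field_simp
  linear_combination (2 * iterDeriv 1 (𝓕 ψ) ξ + ξ * iterDeriv 2 (𝓕 ψ) ξ) *
    Complex.I_sq

end SecondCoefficient

/-! ### Taylor coefficients as operators, and the spectrum on the lattice -/

theorem slope_pos (hR : 0 < R) (hE : 1 < E) : 0 < speed R E / (R * E) :=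
  div_pos (speed_pos hR hE) (mul_pos hR (by linarith))

theorem two_pi_div_slope_mul (R E : ℝ) (k : ℤ) :
    2 * Real.pi / (speed R E / (R * E)) * k = period R E k := by
  rw [period, div_div_eq_mul_div]
  ring

/-- At `ε = 0` the symbols are polynomials in `s` and the displacement is `κ s`, so the Taylor
coefficients act on the dilated function. The factors `κ^(-l)` undo the chain rule for its
derivatives. -/
theorem exists_operators (hR : 0 < R) (hE : 1 < E) {b : ℕ → ℕ → ℝ × ℝ → ℝ}
    (hb : ∀ j l, b j l ∈ symbolAlgebra R E) :
    ∃ T : ℕ → SchwartzMap ℝ ℂ → SchwartzMap ℝ ℂ, (∀ j, IsPolynomialOperator (T j)) ∧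
      ∀ j φ (s : ℝ), T j (dilate _ (slope_pos hR hE).ne' φ) s =
        symbolSum R E (b j) φ j (s, 0) / (j.factorial : ℂ) := by
  set κ := speed R E / (R * E) with hκ
  have hκ0 : (κ : ℂ) ≠ 0 := by exact_mod_cast (slope_pos hR hE).ne'
  choose P hP using fun j l => exists_polynomial_of_mem hE (hb j l)
  choose T hT hTe using fun j l => exists_polynomial_mul (P j l) (isPolynomialOperator_iterDeriv l)
  refine ⟨fun j ψ => ∑ l ∈ Finset.range (j + 1), (((κ : ℂ) ^ l)⁻¹ / (j.factorial : ℂ)) • T j l ψ,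
    fun j => isPolynomialOperator_sum fun l => (hT j l).smul _, fun j φ s => ?_⟩
  rw [symbolSum, sum_apply, Finset.sum_div]
  refine Finset.sum_congr rfl fun l _ => ?_
  rw [smul_apply, hTe, iterDeriv_dilate, hP, displacement_zero hE, ← hκ, smul_eq_mul]
  have h1 : (κ : ℂ) ^ l ≠ 0 := pow_ne_zero l hκ0
  field_simp

/-- The displacement is `(Q - E)/ε` rationalized by `Q + E`, which removes the singularity at `ε =
0`. -/
theorem mul_displacement (hR : 0 < R) (hE : 1 < E) {p : ℝ × ℝ} (hp : Admissible R E p) :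
    p.2 * displacement R E p = frequency R E p - E := by
  have h1 := hp.one_le_frequency hR hE
  have h2 : frequency R E p ^ 2 = radicand R E p :=
    Real.sq_sqrt (zero_le_one.trans (hp.one_le_radicand hR hE))
  have h3 : frequency R E p + E ≠ 0 := by linarith
  have h4 : p.2 * (2 * speed R E / R * p.1 + p.2 * (p.1 ^ 2 - 1 / 4) * (1 / R ^ 2)) =
      (frequency R E p - E) * (frequency R E p + E) := by
    have : (frequency R E p - E) * (frequency R E p + E) = frequency R E p ^ 2 - E ^ 2 := by ring
    rw [this, h2, radicand]
    ring
  rw [displacement, ← mul_assoc, h4, mul_assoc, mul_inv_cancel₀ h3, mul_one]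

section Lattice

variable {N : ℕ}

theorem mul_speed_add (R E : ℝ) (hN : N ≠ 0) (n : ℝ) :
    R * speed R E + (N : ℝ)⁻¹ * (n + offset R E N) = (N : ℝ)⁻¹ * (n + (N + 1) / 2) := by
  have : (N : ℝ) ≠ 0 := by exact_mod_cast hN
  rw [offset]
  field_simp
  ring

/-- Here `R D + ε s = 1/2 + ε/2 + ε n`, so the lower bound in `Admissible` is attained at `n = 0`
and amounts to `n ≥ 0`. -/
theorem admissible_lattice (R E : ℝ) (hN : N ≠ 0) (n : ℕ) :
    Admissible R E (n + offset R E N, (N : ℝ)⁻¹) := by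
  have hN0 : (N : ℝ) ≠ 0 := by exact_mod_cast hN
  have hN1 : (1 : ℝ) ≤ N := by exact_mod_cast Nat.one_le_iff_ne_zero.2 hN
  refine ⟨by positivity, inv_le_one_of_one_le₀ hN1, ?_⟩
  have h : (N : ℝ)⁻¹ * (n + (N + 1) / 2) = 1 / 2 + (N : ℝ)⁻¹ / 2 + (N : ℝ)⁻¹ * n := by
    field_simp
    ring
  simp only [mul_speed_add R E hN, h]
  have : 0 ≤ (N : ℝ)⁻¹ * n := by positivity
  linarith

theorem energy_add_sq (hR : 0 < R) (hE : 1 < E) (hN : N ≠ 0) (n : ℕ) :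
    energy R N n + (N : ℝ) ^ 2 =
      (N : ℝ) ^ 2 * radicand R E (n + offset R E N, (N : ℝ)⁻¹) := by
  have hN0 : (N : ℝ) ≠ 0 := by exact_mod_cast hN
  have h := sq_mul_radicand hR hE (n + offset R E N, (N : ℝ)⁻¹)
  simp only [mul_speed_add R E hN] at h
  have h2 : radicand R E (n + offset R E N, (N : ℝ)⁻¹) =
      (((N : ℝ)⁻¹ * (n + (N + 1) / 2)) ^ 2 + R ^ 2 - 1 / 4 - (N : ℝ)⁻¹ ^ 2 / 4) / R ^ 2 := by
    rw [← h]
    field_simp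
  rw [h2, energy, level]
  field_simp
  ring

theorem displacement_lattice (hR : 0 < R) (hE : 1 < E) (hN : N ≠ 0) (n : ℕ) :
    displacement R E (n + offset R E N, (N : ℝ)⁻¹) =
      √(energy R N n + (N : ℝ) ^ 2) - E * N := by
  have hN0 : (N : ℝ) ≠ 0 := by exact_mod_cast hN
  have h := mul_displacement hR hE (admissible_lattice R E hN n)
  rw [energy_add_sq hR hE hN, Real.sqrt_mul (by positivity), Real.sqrt_sq (by positivity)]
  rw [← frequency]
  simp only at h
  rw [inv_mul_eq_iff_eq_mul₀ hN0] at h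
  rw [h]
  ring

theorem mul_symbolSum_lattice (hR : 0 < R) (hE : 1 < E) (hN : N ≠ 0) (n : ℕ)
    {b : ℕ → ℝ × ℝ → ℝ} (hb : b 0 = fun p => 2 * (R * speed R E + p.2 * p.1))
    (φ : SchwartzMap ℝ ℂ) :
    (N + 2 * n + 1 : ℂ) * φ (√(energy R N n + (N : ℝ) ^ 2) - E * N) =
      N * symbolSum R E b φ 0 (n + offset R E N, (N : ℝ)⁻¹) := by
  have hN0 : (N : ℂ) ≠ 0 := by exact_mod_cast hN
  simp only [symbolSum, zero_add, Finset.sum_range_one, hb, mul_speed_add R E hN,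
    displacement_lattice hR hE hN, iterDeriv]
  push_cast
  field_simp
  ring

end Lattice

/-! ### The asymptotic expansion -/

theorem norm_tsum_int_le {f : ℤ → ℂ} {B C t : ℝ}
    (hf : ∀ n : ℤ, ‖f n‖ ≤ B * ((1 + |(n : ℝ) + t|) ^ 2)⁻¹)
    (hC : ∑' n : ℤ, ((1 + |(n : ℝ) + t|) ^ 2)⁻¹ ≤ C) (hB : 0 ≤ B) :
    Summable f ∧ ‖∑' n, f n‖ ≤ B * C := by
  have hs := (summable_inv_one_add_abs_sq t).mul_left B
  have hn : Summable fun n => ‖f n‖ := Summable.of_nonneg_of_le (fun _ => norm_nonneg _) hf hs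
  refine ⟨hn.of_norm, (norm_tsum_le_tsum_norm hn).trans ((hn.tsum_le_tsum hf hs).trans ?_)⟩
  rw [tsum_mul_left]
  exact mul_le_mul_of_nonneg_left hC hB

theorem exists_norm_schwartz_le (A : SchwartzMap ℝ ℂ) :
    ∃ C, 0 ≤ C ∧ ∀ x, ‖A x‖ ≤ C * ((1 + |x|) ^ 2)⁻¹ := by
  obtain ⟨C, hC0, hC⟩ := exists_schwartz_bound A 2
  refine ⟨C, hC0.le, fun x => ?_⟩
  rw [← div_eq_mul_inv, le_div_iff₀ (by positivity)]
  exact hC x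

/-- The sum of `A` over the lattice. -/
def latticeSum (R E : ℝ) (A : SchwartzMap ℝ ℂ) (N : ℕ) : ℂ := ∑' n : ℤ, A (n + offset R E N)

theorem summable_lattice (R E : ℝ) (A : SchwartzMap ℝ ℂ) (N : ℕ) :
    Summable fun n : ℤ => A (n + offset R E N) := by
  obtain ⟨C, hC0, hC⟩ := exists_norm_schwartz_le A
  exact (norm_tsum_int_le (fun n => hC _) le_rfl hC0).1

theorem exists_norm_latticeSum_le (R E : ℝ) (A : SchwartzMap ℝ ℂ) :
    ∃ C, ∀ N, ‖latticeSum R E A N‖ ≤ C := by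
  obtain ⟨C, hC0, hC⟩ := exists_norm_schwartz_le A
  obtain ⟨K, -, hK⟩ := exists_tsum_inv_one_add_abs_sq_le
  exact ⟨C * K, fun N => (norm_tsum_int_le (fun n => hC _) (hK _) hC0).2⟩

/-- Away from the spectrum, where `n < 0`, a Schwartz function is negligible on the lattice. -/
theorem exists_norm_lattice_neg_le (hR : 0 < R) (hE : 1 < E) (A : SchwartzMap ℝ ℂ) (J : ℕ) :
    ∃ C, 0 ≤ C ∧ ∀ N : ℕ, N ≠ 0 → ∀ n : ℤ, n < 0 → ‖A (n + offset R E N)‖ ≤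
      C * (N : ℝ)⁻¹ ^ J * ((1 + |(n : ℝ) + offset R E N|) ^ 2)⁻¹ := by
  obtain ⟨C, hC0, hC⟩ := exists_schwartz_bound A (J + 2)
  -- The gap `δ` is positive since `E > 1`. For `n ≤ -1` the lattice point satisfies `s ≤ -δ N`, so
  -- extra decay of `A` in `s` gives arbitrary powers of `1/N`.
  set δ := R * speed R E - 1 / 2 with hδ
  have hδ0 : 0 < δ := sub_pos.2 (half_lt_mul_speed hR hE)
  refine ⟨C * (δ ^ J)⁻¹, by positivity, fun N hN n hn => ?_⟩
  have hN0 : (0 : ℝ) < N := by exact_mod_cast Nat.pos_of_ne_zero hN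
  set s := (n : ℝ) + offset R E N with hs
  have hn1 : (n : ℝ) ≤ -1 := by exact_mod_cast Int.le_sub_one_of_lt hn
  have h1 : δ * N ≤ 1 + |s| := by
    have h2 : δ * N ≤ -s := by
      rw [hs, offset, hδ]
      nlinarith
    linarith [neg_le_abs s]
  have h3 : (δ * N) ^ J ≤ (1 + |s|) ^ J := pow_le_pow_left₀ (by positivity) h1 J
  have h4 : ‖A s‖ * ((δ * N) ^ J * (1 + |s|) ^ 2) ≤ C := by
    refine le_trans ?_ (hC s)
    rw [pow_add]
    gcongr
  have h5 : C * (δ ^ J)⁻¹ * (N : ℝ)⁻¹ ^ J * ((1 + |s|) ^ 2)⁻¹ =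
      C / ((δ * N) ^ J * (1 + |s|) ^ 2) := by
    rw [mul_pow, inv_pow]
    field_simp
  rw [h5, le_div_iff₀ (by positivity)]
  exact h4

theorem tsum_nat_eq_tsum_int_ite {α : Type*} [AddCommMonoid α] [TopologicalSpace α]
    (f : ℤ → α) : ∑' n : ℕ, f n = ∑' n : ℤ, if 0 ≤ n then f n else 0 := by
  rw [← (Nat.cast_injective (R := ℤ)).tsum_eq (f := fun n : ℤ => if 0 ≤ n then f n else 0)]
  · exact tsum_congr fun n => (if_pos (Int.natCast_nonneg n)).symm
  · intro n hn
    have h0 : 0 ≤ n := by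
      by_contra h
      exact hn (if_neg h)
    exact ⟨n.toNat, Int.toNat_of_nonneg h0⟩

/-- The asymptotic expansion of the sum over the spectrum. -/
theorem exists_expansion_bound (hR : 0 < R) (hE : 1 < E) {b : ℕ → ℕ → ℝ × ℝ → ℝ}
    (hb : ∀ j l, b j l ∈ symbolAlgebra R E)
    (hb0 : b 0 0 = fun p => 2 * (R * speed R E + p.2 * p.1))
    (hd : ∀ φ j s ε, 0 < radicand R E (s, ε) →
      HasDerivAt (fun e => symbolSum R E (b j) φ j (s, e))
        (symbolSum R E (b (j + 1)) φ (j + 1) (s, ε)) ε) (φ : SchwartzMap ℝ ℂ)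
    {A : ℕ → SchwartzMap ℝ ℂ}
    (hA : ∀ j (s : ℝ), A j s = symbolSum R E (b j) φ j (s, 0) / (j.factorial : ℂ)) (J : ℕ) :
    ∃ C, ∀ N : ℕ, N ≠ 0 →
      ‖(∑' n : ℕ, (N + 2 * n + 1 : ℂ) * φ (√(energy R N n + (N : ℝ) ^ 2) - E * N)) -
        N * ∑ j ∈ Finset.range J, latticeSum R E (A j) N * (N : ℂ)⁻¹ ^ j‖ ≤
      C * (N * (N : ℝ)⁻¹ ^ J) := by
  obtain ⟨C₁, hC₁0, hC₁⟩ := exists_symbolSum_taylor_bound hR hE hb hd φ J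
  choose C₂ hC₂0 hC₂ using fun j => exists_norm_lattice_neg_le hR hE (A j) J
  obtain ⟨K, hK0, hK⟩ := exists_tsum_inv_one_add_abs_sq_le
  -- One constant for two sources of error: the Taylor remainder for `n ≥ 0`, and for `n < 0` the
  -- tails of the Schwartz functions `A j`, where there is no spectrum.
  set C := max C₁ (∑ j ∈ Finset.range J, C₂ j) with hC
  have hC0 : 0 ≤ C := hC₁0.trans (le_max_left _ _)
  refine ⟨C * K, fun N hN => ?_⟩
  have hN1 : (1 : ℝ) ≤ N := by exact_mod_cast Nat.one_le_iff_ne_zero.2 hN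
  -- The spectral summand is extended by zero to negative `n`, so that it can be compared with full
  -- lattice sums.
  set G : ℤ → ℂ := fun n =>
    if 0 ≤ n then symbolSum R E (b 0) φ 0 (n + offset R E N, (N : ℝ)⁻¹) else 0 with hG
  set S : ℤ → ℂ := fun n => ∑ j ∈ Finset.range J, A j (n + offset R E N) * (N : ℂ)⁻¹ ^ j with hS
  have hsum : (∑' n : ℕ, (N + 2 * n + 1 : ℂ) * φ (√(energy R N n + (N : ℝ) ^ 2) - E * N)) =
      N * ∑' n, G n := by
    rw [hG, ← tsum_nat_eq_tsum_int_ite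
      (fun n : ℤ => symbolSum R E (b 0) φ 0 (n + offset R E N, (N : ℝ)⁻¹)), ← tsum_mul_left]
    exact tsum_congr fun n => by
      simpa only [Int.cast_natCast] using mul_symbolSum_lattice hR hE hN n hb0 φ
  have hterm : ∀ n, ‖G n - S n‖ ≤
      C * (N : ℝ)⁻¹ ^ J * ((1 + |(n : ℝ) + offset R E N|) ^ 2)⁻¹ := by
    intro n
    rcases le_or_gt 0 n with hn | hn
    · lift n to ℕ using hn
      have h := hC₁ _ _ (admissible_lattice R E hN n)
      simp only [← hA, Complex.ofReal_inv, Complex.ofReal_natCast] at h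
      have e : G n = symbolSum R E (b 0) φ 0 (n + offset R E N, (N : ℝ)⁻¹) := by
        simp [hG]
      simp only [e, hS, Int.cast_natCast]
      refine h.trans ?_
      gcongr
      exact le_max_left _ _
    · have e : G n = 0 := if_neg (not_le.2 hn)
      rw [e, zero_sub, norm_neg]
      calc ‖S n‖ ≤ ∑ j ∈ Finset.range J,
            C₂ j * (N : ℝ)⁻¹ ^ J * ((1 + |(n : ℝ) + offset R E N|) ^ 2)⁻¹ := by
            refine norm_sum_le_of_le _ fun j _ => ?_
            rw [norm_mul]
            refine (mul_le_of_le_one_right (norm_nonneg _) ?_).trans (hC₂ j N hN n hn)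
            rw [norm_pow, norm_inv, Complex.norm_natCast]
            exact pow_le_one₀ (by positivity) (inv_le_one_of_one_le₀ hN1)
        _ ≤ _ := by
            rw [← Finset.sum_mul, ← Finset.sum_mul]
            gcongr
            exact le_max_right _ _
  have hSsum : HasSum S (∑ j ∈ Finset.range J, latticeSum R E (A j) N * (N : ℂ)⁻¹ ^ j) :=
    hasSum_sum fun j _ => (summable_lattice R E (A j) N).hasSum.mul_right _
  obtain ⟨h1, h2⟩ := norm_tsum_int_le hterm (hK _) (by positivity)
  have hGsum : Summable G := by simpa using h1.add hSsum.summable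
  rw [hsum, ← mul_sub, ← hSsum.tsum_eq, ← hGsum.tsum_sub hSsum.summable, norm_mul,
    Complex.norm_natCast]
  calc _ ≤ (N : ℝ) * (C * (N : ℝ)⁻¹ ^ J * K) := by gcongr
    _ = _ := by ring

theorem expansion_isBigO {Y : ℕ → ℂ} {c : ℕ → ℕ → ℂ} {J : ℕ} {C : ℝ}
    (h : ∀ N : ℕ, N ≠ 0 → ‖Y N - N * ∑ j ∈ Finset.range J, c j N * (N : ℂ)⁻¹ ^ j‖ ≤
      C * (N * (N : ℝ)⁻¹ ^ J)) :
    (fun N : ℕ => Y N - ∑ j ∈ Finset.range J, c j N * (N : ℂ) ^ (1 - (j : ℤ)))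
      =O[Filter.atTop] fun N : ℕ => (N : ℝ) ^ (1 - (J : ℤ)) := by
  refine Asymptotics.IsBigO.of_bound C ?_
  filter_upwards [Filter.eventually_ne_atTop 0] with N hN
  have hN0 : (N : ℂ) ≠ 0 := by exact_mod_cast hN
  have hN0' : (N : ℝ) ≠ 0 := by exact_mod_cast hN
  have e : ∑ j ∈ Finset.range J, c j N * (N : ℂ) ^ (1 - (j : ℤ)) =
      N * ∑ j ∈ Finset.range J, c j N * (N : ℂ)⁻¹ ^ j := by
    rw [Finset.mul_sum]
    refine Finset.sum_congr rfl fun j _ => ?_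
    rw [zpow_sub₀ hN0, zpow_one, zpow_natCast, inv_pow]
    ring
  have e' : ‖(N : ℝ) ^ (1 - (J : ℤ))‖ = N * (N : ℝ)⁻¹ ^ J := by
    rw [Real.norm_of_nonneg (by positivity), zpow_sub₀ hN0', zpow_one, zpow_natCast, inv_pow]
    ring
  rw [e, e']
  exact h N hN

/-! ### Explicit coefficients -/

theorem iterDeriv_fourier_dilate_intCast (hR : 0 < R) (hE : 1 < E) (φ : SchwartzMap ℝ ℂ) (l : ℕ)
    (k : ℤ) : iterDeriv l (𝓕 (dilate _ (slope_pos hR hE).ne' φ)) k =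
      ((speed R E / (R * E) : ℝ) : ℂ)⁻¹ * ((2 * Real.pi / (speed R E / (R * E)) : ℝ) : ℂ) ^ l *
        iteratedDeriv l (fourierHat φ) (period R E k) := by
  rw [iterDeriv_fourier_dilate _ _ (slope_pos hR hE), two_pi_div_slope_mul]

theorem IsPolynomialOperator.exists_fourier_dilate (hR : 0 < R) (hE : 1 < E)
    {T : SchwartzMap ℝ ℂ → SchwartzMap ℝ ℂ} (hT : IsPolynomialOperator T) :
    ∃ (d : ℕ) (q : ℕ → Polynomial ℂ), ∀ φ (k : ℤ),
      𝓕 (T (dilate _ (slope_pos hR hE).ne' φ)) (k : ℝ) = ∑ l ∈ Finset.range d,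
        (q l).eval (k : ℂ) * iteratedDeriv l (fourierHat φ) (period R E k) := by
  obtain ⟨d, q, -, hq⟩ := hT
  refine ⟨d, fun l => q l * Polynomial.C (((speed R E / (R * E) : ℝ) : ℂ)⁻¹ *
    ((2 * Real.pi / (speed R E / (R * E)) : ℝ) : ℂ) ^ l), fun φ k => ?_⟩
  rw [hq]
  refine Finset.sum_congr rfl fun l _ => ?_
  rw [iterDeriv_fourier_dilate_intCast hR hE, Polynomial.eval_mul, Polynomial.eval_C]
  push_cast
  ring

/-- The constant is `2 R D κ⁻¹ = 2 E R²`. -/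
theorem fourier_leading_operator (hR : 0 < R) (hE : 1 < E) {φ A : SchwartzMap ℝ ℂ}
    (hA : ∀ s : ℝ, A s = 2 * (R * speed R E) * φ (displacement R E (s, 0))) (k : ℤ) :
    𝓕 A (k : ℝ) = 2 * E * R ^ 2 * fourierHat φ (period R E k) := by
  have hD : (speed R E : ℂ) ≠ 0 := by exact_mod_cast (speed_pos hR hE).ne'
  have hE0 : (E : ℂ) ≠ 0 := by exact_mod_cast (zero_lt_one.trans hE).ne'
  have hR0 : (R : ℂ) ≠ 0 := by exact_mod_cast hR.ne'
  have e : A = (2 * (R * speed R E) : ℂ) • dilate _ (slope_pos hR hE).ne' φ := by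
    ext s
    rw [hA, smul_apply, dilate_apply, displacement_zero hE, smul_eq_mul]
  rw [e, FourierTransform.fourier_smul, smul_apply, fourier_dilate _ _ (slope_pos hR hE),
    two_pi_div_slope_mul, smul_eq_mul]
  push_cast
  field_simp

theorem fourier_subleading_operator (hR : 0 < R) (hE : 1 < E) {φ A : SchwartzMap ℝ ℂ}
    (hA : ∀ s : ℝ, A s = 2 * s * φ (displacement R E (s, 0)) +
      (2 * (R * speed R E) * ((s ^ 2 - 1 / 4) / (2 * R ^ 2 * E) -
        speed R E ^ 2 * s ^ 2 / (2 * R ^ 2 * E ^ 3)) : ℝ) *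
        iterDeriv 1 φ (displacement R E (s, 0))) (k : ℤ) :
    𝓕 A (k : ℝ) = 2 * Complex.I * R ^ 2 * deriv (fourierHat φ) (period R E k) -
      Real.pi * E * R * (4 * R ^ 2 - 1) * k / (2 * (speed R E : ℂ) ^ 3) *
        Complex.I * iteratedDeriv 2 (fourierHat φ) (period R E k) -
      Real.pi * Complex.I * E * R * k / (2 * (speed R E : ℂ)) * fourierHat φ (period R E k) := by
  have hD : (speed R E : ℂ) ≠ 0 := by exact_mod_cast (speed_pos hR hE).ne'
  have hE0 : (E : ℂ) ≠ 0 := by exact_mod_cast (zero_lt_one.trans hE).ne'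
  have hR0 : (R : ℂ) ≠ 0 := by exact_mod_cast hR.ne'
  have hpi : (Real.pi : ℂ) ≠ 0 := by exact_mod_cast Real.pi_ne_zero
  have hsq : 4 * (R : ℂ) ^ 2 * (speed R E : ℂ) ^ 2 = 4 * R ^ 2 * E ^ 2 - 4 * R ^ 2 + 1 := by
    have h := mul_speed_sq hR hE
    have h' : 4 * R ^ 2 * speed R E ^ 2 = 4 * R ^ 2 * E ^ 2 - 4 * R ^ 2 + 1 := by linarith
    exact_mod_cast h'
  set ψ := dilate _ (slope_pos hR hE).ne' φ with hψ
  -- In terms of the dilate `ψ`, whose derivative is `κ φ'(κ s)`, the coefficient is `2sψ + (1 -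
  -- D²/E²) s²ψ' - ψ'/4`.
  have e : A = (2 : ℂ) • mulX ψ +
      ((E ^ 2 - speed R E ^ 2) / E ^ 2 : ℂ) • mulX (mulX (derivCLM ℂ ℂ ψ)) +
      (-(1 / 4) : ℂ) • derivCLM ℂ ℂ ψ := by
    ext s
    have h1 : derivCLM ℂ ℂ ψ s = iterDeriv 1 ψ s := rfl
    rw [hA]
    simp only [add_apply, smul_apply, mulX_apply, smul_eq_mul]
    rw [h1, hψ, iterDeriv_dilate, dilate_apply, displacement_zero hE]
    push_cast
    field_simp
    ring
  have f0 := iterDeriv_fourier_dilate_intCast hR hE φ 0 k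
  have f1 := iterDeriv_fourier_dilate_intCast hR hE φ 1 k
  have f2 := iterDeriv_fourier_dilate_intCast hR hE φ 2 k
  rw [← hψ] at f0 f1 f2
  have f0' : 𝓕 ψ (k : ℝ) = iterDeriv 0 (𝓕 ψ) (k : ℝ) := rfl
  rw [e, FourierTransform.fourier_add, FourierTransform.fourier_add,
    FourierTransform.fourier_smul, FourierTransform.fourier_smul, FourierTransform.fourier_smul]
  simp only [add_apply, smul_apply, smul_eq_mul]
  rw [fourier_mulX, fourier_mulX_mulX_deriv, fourier_iterDeriv_one, f0', f0, f1, f2,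
    iteratedDeriv_one, iteratedDeriv_zero]
  push_cast
  generalize deriv (fourierHat φ) (period R E k) = f'
  generalize iteratedDeriv 2 (fourierHat φ) (period R E k) = f''
  generalize fourierHat φ (period R E k) = f
  -- This is the definition of `D`; it brings the coefficient of `φ̂''` to the stated form.
  have hsq' : (4 * R ^ 2 - 1 : ℂ) = 4 * R ^ 2 * (E ^ 2 - speed R E ^ 2) := by
    linear_combination hsq
  rw [hsq']
  field_simp
  ring

/-! ### The case `R = 1/2` and the theorem -/

theorem speed_half (hE : 1 < E) : speed (1 / 2) E = E := by
  have : E ^ 2 - 1 + 1 / (4 * (1 / 2) ^ 2) = E ^ 2 := by norm_num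
  rw [speed, this, Real.sqrt_sq (by linarith)]

theorem period_half (hE : 1 < E) (k : ℤ) : period (1 / 2) E k = Real.pi * k := by
  have : E ≠ 0 := by linarith
  rw [period, speed_half hE]
  field_simp

theorem phase_half (hE : 1 < E) (k : ℤ) (N : ℕ) :
    phase (1 / 2) E k N = Complex.exp (Real.pi * Complex.I * k * (N + 1)) *
      Complex.exp (-(Real.pi * Complex.I * k * E * N)) := by
  rw [phase, speed_half hE]
  congr 3
  push_cast
  ring

end

end Monopole

theorem theorem3p2 (R E : ℝ) (hR : 0 < R) (hE : 1 < E) :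
    (∀ N : ℕ, ∃ ν : ℕ → ℝ, Monopole.IsEigenvalueSequence R N ν) ∧
    ∃ (d : ℕ → ℕ) (q : ℕ → ℕ → Polynomial ℂ), ∀ φ : SchwartzMap ℝ ℂ, ∃ c : ℕ → ℕ → ℂ,
      (∀ ν : ℕ → ℕ → ℝ, (∀ N, Monopole.IsEigenvalueSequence R N (ν N)) →
        (∀ N, Summable (Monopole.traceTerm E φ N (ν N))) ∧
        ∀ J : ℕ, (fun N : ℕ => Monopole.traceSum E φ N (ν N) -
            ∑ j ∈ Finset.range J, c j N * (N : ℂ) ^ (1 - (j : ℤ)))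
          =O[Filter.atTop] fun N : ℕ => (N : ℝ) ^ (1 - (J : ℤ))) ∧
      (∀ j, ∃ C : ℝ, ∀ N, ‖c j N‖ ≤ C) ∧
      (∀ j N, HasSum (fun k : ℤ =>
          (∑ l ∈ Finset.range (d j), (q j l).eval (k : ℂ) *
            iteratedDeriv l (Monopole.fourierHat φ) (Monopole.period R E k)) *
          Monopole.phase R E k N) (c j N)) ∧
      (∀ N, HasSum (fun k : ℤ =>
          2 * E * R ^ 2 * Monopole.fourierHat φ (Monopole.period R E k) *
          Monopole.phase R E k N) (c 0 N)) ∧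
      (∀ N, HasSum (fun k : ℤ =>
          (2 * Complex.I * R ^ 2 * deriv (Monopole.fourierHat φ) (Monopole.period R E k) -
            Real.pi * E * R * (4 * R ^ 2 - 1) * k / (2 * (Monopole.speed R E : ℂ) ^ 3) *
              Complex.I * iteratedDeriv 2 (Monopole.fourierHat φ) (Monopole.period R E k) -
            Real.pi * Complex.I * E * R * k / (2 * (Monopole.speed R E : ℂ)) *
              Monopole.fourierHat φ (Monopole.period R E k)) *
          Monopole.phase R E k N) (c 1 N)) ∧
      (R = 1 / 2 →
        (∀ N : ℕ, HasSum (fun k : ℤ =>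
          E / 2 * Monopole.fourierHat φ (Real.pi * k) *
          (Complex.exp (Real.pi * Complex.I * k * (N + 1)) *
            Complex.exp (-(Real.pi * Complex.I * k * E * N)))) (c 0 N)) ∧
        (∀ N : ℕ, HasSum (fun k : ℤ =>
          (1 / 2 * Complex.I * deriv (Monopole.fourierHat φ) (Real.pi * k) -
            Real.pi * Complex.I * k / 4 * Monopole.fourierHat φ (Real.pi * k)) *
          (Complex.exp (Real.pi * Complex.I * k * (N + 1)) *
            Complex.exp (-(Real.pi * Complex.I * k * E * N)))) (c 1 N))) := by
  refine ⟨fun N => Monopole.exists_isEigenvalueSequence hR N, ?_⟩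
  obtain ⟨b, hb, hb00, hb10, hb11, hd⟩ := Monopole.exists_symbols hR hE
  obtain ⟨T, hT, hTe⟩ := Monopole.exists_operators hR hE hb
  choose d q hq using fun j => (hT j).exists_fourier_dilate hR hE
  refine ⟨d, q, fun φ => ?_⟩
  set A : ℕ → SchwartzMap ℝ ℂ :=
    fun j => T j (Monopole.dilate _ (Monopole.slope_pos hR hE).ne' φ) with hA
  have hA0 := Monopole.fourier_leading_operator hR hE (φ := φ) (A := A 0) fun s => by
    simp [hA, hTe, Monopole.symbolSum, hb00, Monopole.iterDeriv]
  have hA1 := Monopole.fourier_subleading_operator hR hE (φ := φ) (A := A 1) fun s => by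
    simp only [hA, hTe, Monopole.symbolSum, Finset.sum_range_succ, Finset.sum_range_zero, hb10,
      hb11, Monopole.iterDeriv, Nat.factorial_one, Nat.cast_one, div_one, zero_add,
      Complex.ofReal_mul, Complex.ofReal_ofNat]
  have hpoisson : ∀ j N, HasSum _ (Monopole.latticeSum R E (A j) N) :=
    fun j N => Monopole.hasSum_poisson R E (A j) N
  have h0 : ∀ N, HasSum (fun k : ℤ => 2 * E * R ^ 2 *
      Monopole.fourierHat φ (Monopole.period R E k) * Monopole.phase R E k N)
      (Monopole.latticeSum R E (A 0) N) := fun N => by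
    simpa only [hA0] using hpoisson 0 N
  have h1 := fun N => hpoisson 1 N
  simp only [hA1] at h1
  -- The coefficients `c_j` are the full lattice sums of `A j`. They are bounded in `N` by the
  -- uniform estimate over all offsets, and Poisson summation gives their series over `k`.
  refine ⟨fun j => Monopole.latticeSum R E (A j), fun ν hν => ⟨fun N =>
    (Monopole.hasSum_traceTerm hR (by linarith) φ (hν N)).summable, fun J => ?_⟩,
    fun j => Monopole.exists_norm_latticeSum_le R E (A j), fun j N => ?_, h0, h1, ?_⟩
  · obtain ⟨C, hC⟩ := Monopole.exists_expansion_bound hR hE hb hb00 hd φ (fun j s => hTe j φ s) J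
    refine Monopole.expansion_isBigO (C := C) fun N hN => ?_
    have h := hC N hN
    rwa [← (Monopole.hasSum_traceTerm hR (by linarith) φ (hν N)).tsum_eq] at h
  · simpa only [hA, hq] using hpoisson j N
  -- Here `D = E` and `4R² - 1 = 0`, so the periods are `πk` and the term with `φ̂''` disappears.
  · rintro rfl
    refine ⟨fun N => ?_, fun N => ?_⟩
    · convert! h0 N using 2 with k
      rw [Monopole.period_half hE, Monopole.phase_half hE]
      push_cast
      ring
    · convert! h1 N using 2 with k
      have : (E : ℂ) ≠ 0 := by exact_mod_cast (zero_lt_one.trans hE).ne'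
      rw [Monopole.period_half hE, Monopole.phase_half hE, Monopole.speed_half hE]
      push_cast
      field_simp
      ring
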